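/- Let $Y$ be a closed connected surface. For a linear Lie group $G$, a $G$-connection $(P,A)$ over $Y$ is a smooth principal $G$-bundle $P\to Y$ together with a connection $A$ on $P$; two $G$-connections are equivalent if there is a bundle isomorphism covering $\mathrm{id}_Y$ that carries one connection to the other. Let $\beta:U_2\to PU_2\cong SO_3$ be the projection followed by an isomorphism of Lie groups (any such choice), and write $\beta$ also for its restriction to $SU_2$; $(\beta P,\beta A)$ denotes the induced $SO_3$-connection. For a principal $\mathbb Z/2$-bundle $Z\to Y$ (with its unique connection) and an $SU_2$- or $U_2$-connection $(P,A)$, let $(Z\otimes P, Z\otimes A)=(Z\times_Y (P,A))/(\mathbb Z/2)$, where $\mathbb Z/2=\{\pm1\}$ acts diagonally, through multiplication by $\pm 1$ on $P$. For a $U_1$-connection $(T,a)$, a $U_2$-connection with determinant $(T,a)$ is a $U_2$-connection $(P,A)$ with an identification $(\mathrm{Det}\,P,\mathrm{Det}\,A)\cong(T,a)$, and two of these are equivalent if there is a connection preserving isomorphism $\phi$ with $\mathrm{Det}\,\phi=\mathrm{id}_T$. Since $\mathrm{Det}(Z\otimes P)=\mathrm{Det}\,P$ canonically, $[Z]\cdot[P,A]=[Z\otimes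 P,Z\otimes A]$ is an action of the isomorphism classes of $\mathbb Z/2$-bundles on the set of equivalence classes of $SU_2$-connections, and on the set of equivalence classes of $U_2$-connections with determinant $(T,a)$. The moduli space of flat $SU_2$-connections, and the moduli space of Yang–Mills $U_2$-connections with fixed Yang–Mills determinant $(T,a)$, are invariant subsets. **Proposition (Characterization of the Fixed Points).** Let $[P,A]$ be an equivalence class of $SU_2$-connections, or of $U_2$-connections with determinant $(T,a)$ for some $U_1$-connection $(T,a)$, and let $Z$ be a non-trivial principal $\mathbb Z/2$-bundle. Then $[P,A]$ is a fixed point of $[Z]$ if and only if $(\beta P,\beta A)$ can be reduced to an $O_2$-connection $(Q,B)$ (where $O_2\subset SO_3$ by $M\mapsto\mathrm{diag}(M,\det M)$) such that the orientation bundle $\mathrm{Det}\,Q$, the $\mathbb Z/2$-bundle associated to $Q$ through $\det:O_2\to\{\pm1\}$, is isomorphic to $Z$. The implication "if" holds for trivial $Z$ as well. -/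

import Mathlib

open scoped Manifold ContDiff
open Set

attribute [local instance] Matrix.linftyOpNormedRing Matrix.linftyOpNormedAlgebra

namespace GaugeTheory

universe u

section Analysis

variable {𝔸 : Type} [NormedRing 𝔸] [NormedAlgebra ℝ 𝔸] {𝔹 : Type} [NormedRing 𝔹] [NormedAlgebra ℝ 𝔹]

/-- The Lie algebra of a linear group `G` inside a normed algebra: the set of velocities at `1`
of smooth curves in `G`. -/
def lieSet (G : Subgroup 𝔸ˣ) : Set 𝔸 :=
  {X | ∃ γ : ℝ → G, ContDiff ℝ ∞ (fun t => ((γ t : 𝔸ˣ) : 𝔸)) ∧ γ 0 = 1 ∧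
    HasDerivAt (fun t => ((γ t : 𝔸ˣ) : 𝔸)) X 0}

/-- A homomorphism of linear groups which is the restriction of a smooth map `ext` between the
ambient algebras. -/
structure LinHom (G : Subgroup 𝔸ˣ) (H : Subgroup 𝔹ˣ) where
  hom : G →* H
  ext : 𝔸 → 𝔹
  smooth_ext : ContDiff ℝ ∞ ext
  ext_eq : ∀ g : G, ext ((g : 𝔸ˣ) : 𝔸) = ((hom g : 𝔹ˣ) : 𝔹)

variable {G : Subgroup 𝔸ˣ} {H : Subgroup 𝔹ˣ}

/-- Restriction of a smooth multiplicative map of the ambient algebras. -/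
def LinHom.ofMonoidHom (f : 𝔸 →* 𝔹) (hf : ContDiff ℝ ∞ f)
    (hGH : ∀ g ∈ G, Units.map f g ∈ H) : LinHom G H where
  hom := ((Units.map f).comp G.subtype).codRestrict H fun g => hGH g g.2
  ext := f
  smooth_ext := hf
  ext_eq _ := rfl

/-- The differential at the identity. -/
noncomputable def LinHom.diff (F : LinHom G H) : 𝔸 →L[ℝ] 𝔹 := fderiv ℝ F.ext 1

def LinHom.comp {𝔻 : Type} [NormedRing 𝔻] [NormedAlgebra ℝ 𝔻] {K : Subgroup 𝔻ˣ}
    (F' : LinHom H K) (F : LinHom G H) : LinHom G K where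
  hom := F'.hom.comp F.hom
  ext := F'.ext ∘ F.ext
  smooth_ext := F'.smooth_ext.comp F.smooth_ext
  ext_eq g := by simp [F.ext_eq, F'.ext_eq]

theorem LinHom.hasFDerivAt_one (F : LinHom G H) : HasFDerivAt F.ext F.diff 1 :=
  (F.smooth_ext.differentiable (by simp) 1).hasFDerivAt

theorem LinHom.diff_mem (F : LinHom G H) {X : 𝔸} (hX : X ∈ lieSet G) : F.diff X ∈ lieSet H := by
  obtain ⟨γ, h1, h2, h3⟩ := hX
  refine ⟨fun t => F.hom (γ t), ?_, by simp [h2], ?_⟩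
  · have := F.smooth_ext.comp h1
    simpa only [← F.ext_eq, Function.comp_def] using this
  · simp only [← F.ext_eq]
    have : HasFDerivAt F.ext F.diff ((γ 0 : 𝔸ˣ) : 𝔸) := by rw [h2]; exact F.hasFDerivAt_one
    exact this.comp_hasDerivAt (x := (0 : ℝ)) h3

theorem LinHom.diff_conj (F : LinHom G H) {X : 𝔸} (hX : X ∈ lieSet G) (g : G) :
    F.diff (((g⁻¹ : G) : 𝔸ˣ) * X * (g : 𝔸ˣ)) =
      ((((F.hom g)⁻¹ : H) : 𝔹ˣ) : 𝔹) * F.diff X * ((F.hom g : 𝔹ˣ) : 𝔹) := by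
  obtain ⟨γ, h1, h2, h3⟩ := hX
  have e1 : HasDerivAt (fun t => (((g⁻¹ * γ t * g : G) : 𝔸ˣ) : 𝔸))
      (((g⁻¹ : G) : 𝔸ˣ) * X * (g : 𝔸ˣ)) 0 := by
    simpa using (h3.const_mul (((g⁻¹ : G) : 𝔸ˣ) : 𝔸)).mul_const ((g : 𝔸ˣ) : 𝔸)
  have f1 : HasFDerivAt F.ext F.diff (((g⁻¹ * γ 0 * g : G) : 𝔸ˣ) : 𝔸) := by
    rw [h2]; simpa using F.hasFDerivAt_one
  have f0 : HasFDerivAt F.ext F.diff ((γ 0 : 𝔸ˣ) : 𝔸) := by rw [h2]; exact F.hasFDerivAt_one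
  have e2 := f1.comp_hasDerivAt (x := (0 : ℝ)) e1
  have e3 := ((f0.comp_hasDerivAt (x := (0 : ℝ)) h3).const_mul
    ((((F.hom g)⁻¹ : H) : 𝔹ˣ) : 𝔹)).mul_const ((F.hom g : 𝔹ˣ) : 𝔹)
  refine e2.unique (e3.congr_of_eventuallyEq (Filter.Eventually.of_forall fun t => ?_))
  simp only [Function.comp_apply, F.ext_eq]
  simp

variable {Y : Type u} [TopologicalSpace Y] [ChartedSpace (EuclideanSpace ℝ (Fin 2)) Y]

/-- Smoothness on `U` of a map from `Y` to the linear group `G`. -/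
def SmoothOn (h : Y → G) (U : Set Y) : Prop :=
  ContMDiffOn (𝓡 2) 𝓘(ℝ, 𝔸) ∞ (fun x => ((h x : 𝔸ˣ) : 𝔸)) U

/-- `h⁻¹ α h + h⁻¹ dh` at the point `x`, evaluated on the tangent vector `v`. -/
noncomputable def gaugeAt (h : Y → G) {x : Y} (α : TangentSpace (𝓡 2) x →L[ℝ] 𝔸)
    (v : TangentSpace (𝓡 2) x) : 𝔸 :=
  (((h x)⁻¹ : G) : 𝔸ˣ) * α v * ((h x : 𝔸ˣ) : 𝔸) +
    (((h x)⁻¹ : G) : 𝔸ˣ) * mvfderiv (𝓡 2) (fun y => ((h y : 𝔸ˣ) : 𝔸)) x v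

theorem SmoothOn.mdiff {h : Y → G} {U : Set Y} (hh : SmoothOn h U) (hU : IsOpen U) {x : Y}
    (hx : x ∈ U) : MDifferentiableAt (𝓡 2) 𝓘(ℝ, 𝔸) (fun y => ((h y : 𝔸ˣ) : 𝔸)) x :=
  (hh.contMDiffAt (hU.mem_nhds hx)).mdifferentiableAt (by simp)

theorem mvfderiv_ring_mul {f g : Y → 𝔸} {x : Y} (hf : MDifferentiableAt (𝓡 2) 𝓘(ℝ, 𝔸) f x)
    (hg : MDifferentiableAt (𝓡 2) 𝓘(ℝ, 𝔸) g x) (v : TangentSpace (𝓡 2) x) :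
    mvfderiv (𝓡 2) (fun y => f y * g y) x v =
      f x * mvfderiv (𝓡 2) g x v + mvfderiv (𝓡 2) f x v * g x := by
  have := (hf.hasMFDerivAt.mul' hg.hasMFDerivAt).mfderiv
  have h2 := congrArg (fun T => T v) this
  exact h2

theorem mvfderiv_fderiv_comp {f : Y → 𝔸} {x : Y} {Φ : 𝔸 → 𝔹} {L : 𝔸 →L[ℝ] 𝔹}
    (hf : MDifferentiableAt (𝓡 2) 𝓘(ℝ, 𝔸) f x) (hΦ : HasFDerivAt Φ L (f x))
    (v : TangentSpace (𝓡 2) x) :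
    mvfderiv (𝓡 2) (Φ ∘ f) x v = L (mvfderiv (𝓡 2) f x v) := by
  have := (hΦ.hasMFDerivAt.comp x hf.hasMFDerivAt).mfderiv
  exact congrArg (fun T => T v) this

theorem SmoothOn.mono {h : Y → G} {U V : Set Y} (hh : SmoothOn h U) (hV : V ⊆ U) : SmoothOn h V :=
  ContMDiffOn.mono hh hV

theorem SmoothOn.mul {h k : Y → G} {U : Set Y} (hh : SmoothOn h U) (hk : SmoothOn k U) :
    SmoothOn (fun x => h x * k x) U := by
  have : ContDiff ℝ ∞ (fun p : 𝔸 × 𝔸 => p.1 * p.2) := contDiff_fst.mul contDiff_snd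
  exact this.contMDiff.comp_contMDiffOn (ContMDiffOn.prodMk_space hh hk)

/-- Smoothness can be checked locally. -/
theorem SmoothOn.of_cover {h : Y → G} {U : Set Y} {κ : Type*}
    (V : κ → Set Y) (hV : ∀ k, IsOpen (V k)) (hc : ∀ x, ∃ k, x ∈ V k)
    (hs : ∀ k, SmoothOn h (U ∩ V k)) : SmoothOn h U := by
  intro x hx
  obtain ⟨k, hk⟩ := hc x
  exact ((hs k) x ⟨hx, hk⟩).mono_of_mem_nhdsWithin
    (Filter.inter_mem self_mem_nhdsWithin (mem_nhdsWithin_of_mem_nhds ((hV k).mem_nhds hk)))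

theorem SmoothOn.map (F : LinHom G H) {h : Y → G} {U : Set Y} (hh : SmoothOn h U) :
    SmoothOn (fun x => F.hom (h x)) U := by
  have := F.smooth_ext.contMDiff.comp_contMDiffOn hh
  refine this.congr fun x _ => ?_
  simp [F.ext_eq]

theorem SmoothOn.inv [CompleteSpace 𝔸] {h : Y → G} {U : Set Y} (hh : SmoothOn h U) :
    SmoothOn (fun x => (h x)⁻¹) U := by
  intro x hx
  have h1 := (contDiffAt_ringInverse ℝ (n := ∞) (h x : 𝔸ˣ)).contMDiffAt
  have := h1.comp_contMDiffWithinAt x (hh x hx)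
  refine this.congr (fun y _ => ?_) ?_ <;> simp

theorem gaugeAt_mul {h k : Y → G} {x : Y}
    (hh : MDifferentiableAt (𝓡 2) 𝓘(ℝ, 𝔸) (fun y => ((h y : 𝔸ˣ) : 𝔸)) x)
    (hk : MDifferentiableAt (𝓡 2) 𝓘(ℝ, 𝔸) (fun y => ((k y : 𝔸ˣ) : 𝔸)) x)
    (α β : TangentSpace (𝓡 2) x →L[ℝ] 𝔸) (v : TangentSpace (𝓡 2) x) (hβ : β v = gaugeAt h α v) :
    gaugeAt (fun y => h y * k y) α v = gaugeAt k β v := by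
  have := mvfderiv_ring_mul hh hk v
  simp only [gaugeAt, Subgroup.coe_mul, Units.val_mul, this, hβ, mul_inv_rev]
  have e : ((((h x)⁻¹ : G) : 𝔸ˣ) : 𝔸) * ((h x : 𝔸ˣ) : 𝔸) = 1 := by simp
  simp only [mul_add, add_mul, mul_assoc]
  rw [← mul_assoc ((((h x)⁻¹ : G) : 𝔸ˣ) : 𝔸) ((h x : 𝔸ˣ) : 𝔸) (mvfderiv _ _ _ _), e, one_mul]
  abel

theorem gaugeAt_one {x : Y} (α : TangentSpace (𝓡 2) x →L[ℝ] 𝔸) (v : TangentSpace (𝓡 2) x) :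
    gaugeAt (fun _ => (1 : G)) α v = α v := by
  simp [gaugeAt, mvfderiv_const]

theorem gaugeAt_inv [CompleteSpace 𝔸] {h : Y → G} {U : Set Y} (hU : IsOpen U) (hh : SmoothOn h U)
    {x : Y} (hx : x ∈ U) (α β : TangentSpace (𝓡 2) x →L[ℝ] 𝔸) (v : TangentSpace (𝓡 2) x)
    (hβ : β v = gaugeAt h α v) : α v = gaugeAt (fun y => (h y)⁻¹) β v := by
  rw [← gaugeAt_mul (hh.mdiff hU hx) (hh.inv.mdiff hU hx) α β v hβ]
  simp [gaugeAt_one]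

theorem gaugeAt_map (F : LinHom G H) {h : Y → G} {x : Y}
    (hh : MDifferentiableAt (𝓡 2) 𝓘(ℝ, 𝔸) (fun y => ((h y : 𝔸ˣ) : 𝔸)) x)
    (α : TangentSpace (𝓡 2) x →L[ℝ] 𝔸) (v : TangentSpace (𝓡 2) x) (hα : α v ∈ lieSet G) :
    gaugeAt (fun y => F.hom (h y)) (F.diff.comp α) v = F.diff (gaugeAt h α v) := by
  have key : F.diff ((((h x)⁻¹ : G) : 𝔸ˣ) * mvfderiv (𝓡 2) (fun y => ((h y : 𝔸ˣ) : 𝔸)) x v) =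
      ((((F.hom (h x))⁻¹ : H) : 𝔹ˣ) : 𝔹) *
        mvfderiv (𝓡 2) (fun y => ((F.hom (h y) : 𝔹ˣ) : 𝔹)) x v := by
    have hconst : MDifferentiableAt (𝓡 2) 𝓘(ℝ, 𝔸) (fun _ : Y => ((((h x)⁻¹ : G) : 𝔸ˣ) : 𝔸)) x :=
      mdifferentiableAt_const
    have hm := mvfderiv_ring_mul hconst hh v
    have hd : MDifferentiableAt (𝓡 2) 𝓘(ℝ, 𝔸)
        (fun y => ((((h x)⁻¹ : G) : 𝔸ˣ) : 𝔸) * ((h y : 𝔸ˣ) : 𝔸)) x := by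
      exact hconst.mul hh
    have hF : ∀ a : 𝔸, MDifferentiableAt 𝓘(ℝ, 𝔸) 𝓘(ℝ, 𝔹) F.ext a := fun a =>
      (F.smooth_ext.differentiable (by simp) a).mdifferentiableAt
    have hFh : MDifferentiableAt (𝓡 2) 𝓘(ℝ, 𝔹) (fun y => ((F.hom (h y) : 𝔹ˣ) : 𝔹)) x := by
      have := (hF _).comp x hh
      exact this.congr_of_eventuallyEq (Filter.Eventually.of_forall fun y => by simp [F.ext_eq])
    have hconst' : MDifferentiableAt (𝓡 2) 𝓘(ℝ, 𝔹)
        (fun _ : Y => ((((F.hom (h x))⁻¹ : H) : 𝔹ˣ) : 𝔹)) x := mdifferentiableAt_const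
    have hm' := mvfderiv_ring_mul hconst' hFh v
    rw [mvfderiv_const] at hm hm'
    have e : (fun y => ((((F.hom (h x))⁻¹ : H) : 𝔹ˣ) : 𝔹) * ((F.hom (h y) : 𝔹ˣ) : 𝔹)) =
        F.ext ∘ (fun y => ((((h x)⁻¹ : G) : 𝔸ˣ) : 𝔸) * ((h y : 𝔸ˣ) : 𝔸)) := by
      funext y
      have := F.ext_eq ((h x)⁻¹ * h y)
      simp only [map_mul, map_inv, Subgroup.coe_mul, Units.val_mul] at this
      exact this.symm
    have hone : ((((h x)⁻¹ : G) : 𝔸ˣ) : 𝔸) * ((h x : 𝔸ˣ) : 𝔸) = 1 := by simp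
    have e' := mvfderiv_fderiv_comp (L := F.diff) hd
      (by simpa only [hone] using F.hasFDerivAt_one) v
    rw [← e, hm', hm] at e'
    simpa using e'.symm
  simp only [gaugeAt, map_add, key, ContinuousLinearMap.comp_apply, ← F.diff_conj hα]

end Analysis

section Bundles

variable {𝔸 : Type} [NormedRing 𝔸] [NormedAlgebra ℝ 𝔸] {𝔹 : Type} [NormedRing 𝔹] [NormedAlgebra ℝ 𝔹]

variable (Y : Type u) [TopologicalSpace Y] [ChartedSpace (EuclideanSpace ℝ (Fin 2)) Y]

/-- A smooth principal `G`-bundle over the surface `Y`: a family of sets `Fib x`, each with a simply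
transitive right action of `G`, together with an atlas of local sections `sec i`, over open sets
`dom i` that cover `Y`, whose transition functions `(sec i)⁻¹ (sec j)` are smooth.
Only the values of `sec i` on `dom i` matter. -/
structure PrincipalBundle (G : Subgroup 𝔸ˣ) where
  Fib : Y → Type u
  act : ∀ {x : Y}, Fib x → G → Fib x
  act_one : ∀ {x : Y} (p : Fib x), act p 1 = p
  act_mul : ∀ {x : Y} (p : Fib x) (g h : G), act p (g * h) = act (act p g) h
  torsor : ∀ {x : Y} (p q : Fib x), ∃! g : G, act p g = q
  ι : Type u
  dom : ι → Set Y
  isOpen_dom : ∀ i, IsOpen (dom i)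
  cover : ∀ x, ∃ i, x ∈ dom i
  sec : ι → ∀ x, Fib x
  smooth_sec : ∀ i j, ∃ g : Y → G, SmoothOn g (dom i ∩ dom j) ∧
    ∀ x, act (sec i x) (g x) = sec j x

variable {Y} {G : Subgroup 𝔸ˣ} {H : Subgroup 𝔹ˣ}

namespace PrincipalBundle

/-- The translation carrying `p` to `q`: the unique `g` with `p g = q`. -/
noncomputable def div (P : PrincipalBundle Y G) {x : Y} (p q : P.Fib x) : G :=
  (P.torsor p q).choose

@[simp] theorem act_div (P : PrincipalBundle Y G) {x : Y} (p q : P.Fib x) :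
    P.act p (P.div p q) = q := (P.torsor p q).choose_spec.1

theorem div_eq (P : PrincipalBundle Y G) {x : Y} {p q : P.Fib x} {g : G} (h : P.act p g = q) :
    P.div p q = g := ((P.torsor p q).choose_spec.2 g h).symm

theorem act_inj (P : PrincipalBundle Y G) {x : Y} {p : P.Fib x} {g h : G}
    (e : P.act p g = P.act p h) : g = h := by
  rw [← P.div_eq e, P.div_eq rfl]

theorem div_self (P : PrincipalBundle Y G) {x : Y} (p : P.Fib x) : P.div p p = 1 :=
  P.div_eq (P.act_one p)

/-- The transition function from the section `i` to the section `j`. -/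
noncomputable def trans (P : PrincipalBundle Y G) (i j : P.ι) (x : Y) : G :=
  P.div (P.sec i x) (P.sec j x)

theorem act_trans (P : PrincipalBundle Y G) (i j : P.ι) (x : Y) :
    P.act (P.sec i x) (P.trans i j x) = P.sec j x := P.act_div _ _

theorem smooth_trans (P : PrincipalBundle Y G) (i j : P.ι) :
    SmoothOn (P.trans i j) (P.dom i ∩ P.dom j) := by
  obtain ⟨g, hg, h⟩ := P.smooth_sec i j
  have : P.trans i j = g := funext fun x => P.div_eq (h x)
  rwa [this]

/-- A bundle isomorphism (gauge transformation) covering the identity of `Y`: fibrewise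
equivariant, and smooth in the local sections. -/
@[ext] structure Iso (P P' : PrincipalBundle Y G) where
  toFun : ∀ {x : Y}, P.Fib x → P'.Fib x
  equivariant : ∀ {x : Y} (p : P.Fib x) (g : G), toFun (P.act p g) = P'.act (toFun p) g
  smooth : ∀ i j, SmoothOn (fun x => P'.div (P'.sec j x) (toFun (P.sec i x)))
    (P.dom i ∩ P'.dom j)

/-- The local expression of an isomorphism: `φ (sec i) = (sec' j) · (φ.rep i j)`. -/
noncomputable def Iso.rep {P P' : PrincipalBundle Y G} (φ : Iso P P') (i : P.ι) (j : P'.ι)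
    (x : Y) : G :=
  P'.div (P'.sec j x) (φ.toFun (P.sec i x))

end PrincipalBundle

open PrincipalBundle

namespace PrincipalBundle.Iso

theorem act_rep {P P' : PrincipalBundle Y G} (φ : Iso P P') (i j) (x : Y) :
    P'.act (P'.sec j x) (φ.rep i j x) = φ.toFun (P.sec i x) := P'.act_div _ _

def refl (P : PrincipalBundle Y G) : Iso P P where
  toFun p := p
  equivariant _ _ := rfl
  smooth i j := by
    rw [inter_comm]
    exact P.smooth_trans j i

theorem rep_trans {P P' P'' : PrincipalBundle Y G} (φ : Iso P P') (ψ : Iso P' P'') (i j k)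
    (x : Y) : P''.div (P''.sec k x) (ψ.toFun (φ.toFun (P.sec i x))) =
      ψ.rep j k x * φ.rep i j x := by
  apply P''.div_eq
  rw [P''.act_mul, ψ.act_rep, ← ψ.equivariant, φ.act_rep]

def trans {P P' P'' : PrincipalBundle Y G} (φ : Iso P P') (ψ : Iso P' P'') : Iso P P'' where
  toFun p := ψ.toFun (φ.toFun p)
  equivariant p g := by rw [φ.equivariant, ψ.equivariant]
  smooth i k := by
    refine SmoothOn.of_cover P'.dom P'.isOpen_dom P'.cover fun j => ?_
    have e : (fun x => P''.div (P''.sec k x) (ψ.toFun (φ.toFun (P.sec i x)))) =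
      fun x => ψ.rep j k x * φ.rep i j x := funext fun x => rep_trans φ ψ i j k x
    rw [e]
    exact ((ψ.smooth j k).mono fun x hx => ⟨hx.2, hx.1.2⟩).mul
      ((φ.smooth i j).mono fun x hx => ⟨hx.1.1, hx.2⟩)

theorem bijective {P P' : PrincipalBundle Y G} (φ : Iso P P') (x : Y) :
    Function.Bijective (φ.toFun : P.Fib x → P'.Fib x) := by
  constructor
  · intro p q h
    have e : φ.toFun q = P'.act (φ.toFun p) (P.div p q) := by rw [← φ.equivariant, P.act_div]
    rw [← h] at e
    have : (1 : G) = P.div p q := P'.act_inj ((P'.act_one _).trans e)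
    rw [← P.act_div p q, ← this, P.act_one]
  · intro q
    obtain ⟨i, -⟩ := P.cover x
    refine ⟨P.act (P.sec i x) (P'.div (φ.toFun (P.sec i x)) q), ?_⟩
    rw [φ.equivariant, P'.act_div]

noncomputable def invFun {P P' : PrincipalBundle Y G} (φ : Iso P P') {x : Y} (q : P'.Fib x) :
    P.Fib x := ((φ.bijective x).2 q).choose

@[simp] theorem toFun_invFun {P P' : PrincipalBundle Y G} (φ : Iso P P') {x : Y} (q : P'.Fib x) :
    φ.toFun (φ.invFun q) = q := ((φ.bijective x).2 q).choose_spec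

theorem invFun_equivariant {P P' : PrincipalBundle Y G} (φ : Iso P P') {x : Y} (q : P'.Fib x)
    (g : G) : φ.invFun (P'.act q g) = P.act (φ.invFun q) g := by
  apply (φ.bijective x).1
  rw [φ.equivariant, toFun_invFun, toFun_invFun]

theorem rep_symm {P P' : PrincipalBundle Y G} (φ : Iso P P') (i j) (x : Y) :
    P.div (P.sec i x) (φ.invFun (P'.sec j x)) = (φ.rep i j x)⁻¹ := by
  apply P.div_eq
  apply (φ.bijective x).1
  rw [φ.equivariant, toFun_invFun, ← φ.act_rep i j, ← P'.act_mul, mul_inv_cancel, P'.act_one]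

variable [CompleteSpace 𝔸]

noncomputable def symm {P P' : PrincipalBundle Y G} (φ : Iso P P') : Iso P' P where
  toFun := φ.invFun
  equivariant := φ.invFun_equivariant
  smooth j i := by
    have e : (fun x => P.div (P.sec i x) (φ.invFun (P'.sec j x))) = fun x => (φ.rep i j x)⁻¹ :=
      funext fun x => rep_symm φ i j x
    rw [e, inter_comm]
    exact SmoothOn.inv (φ.smooth i j)

end PrincipalBundle.Iso

/-! Change of structure group. -/

namespace PrincipalBundle

variable (F : LinHom G H) (P : PrincipalBundle Y G)

/-- Pairs `(p, h)` modulo `(p g, h) ∼ (p, F(g) h)`. -/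
def pushSetoid (x : Y) : Setoid (P.Fib x × H) where
  r a b := ∃ g : G, P.act b.1 g = a.1 ∧ b.2 = F.hom g * a.2
  iseqv := {
    refl := fun a => ⟨1, P.act_one _, by simp⟩
    symm := by
      rintro ⟨p, h⟩ ⟨q, k⟩ ⟨g, h1, h2⟩
      refine ⟨g⁻¹, ?_, ?_⟩
      · simp only at h1 ⊢
        rw [← h1, ← P.act_mul, mul_inv_cancel, P.act_one]
      · simp only at h2 ⊢
        rw [h2]; simp
    trans := by
      rintro ⟨p, h⟩ ⟨q, k⟩ ⟨r, l⟩ ⟨g, h1, h2⟩ ⟨g', h1', h2'⟩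
      refine ⟨g' * g, ?_, ?_⟩
      · simp only at h1 h1' ⊢
        rw [P.act_mul, h1', h1]
      · simp only at h2 h2' ⊢
        rw [h2', h2, map_mul, mul_assoc] }

/-- The class `[p, h]` in the associated bundle. -/
def pushMk {x : Y} (p : P.Fib x) (h : H) : Quotient (P.pushSetoid F x) :=
  Quotient.mk _ (p, h)

theorem pushMk_act {x : Y} (p : P.Fib x) (g : G) (h : H) :
    P.pushMk F (P.act p g) h = P.pushMk F p (F.hom g * h) :=
  Quotient.sound ⟨g, rfl, rfl⟩

theorem pushMk_inj {x : Y} {p : P.Fib x} {h k : H} (e : P.pushMk F p h = P.pushMk F p k) :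
    h = k := by
  obtain ⟨g, h1, h2⟩ := Quotient.exact e
  have : g = 1 := P.act_inj (h1.trans (P.act_one _).symm)
  simp only [this, map_one, one_mul] at h2
  exact h2.symm

/-- The bundle `P ×_G H` associated to `P` through `F : G → H`. -/
def push : PrincipalBundle Y H where
  Fib x := Quotient (P.pushSetoid F x)
  act {x} c k := Quotient.map (fun a : P.Fib x × H => (a.1, a.2 * k))
    (by rintro a b ⟨g, h1, h2⟩; exact ⟨g, h1, by simp only [h2, mul_assoc]⟩) c
  act_one c := by
    induction c using Quotient.inductionOn with
    | h a => simp
  act_mul c g h := by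
    induction c using Quotient.inductionOn with
    | h a => simp [mul_assoc]
  torsor {x} c d := by
    induction c using Quotient.inductionOn with
    | h a =>
    induction d using Quotient.inductionOn with
    | h b =>
    obtain ⟨p, h⟩ := a
    obtain ⟨q, k⟩ := b
    refine ⟨h⁻¹ * (F.hom (P.div p q) * k), ?_, ?_⟩
    · change P.pushMk F p _ = P.pushMk F q k
      rw [mul_inv_cancel_left, ← pushMk_act, P.act_div]
    · intro g hg
      change P.pushMk F p (h * g) = P.pushMk F q k at hg
      conv_rhs at hg => rw [← P.act_div p q, pushMk_act]
      rw [← P.pushMk_inj F hg, inv_mul_cancel_left]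
  ι := P.ι
  dom := P.dom
  isOpen_dom := P.isOpen_dom
  cover := P.cover
  sec i x := P.pushMk F (P.sec i x) 1
  smooth_sec i j := by
    refine ⟨fun x => F.hom (P.trans i j x), (P.smooth_trans i j).map F, fun x => ?_⟩
    change P.pushMk F (P.sec i x) (1 * F.hom _) = P.pushMk F (P.sec j x) 1
    rw [one_mul, ← mul_one (F.hom _), ← pushMk_act, trans, P.act_div]

theorem push_act {x : Y} (p : P.Fib x) (h k : H) :
    (P.push F).act (P.pushMk F p h) k = P.pushMk F p (h * k) := rfl

theorem push_div {x : Y} (p : P.Fib x) (g : G) (h k : H) :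
    (P.push F).div (P.pushMk F p h) (P.pushMk F (P.act p g) k) = h⁻¹ * (F.hom g * k) := by
  apply div_eq
  rw [push_act, mul_inv_cancel_left, pushMk_act]

theorem push_trans (i j : P.ι) : @trans _ _ _ _ _ _ _ (P.push F) i j = fun x => F.hom (P.trans i j x) := by
  funext x
  have := P.push_div F (P.sec i x) (P.trans i j x) 1 1
  rw [P.act_trans] at this
  exact this.trans (by simp)

/-- A fibrewise map `f : P → R`, smooth in the local sections, with `f (p g) = f p F(g)`, induces
an isomorphism from the associated bundle to `R`. -/
def Iso.ofEquivariant {R : PrincipalBundle Y H} (f : ∀ {x : Y}, P.Fib x → R.Fib x)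
    (hf : ∀ {x : Y} (p : P.Fib x) (g : G), f (P.act p g) = R.act (f p) (F.hom g))
    (hs : ∀ i j, SmoothOn (fun x => R.div (R.sec j x) (f (P.sec i x))) (P.dom i ∩ R.dom j)) :
    Iso (P.push F) R where
  toFun {x} c := Quotient.lift (fun a : P.Fib x × H => R.act (f a.1) a.2)
    (by
      rintro ⟨p, h⟩ ⟨q, k⟩ ⟨g, h1, h2⟩
      simp only at h1 h2
      subst h1 h2
      simp only [hf, R.act_mul]) c
  equivariant {x} c g := by
    induction c using Quotient.inductionOn with
    | h a => exact R.act_mul _ _ _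
  smooth i j := by
    refine (hs i j).congr fun x _ => ?_
    change (((R.div (R.sec j x) (R.act (f (P.sec i x)) 1) : H) : 𝔹ˣ) : 𝔹) = _
    rw [R.act_one]

variable {P}

/-- The isomorphism of associated bundles induced by an isomorphism. -/
def Iso.push {P' : PrincipalBundle Y G} (φ : Iso P P') : Iso (P.push F) (P'.push F) :=
  Iso.ofEquivariant F P (R := P'.push F) (fun p => P'.pushMk F (φ.toFun p) 1)
    (fun p g => by rw [φ.equivariant, pushMk_act, push_act, one_mul, mul_one])
    (fun (i : P.ι) (j : P'.ι) => by
      refine ((φ.smooth i j).map F).congr fun x _ => ?_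
      have := P'.push_div F (P'.sec j x) (φ.rep i j x) 1 1
      rw [φ.act_rep] at this
      exact congrArg (fun h : H => ((h : 𝔹ˣ) : 𝔹)) (this.trans (by simp [Iso.rep])))

end PrincipalBundle

/-! Tensoring with a `ℤ/2`-bundle. -/

/-- The group `ℤ/2 = {1, -1}`. -/
abbrev Z2 : Subgroup ℝˣ := rootsOfUnity 2 ℝ

/-- The group contains the central elements `±1`. -/
class HasNegOne (G : Subgroup 𝔸ˣ) : Prop where
  neg_one_mem : (-1 : 𝔸ˣ) ∈ G

theorem Z2.eq_or (e : Z2) : (e : ℝˣ) = 1 ∨ (e : ℝˣ) = -1 := by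
  have h : (e : ℝˣ) ^ 2 = 1 := (mem_rootsOfUnity 2 _).1 e.2
  have h2 : ((e : ℝˣ) : ℝ) ^ 2 = 1 := by
    rw [← Units.val_pow_eq_pow_val, h, Units.val_one]
  rw [sq] at h2
  rcases mul_self_eq_one_iff.1 h2 with h | h
  · exact Or.inl (Units.ext h)
  · exact Or.inr (Units.ext (by simpa using h))

/-- The homomorphism `±1 ↦ ±1` from `ℤ/2` to the centre of `G`. -/
noncomputable def sgn (G : Subgroup 𝔸ˣ) [HasNegOne G] : LinHom Z2 G :=
  LinHom.ofMonoidHom (algebraMap ℝ 𝔸 : ℝ →* 𝔸) (algebraMapCLM ℝ 𝔸).contDiff (by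
    intro e he
    rcases Z2.eq_or ⟨e, he⟩ with h | h
    · simp only at h
      rw [h, map_one]
      exact one_mem G
    · simp only at h
      have : Units.map (algebraMap ℝ 𝔸 : ℝ →* 𝔸) e = -1 := by
        rw [h]; ext; simp
      rw [this]
      exact HasNegOne.neg_one_mem)

section Sign

variable [HasNegOne G]

theorem sgn_val (e : Z2) :
    (((sgn G).hom e : 𝔸ˣ) : 𝔸) = algebraMap ℝ 𝔸 ((e : ℝˣ) : ℝ) := rfl

theorem sgn_comm (e : Z2) (g : G) : (sgn G).hom e * g = g * (sgn G).hom e := by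
  ext
  simp only [Subgroup.coe_mul, Units.val_mul, sgn_val]
  exact Algebra.commutes _ _

theorem gaugeAt_sgn {e : Y → Z2} {U : Set Y} (hU : IsOpen U) (he : SmoothOn e U) {x : Y}
    (hx : x ∈ U) (α : TangentSpace (𝓡 2) x →L[ℝ] 𝔸) (v : TangentSpace (𝓡 2) x) :
    α v = gaugeAt (fun y => (sgn G).hom (e y)) α v := by
  have hd := he.mdiff hU hx
  have h0 : mvfderiv (𝓡 2) (fun y => ((e y : ℝˣ) : ℝ)) x v = 0 := by
    have h1 := mvfderiv_ring_mul hd hd v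
    have h2 : (fun y => ((e y : ℝˣ) : ℝ) * ((e y : ℝˣ) : ℝ)) = fun _ => (1 : ℝ) := by
      funext y
      rcases Z2.eq_or (e y) with h | h <;> simp [h]
    rw [h2, mvfderiv_const] at h1
    rcases Z2.eq_or (e x) with h | h <;> simp [h] at h1 <;> linarith
  have h3 := mvfderiv_fderiv_comp (Φ := algebraMapCLM ℝ 𝔸) hd
    (algebraMapCLM ℝ 𝔸).hasFDerivAt v
  rw [h0, map_zero] at h3
  have h4 : mvfderiv (𝓡 2) (fun y => (((sgn G).hom (e y) : 𝔸ˣ) : 𝔸)) x v = 0 := h3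
  rw [gaugeAt, h4, mul_zero, add_zero, mul_assoc, sgn_val, ← Algebra.commutes, ← sgn_val (G := G),
    ← mul_assoc]
  simp

end Sign

namespace PrincipalBundle

variable [HasNegOne G]

/-- The diagonal action of `ℤ/2` on the fibre product of `Z` and `P`. -/
def tensorSetoid (Z : PrincipalBundle Y Z2) (P : PrincipalBundle Y G) (x : Y) :
    Setoid (Z.Fib x × P.Fib x) where
  r a b := ∃ e : Z2, Z.act b.1 e = a.1 ∧ P.act b.2 ((sgn G).hom e) = a.2
  iseqv := {
    refl := fun a => ⟨1, Z.act_one _, by rw [map_one, P.act_one]⟩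
    symm := by
      rintro ⟨z, p⟩ ⟨w, q⟩ ⟨e, h1, h2⟩
      refine ⟨e⁻¹, ?_, ?_⟩
      · simp only at h1 ⊢
        rw [← h1, ← Z.act_mul, mul_inv_cancel, Z.act_one]
      · simp only at h2 ⊢
        rw [← h2, ← P.act_mul, map_inv, mul_inv_cancel, P.act_one]
    trans := by
      rintro ⟨z, p⟩ ⟨w, q⟩ ⟨y, r⟩ ⟨e, h1, h2⟩ ⟨e', h1', h2'⟩
      refine ⟨e' * e, ?_, ?_⟩
      · simp only at h1 h1' ⊢
        rw [Z.act_mul, h1', h1]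
      · simp only at h2 h2' ⊢
        rw [map_mul, P.act_mul, h2', h2] }

variable (Z : PrincipalBundle Y Z2) (P : PrincipalBundle Y G)

/-- The class `z ⊗ p`. -/
def tensorMk {x : Y} (z : Z.Fib x) (p : P.Fib x) : Quotient (tensorSetoid Z P x) :=
  Quotient.mk _ (z, p)

theorem tensorMk_act {x : Y} (z : Z.Fib x) (p : P.Fib x) (e : Z2) :
    tensorMk Z P (Z.act z e) p = tensorMk Z P z (P.act p ((sgn G).hom e)) := by
  refine Quotient.sound ⟨e, ?_, ?_⟩
  · rfl
  · have h : e * e = 1 := by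
      have := (mem_rootsOfUnity 2 _).1 e.2
      ext1
      rw [Subgroup.coe_mul, ← sq, this, Subgroup.coe_one]
    simp only
    rw [← P.act_mul, ← map_mul, h, map_one, P.act_one]

theorem tensorMk_inj {x : Y} {z : Z.Fib x} {p q : P.Fib x}
    (e : tensorMk Z P z p = tensorMk Z P z q) : p = q := by
  obtain ⟨g, h1, h2⟩ := Quotient.exact e
  have : g = 1 := Z.act_inj (h1.trans (Z.act_one _).symm)
  simp only [this, map_one, P.act_one] at h2
  exact h2.symm

/-- The bundle `Z ⊗ P = (Z ×_Y P) / (ℤ/2)`. -/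
noncomputable def tensor : PrincipalBundle Y G where
  Fib x := Quotient (tensorSetoid Z P x)
  act {x} c g := Quotient.map (fun a : Z.Fib x × P.Fib x => (a.1, P.act a.2 g))
    (by
      rintro a b ⟨e, h1, h2⟩
      exact ⟨e, h1, by simp only [← h2, ← P.act_mul, sgn_comm]⟩) c
  act_one c := by
    induction c using Quotient.inductionOn with
    | h a => simp [P.act_one]
  act_mul c g h := by
    induction c using Quotient.inductionOn with
    | h a => simp [P.act_mul]
  torsor {x} c d := by
    induction c using Quotient.inductionOn with
    | h a =>
    induction d using Quotient.inductionOn with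
    | h b =>
    obtain ⟨z, p⟩ := a
    obtain ⟨w, q⟩ := b
    have hd : tensorMk Z P w q = tensorMk Z P z (P.act q ((sgn G).hom (Z.div z w))) := by
      rw [← tensorMk_act, Z.act_div]
    refine ⟨P.div p (P.act q ((sgn G).hom (Z.div z w))), ?_, ?_⟩
    · change tensorMk Z P z (P.act p _) = tensorMk Z P w q
      rw [P.act_div, hd]
    · intro g hg
      change tensorMk Z P z (P.act p g) = tensorMk Z P w q at hg
      exact (P.div_eq (tensorMk_inj Z P (hg.trans hd))).symm
  ι := Z.ι × P.ι
  dom i := Z.dom i.1 ∩ P.dom i.2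
  isOpen_dom i := (Z.isOpen_dom i.1).inter (P.isOpen_dom i.2)
  cover x := by
    obtain ⟨a, ha⟩ := Z.cover x
    obtain ⟨i, hi⟩ := P.cover x
    exact ⟨(a, i), ha, hi⟩
  sec i x := tensorMk Z P (Z.sec i.1 x) (P.sec i.2 x)
  smooth_sec i j := by
    refine ⟨fun x => (sgn G).hom (Z.trans i.1 j.1 x) * P.trans i.2 j.2 x,
      SmoothOn.mul (((Z.smooth_trans i.1 j.1).map (sgn G)).mono fun x hx => ⟨hx.1.1, hx.2.1⟩)
        ((P.smooth_trans i.2 j.2).mono fun x hx => ⟨hx.1.2, hx.2.2⟩), fun x => ?_⟩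
    change tensorMk Z P (Z.sec i.1 x) (P.act (P.sec i.2 x)
      ((sgn G).hom (Z.trans i.1 j.1 x) * P.trans i.2 j.2 x)) = tensorMk Z P _ _
    rw [sgn_comm, P.act_mul, ← tensorMk_act, P.act_trans, Z.act_trans]

theorem tensor_act {x : Y} (z : Z.Fib x) (p : P.Fib x) (g : G) :
    (tensor Z P).act (tensorMk Z P z p) g = tensorMk Z P z (P.act p g) := rfl

theorem tensor_div {x : Y} (z : Z.Fib x) (p : P.Fib x) (e : Z2) (g : G) :
    (tensor Z P).div (tensorMk Z P z p) (tensorMk Z P (Z.act z e) (P.act p g)) =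
      (sgn G).hom e * g := by
  apply div_eq
  rw [tensor_act, tensorMk_act, sgn_comm, P.act_mul]

theorem tensor_trans (i j : Z.ι × P.ι) : @trans _ _ _ _ _ _ _ (tensor Z P) i j =
    fun x => (sgn G).hom (Z.trans i.1 j.1 x) * P.trans i.2 j.2 x := by
  funext x
  have := tensor_div Z P (Z.sec i.1 x) (P.sec i.2 x) (Z.trans i.1 j.1 x) (P.trans i.2 j.2 x)
  rw [P.act_trans, Z.act_trans] at this
  exact this

variable {Z P}

theorem tensor_rep {Z' : PrincipalBundle Y Z2} {P' : PrincipalBundle Y G} (f : Iso Z Z')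
    (φ : Iso P P') (i : Z.ι × P.ι) (j : Z'.ι × P'.ι) (x : Y) :
    (tensor Z' P').div (tensorMk Z' P' (Z'.sec j.1 x) (P'.sec j.2 x))
      (tensorMk Z' P' (f.toFun (Z.sec i.1 x)) (φ.toFun (P.sec i.2 x))) =
    (sgn G).hom (f.rep i.1 j.1 x) * φ.rep i.2 j.2 x := by
  have := tensor_div Z' P' (Z'.sec j.1 x) (P'.sec j.2 x) (f.rep i.1 j.1 x) (φ.rep i.2 j.2 x)
  rwa [f.act_rep, φ.act_rep] at this

/-- The isomorphism `f ⊗ φ`. -/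
noncomputable def Iso.tensor {Z' : PrincipalBundle Y Z2} {P' : PrincipalBundle Y G} (f : Iso Z Z')
    (φ : Iso P P') : Iso (tensor Z P) (tensor Z' P') where
  toFun {x} c := Quotient.map (fun a : Z.Fib x × P.Fib x => (f.toFun a.1, φ.toFun a.2))
    (by
      rintro a b ⟨e, h1, h2⟩
      exact ⟨e, by simp only [← h1, f.equivariant], by simp only [← h2, φ.equivariant]⟩) c
  equivariant {x} c g := by
    induction c using Quotient.inductionOn with
    | h a => exact congrArg (tensorMk Z' P' (f.toFun a.1)) (φ.equivariant a.2 g)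
  smooth i j := by
    refine (SmoothOn.mul (((f.smooth i.1 j.1).map (sgn G)).mono fun x hx => ⟨hx.1.1, hx.2.1⟩)
      ((φ.smooth i.2 j.2).mono fun x hx => ⟨hx.1.2, hx.2.2⟩)).congr fun x _ => ?_
    exact congrArg (fun h : G => ((h : 𝔸ˣ) : 𝔸)) (tensor_rep f φ i j x)

/-- If `F` is trivial on `±1`, then `z ⊗ p ↦ p` induces an isomorphism between the bundles
associated to `Z ⊗ P` and to `P` through `F`. -/
noncomputable def tensorPushIso (Z : PrincipalBundle Y Z2) (P : PrincipalBundle Y G)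
    (F : LinHom G H) (hF : ∀ e, F.hom ((sgn G).hom e) = 1) :
    Iso ((tensor Z P).push F) (P.push F) :=
  Iso.ofEquivariant F (tensor Z P) (R := P.push F)
    (fun {x} c => Quotient.lift (fun a : Z.Fib x × P.Fib x => P.pushMk F a.2 1)
      (by
        rintro a b ⟨e, h1, h2⟩
        change P.pushMk F a.2 1 = P.pushMk F b.2 1
        rw [← h2, pushMk_act, hF, one_mul]) c)
    (fun {x} c g => by
      induction c using Quotient.inductionOn with
      | h a =>
        change P.pushMk F (P.act a.2 g) 1 = (P.push F).act (P.pushMk F a.2 1) (F.hom g)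
        rw [pushMk_act, push_act, one_mul, mul_one])
    (fun (i : Z.ι × P.ι) (j : P.ι) => by
      refine (((P.smooth_trans j i.2).map F).mono fun x hx => ⟨hx.2, hx.1.2⟩).congr fun x _ => ?_
      exact congrArg (fun h : H => ((h : 𝔹ˣ) : 𝔹)) (congrFun (P.push_trans F j i.2) x))

theorem tensorPushIso_mk (F : LinHom G H) (hF : ∀ e, F.hom ((sgn G).hom e) = 1) {x : Y}
    (z : Z.Fib x) (p : P.Fib x) (h : H) :
    (tensorPushIso Z P F hF).toFun ((tensor Z P).pushMk F (tensorMk Z P z p) h) =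
      P.pushMk F p h := by
  change (P.push F).act (P.pushMk F p 1) h = _
  rw [push_act, one_mul]

end PrincipalBundle

/-- A `G`-bundle is trivial when it has a global smooth section. -/
def PrincipalBundle.IsTrivial (P : PrincipalBundle Y G) : Prop :=
  ∃ s : ∀ x, P.Fib x, ∀ i, SmoothOn (fun x => P.div (P.sec i x) (s x)) (P.dom i)

end Bundles

section Connections

open PrincipalBundle

variable {𝔸 : Type} [NormedRing 𝔸] [NormedAlgebra ℝ 𝔸] {𝔹 : Type} [NormedRing 𝔹] [NormedAlgebra ℝ 𝔹]
  {Y : Type u} [TopologicalSpace Y] [ChartedSpace (EuclideanSpace ℝ (Fin 2)) Y]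
  [IsManifold (𝓡 2) ∞ Y] {G : Subgroup 𝔸ˣ} {H : Subgroup 𝔹ˣ}

/-- A connection on `P`, given by its pull-backs `form i` along the local sections: smooth one-forms
on `dom i` with values in the Lie algebra of `G`, related on overlaps by
`A_j = g⁻¹ A_i g + g⁻¹ dg`, where `sec j = (sec i) · g`. -/
structure Connection (P : PrincipalBundle Y G) where
  form : P.ι → ∀ x : Y, TangentSpace (𝓡 2) x →L[ℝ] 𝔸
  form_mem : ∀ i, ∀ x ∈ P.dom i, ∀ v, form i x v ∈ lieSet G
  smooth_form : ∀ i, ContMDiffOn (𝓡 2).tangent 𝓘(ℝ, 𝔸) ∞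
    (fun w : TangentBundle (𝓡 2) Y => form i w.proj w.snd) {w | w.proj ∈ P.dom i}
  compat : ∀ i j, ∀ x ∈ P.dom i ∩ P.dom j, ∀ v,
    form j x v = gaugeAt (P.trans i j) (form i x) v

/-- The isomorphism `φ` carries the connection `A` to the connection `A'`. -/
def PrincipalBundle.Iso.Preserves {P P' : PrincipalBundle Y G} (φ : Iso P P')
    (A : Connection P) (A' : Connection P') : Prop :=
  ∀ i j, ∀ x ∈ P.dom i ∩ P'.dom j, ∀ v, A.form i x v = gaugeAt (φ.rep i j) (A'.form j x) v

namespace PrincipalBundle.Iso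

theorem refl_preserves {P : PrincipalBundle Y G} (A : Connection P) : (refl P).Preserves A A :=
  fun i j x hx v => A.compat j i x hx.symm v

theorem trans_preserves {P P' P'' : PrincipalBundle Y G} {φ : Iso P P'} {ψ : Iso P' P''}
    {A : Connection P} {A' : Connection P'} {A'' : Connection P''}
    (h : φ.Preserves A A') (h' : ψ.Preserves A' A'') : (φ.trans ψ).Preserves A A'' := by
  intro i k x hx v
  obtain ⟨j, hj⟩ := P'.cover x
  have e : (φ.trans ψ).rep i k = fun x => ψ.rep j k x * φ.rep i j x :=
    funext fun x => rep_trans φ ψ i j k x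
  rw [e, h i j x ⟨hx.1, hj⟩ v]
  symm
  exact gaugeAt_mul
    ((ψ.smooth j k).mdiff ((P'.isOpen_dom j).inter (P''.isOpen_dom k)) ⟨hj, hx.2⟩)
    ((φ.smooth i j).mdiff ((P.isOpen_dom i).inter (P'.isOpen_dom j)) ⟨hx.1, hj⟩) _ _ _
    (h' j k x ⟨hj, hx.2⟩ v)

theorem symm_preserves [CompleteSpace 𝔸] {P P' : PrincipalBundle Y G} {φ : Iso P P'} {A : Connection P}
    {A' : Connection P'} (h : φ.Preserves A A') : φ.symm.Preserves A' A := by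
  intro j i x hx v
  have e : φ.symm.rep j i = fun x => (φ.rep i j x)⁻¹ := funext fun x => rep_symm φ i j x
  rw [e]
  exact gaugeAt_inv ((P.isOpen_dom i).inter (P'.isOpen_dom j)) (φ.smooth i j) hx.symm _ _ v
    (h i j x hx.symm v)

end PrincipalBundle.Iso

/-- The induced connection on the associated bundle. -/
noncomputable def Connection.push {P : PrincipalBundle Y G} (F : LinHom G H) (A : Connection P) :
    Connection (P.push F) where
  form i x := F.diff.comp (A.form i x)
  form_mem i x hx v := F.diff_mem (A.form_mem i x hx v)
  smooth_form i := F.diff.contDiff.contMDiff.comp_contMDiffOn (A.smooth_form i)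
  compat (i j : P.ι) x hx v := by
    have h := gaugeAt_map F ((P.smooth_trans i j).mdiff
      ((P.isOpen_dom i).inter (P.isOpen_dom j)) hx) (A.form i x) v (A.form_mem i x hx.1 v)
    rw [← P.push_trans F i j, ← A.compat i j x hx v] at h
    exact h.symm

/-- The connection `Z ⊗ A` on `Z ⊗ P`; the unique connection of `Z` vanishes in the local
sections of `Z`, and `z ⊗ p` is parallel when `z` and `p` are. -/
noncomputable def Connection.tensor [HasNegOne G] (Z : PrincipalBundle Y Z2)
    {P : PrincipalBundle Y G} (A : Connection P) : Connection (Z.tensor P) where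
  form i x := A.form i.2 x
  form_mem i x hx v := A.form_mem i.2 x hx.2 v
  smooth_form i := (A.smooth_form i.2).mono fun _ hw => hw.2
  compat (i j : Z.ι × P.ι) x hx v := by
    have h := gaugeAt_mul
      (((Z.smooth_trans i.1 j.1).map (sgn G)).mdiff
        ((Z.isOpen_dom i.1).inter (Z.isOpen_dom j.1)) ⟨hx.1.1, hx.2.1⟩)
      ((P.smooth_trans i.2 j.2).mdiff
        ((P.isOpen_dom i.2).inter (P.isOpen_dom j.2)) ⟨hx.1.2, hx.2.2⟩)
      (A.form i.2 x) (A.form i.2 x) v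
      (gaugeAt_sgn ((Z.isOpen_dom i.1).inter (Z.isOpen_dom j.1)) (Z.smooth_trans i.1 j.1)
        ⟨hx.1.1, hx.2.1⟩ _ v)
    rw [← tensor_trans, ← A.compat i.2 j.2 x ⟨hx.1.2, hx.2.2⟩ v] at h
    exact h.symm

theorem PrincipalBundle.Iso.tensor_preserves [HasNegOne G] {Z Z' : PrincipalBundle Y Z2}
    {P P' : PrincipalBundle Y G} (f : Iso Z Z') {φ : Iso P P'} {A : Connection P}
    {A' : Connection P'} (h : φ.Preserves A A') :
    (f.tensor φ).Preserves (A.tensor Z) (A'.tensor Z') := by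
  intro i j x hx v
  have e : (f.tensor φ).rep i j = fun x => (sgn G).hom (f.rep i.1 j.1 x) * φ.rep i.2 j.2 x :=
    funext fun x => tensor_rep f φ i j x
  rw [e]
  refine (h i.2 j.2 x ⟨hx.1.2, hx.2.2⟩ v).trans ?_
  symm
  exact gaugeAt_mul
    (((f.smooth i.1 j.1).map (sgn G)).mdiff
      ((Z.isOpen_dom i.1).inter (Z'.isOpen_dom j.1)) ⟨hx.1.1, hx.2.1⟩)
    ((φ.smooth i.2 j.2).mdiff
      ((P.isOpen_dom i.2).inter (P'.isOpen_dom j.2)) ⟨hx.1.2, hx.2.2⟩) _ _ v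
    (gaugeAt_sgn ((Z.isOpen_dom i.1).inter (Z'.isOpen_dom j.1)) (f.smooth i.1 j.1)
      ⟨hx.1.1, hx.2.1⟩ _ v)

theorem PrincipalBundle.tensorPushIso_preserves [HasNegOne G] (Z : PrincipalBundle Y Z2)
    {P : PrincipalBundle Y G} (A : Connection P) (F : LinHom G H)
    (hF : ∀ e, F.hom ((sgn G).hom e) = 1) :
    (tensorPushIso Z P F hF).Preserves ((A.tensor Z).push F) (A.push F) :=
  fun (i : Z.ι × P.ι) (j : P.ι) x hx v => by
    have e : (tensorPushIso Z P F hF).rep i j = (P.push F).trans j i.2 := funext fun y =>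
      congrArg ((P.push F).div (P.pushMk F (P.sec j y) 1))
        (tensorPushIso_mk F hF (Z.sec i.1 y) (P.sec i.2 y) 1)
    rw [e]
    exact (A.push F).compat j i.2 x ⟨hx.2, hx.1.2⟩ v

variable (Y) in
/-- A `G`-connection `(P, A)` over `Y`: a principal bundle together with a connection. -/
structure GConn (G : Subgroup 𝔸ˣ) where
  bundle : PrincipalBundle Y G
  conn : Connection bundle

/-- Gauge equivalence of `G`-connections. -/
def GConn.Equiv (P P' : GConn Y G) : Prop :=
  ∃ φ : Iso P.bundle P'.bundle, φ.Preserves P.conn P'.conn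

instance GConn.setoid [CompleteSpace 𝔸] : Setoid (GConn Y G) where
  r := GConn.Equiv
  iseqv := {
    refl := fun _ => ⟨Iso.refl _, Iso.refl_preserves _⟩
    symm := fun ⟨φ, h⟩ => ⟨φ.symm, Iso.symm_preserves h⟩
    trans := fun ⟨φ, h⟩ ⟨ψ, h'⟩ => ⟨φ.trans ψ, Iso.trans_preserves h h'⟩ }

/-- The `H`-connection induced by a `G`-connection through `F : G → H`. -/
noncomputable def GConn.push (F : LinHom G H) (P : GConn Y G) : GConn Y H :=
  ⟨P.bundle.push F, P.conn.push F⟩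

/-- `(Z ⊗ P, Z ⊗ A)`. -/
noncomputable def GConn.tensor [HasNegOne G] (Z : PrincipalBundle Y Z2) (P : GConn Y G) :
    GConn Y G :=
  ⟨Z.tensor P.bundle, P.conn.tensor Z⟩

end Connections

section Groups

abbrev U1 : Subgroup ℂˣ := (unitary ℂ).units
abbrev U2 : Subgroup (Matrix (Fin 2) (Fin 2) ℂ)ˣ := (Matrix.unitaryGroup (Fin 2) ℂ).units
abbrev SU2 : Subgroup (Matrix (Fin 2) (Fin 2) ℂ)ˣ := (Matrix.specialUnitaryGroup (Fin 2) ℂ).units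
abbrev O2 : Subgroup (Matrix (Fin 2) (Fin 2) ℝ)ˣ := (Matrix.orthogonalGroup (Fin 2) ℝ).units
abbrev SO3 : Subgroup (Matrix (Fin 3) (Fin 3) ℝ)ˣ :=
  (Matrix.specialOrthogonalGroup (Fin 3) ℝ).units

theorem contDiff_matrix {E : Type*} [NormedAddCommGroup E] [NormedSpace ℝ E] {n : ℕ}
    {𝕜 : Type} [RCLike 𝕜] {f : E → Matrix (Fin n) (Fin n) 𝕜}
    (h : ∀ i j, ContDiff ℝ ∞ fun x => f x i j) : ContDiff ℝ ∞ f := by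
  have h1 : ContDiff ℝ ∞ (fun x => (fun i j => f x i j : Fin n → Fin n → 𝕜)) :=
    contDiff_pi.2 fun i => contDiff_pi.2 fun j => h i j
  exact ((Matrix.ofLinearEquiv ℝ : (Fin n → Fin n → 𝕜) ≃ₗ[ℝ]
    Matrix (Fin n) (Fin n) 𝕜).toLinearMap.toContinuousLinearMap.contDiff).comp h1

theorem contDiff_entry {n : ℕ} {𝕜 : Type} [RCLike 𝕜] (i j : Fin n) :
    ContDiff ℝ ∞ fun M : Matrix (Fin n) (Fin n) 𝕜 => M i j :=
  (Matrix.entryLinearMap ℝ 𝕜 i j).toContinuousLinearMap.contDiff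

theorem contDiff_det {𝕜 : Type} [RCLike 𝕜] :
    ContDiff ℝ ∞ fun M : Matrix (Fin 2) (Fin 2) 𝕜 => M.det := by
  simp only [Matrix.det_fin_two]
  exact ((contDiff_entry (n := 2) (𝕜 := 𝕜) 0 0).mul (contDiff_entry (n := 2) (𝕜 := 𝕜) 1 1)).sub
    ((contDiff_entry (n := 2) (𝕜 := 𝕜) 0 1).mul (contDiff_entry (n := 2) (𝕜 := 𝕜) 1 0))

/-- The determinant `U₂ → U₁`. -/
noncomputable def detU : LinHom U2 U1 := LinHom.ofMonoidHom Matrix.detMonoidHom contDiff_det (by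
  intro g hg
  have key : ∀ M ∈ Matrix.unitaryGroup (Fin 2) ℂ, M.det ∈ unitary ℂ := fun M hM =>
    Matrix.det_of_mem_unitary hM
  exact Submonoid.mem_units_iff _ _ |>.2 ⟨key _ ((Submonoid.mem_units_iff _ _).1 hg).1,
    by simpa using key _ ((Submonoid.mem_units_iff _ _).1 hg).2⟩)

/-- The determinant `O₂ → {1, -1}`. -/
noncomputable def detO : LinHom O2 Z2 := LinHom.ofMonoidHom Matrix.detMonoidHom contDiff_det (by
  intro g hg
  have h := Matrix.det_of_mem_unitary ((Submonoid.mem_units_iff _ _).1 hg).1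
  have h2 := (Unitary.mem_iff.1 h).1
  rw [mem_rootsOfUnity]
  ext
  simpa [sq] using h2)

/-- The inclusion `SU₂ → U₂`. -/
noncomputable def inclSU : LinHom SU2 U2 := LinHom.ofMonoidHom (MonoidHom.id _) contDiff_id (by
  intro g hg
  rw [Submonoid.mem_units_iff] at hg ⊢
  exact ⟨(Matrix.mem_specialUnitaryGroup_iff.1 hg.1).1,
    (Matrix.mem_specialUnitaryGroup_iff.1 hg.2).1⟩)

/-- The block matrix `diag(M, det M)`. -/
def blockDet : Matrix (Fin 2) (Fin 2) ℝ →* Matrix (Fin 3) (Fin 3) ℝ where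
  toFun M := !![M 0 0, M 0 1, 0; M 1 0, M 1 1, 0; 0, 0, M.det]
  map_one' := by
    ext i j; fin_cases i <;> fin_cases j <;> simp
  map_mul' M N := by
    ext i j
    fin_cases i <;> fin_cases j <;> simp [Matrix.mul_apply, Fin.sum_univ_succ, Matrix.det_mul]

/-- The inclusion `O₂ → SO₃`, `M ↦ diag(M, det M)`. -/
noncomputable def inclO : LinHom O2 SO3 := LinHom.ofMonoidHom blockDet
  (contDiff_matrix fun i j => by
    fin_cases i <;> fin_cases j <;> simp [blockDet] <;>
      first | exact contDiff_const | exact contDiff_entry _ _ | exact contDiff_det)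
  (by
    have key : ∀ M ∈ Matrix.orthogonalGroup (Fin 2) ℝ,
        blockDet M ∈ Matrix.specialOrthogonalGroup (Fin 3) ℝ := by
      intro M hM
      have h1 : M * star M = 1 := Unitary.mul_star_self_of_mem hM
      have h2 : M.det * M.det = 1 := by
        have := congrArg Matrix.det h1
        rw [Matrix.det_mul, Matrix.det_one, Matrix.star_eq_conjTranspose,
          Matrix.det_conjTranspose] at this
        simpa using this
      have hb : star (blockDet M) = blockDet (star M) := by
        ext i j
        fin_cases i <;> fin_cases j <;> simp [blockDet, Matrix.star_eq_conjTranspose]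
      refine Matrix.mem_specialOrthogonalGroup_iff.2 ⟨?_, ?_⟩
      · have : blockDet M * star (blockDet M) = 1 := by rw [hb, ← map_mul, h1, map_one]
        exact (Matrix.mem_orthogonalGroup_iff (Fin 3) ℝ).2 this
      · rw [← h2]
        simp [blockDet, Matrix.det_fin_three, Matrix.det_fin_two]
        ring
    intro g hg
    rw [Submonoid.mem_units_iff] at hg ⊢
    exact ⟨key _ hg.1, by simpa using key _ hg.2⟩)

/-- The Pauli matrices; the matrices `I • pauli i` form a basis of the Lie algebra of `SU₂`. -/
noncomputable def pauli : Fin 3 → Matrix (Fin 2) (Fin 2) ℂ :=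
  ![!![0, 1; 1, 0], !![0, -Complex.I; Complex.I, 0], !![1, 0; 0, -1]]

/-- The matrix, in the basis `pauli`, of `X ↦ M X Mᴴ`. -/
noncomputable def adMatrix (M : Matrix (Fin 2) (Fin 2) ℂ) : Matrix (Fin 3) (Fin 3) ℝ :=
  Matrix.of fun i j => (1 / 2) * (pauli i * (M * pauli j * star M)).trace.re

theorem pauli_expand (X : Matrix (Fin 2) (Fin 2) ℂ) (h : star X = X) (ht : X.trace = 0) :
    X = ∑ k, ((1 / 2 * (pauli k * X).trace.re : ℝ) : ℂ) • pauli k := by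
  have e := fun i j => congrFun (congrFun h i) j
  have e00 := e 0 0
  have e01 := e 0 1
  have e11 := e 1 1
  simp only [Matrix.star_apply, Complex.ext_iff, Complex.star_def, Complex.conj_re,
    Complex.conj_im] at e00 e01 e11
  simp only [Matrix.trace_fin_two, Complex.ext_iff, Complex.add_re, Complex.add_im,
    Complex.zero_re, Complex.zero_im] at ht
  obtain ⟨t1, t2⟩ := ht
  obtain ⟨-, a2⟩ := e00
  obtain ⟨b1, b2⟩ := e01
  obtain ⟨-, c2⟩ := e11
  ext i j
  fin_cases i <;> fin_cases j <;>
    simp [pauli, Fin.sum_univ_succ, Matrix.trace_fin_two, Matrix.mul_apply, Complex.ext_iff] <;>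
    constructor <;> linarith

theorem pauli_star (j : Fin 3) : star (pauli j) = pauli j := by
  fin_cases j <;> ext a b <;> fin_cases a <;> fin_cases b <;> simp [pauli]

theorem pauli_trace (j : Fin 3) : (pauli j).trace = 0 := by
  fin_cases j <;> simp [pauli, Matrix.trace_fin_two]

theorem adMatrix_expand {M : Matrix (Fin 2) (Fin 2) ℂ} (hM : M ∈ Matrix.unitaryGroup (Fin 2) ℂ)
    (j : Fin 3) : M * pauli j * star M = ∑ k, ((adMatrix M k j : ℝ) : ℂ) • pauli k := by
  apply pauli_expand
  · simp [pauli_star, mul_assoc]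
  · rw [Matrix.trace_mul_comm, ← mul_assoc, Matrix.mem_unitaryGroup_iff'.1 hM, one_mul,
      pauli_trace]

theorem adMatrix_mul (M : Matrix (Fin 2) (Fin 2) ℂ) {N : Matrix (Fin 2) (Fin 2) ℂ}
    (hN : N ∈ Matrix.unitaryGroup (Fin 2) ℂ) :
    adMatrix (M * N) = adMatrix M * adMatrix N := by
  ext i j
  have h : pauli i * (M * N * pauli j * star (M * N)) =
      pauli i * (M * (N * pauli j * star N) * star M) := by
    simp [mul_assoc]
  have h' : adMatrix (M * N) i j = (1 / 2) *
    (pauli i * (M * N * pauli j * star (M * N))).trace.re := rfl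
  rw [h', h, adMatrix_expand hN, Matrix.mul_apply]
  simp only [Finset.mul_sum, Finset.sum_mul, Matrix.trace_sum, Complex.re_sum, Matrix.mul_smul,
    Matrix.smul_mul, Matrix.trace_smul, smul_eq_mul, Complex.re_ofReal_mul]
  refine Finset.sum_congr rfl fun k _ => ?_
  simp only [adMatrix, Matrix.of_apply]
  ring

theorem adMatrix_one : adMatrix 1 = 1 := by
  ext i j
  fin_cases i <;> fin_cases j <;>
    simp [adMatrix, pauli, Matrix.trace_fin_two, Matrix.mul_apply, Fin.sum_univ_succ] <;> norm_num

theorem adMatrix_star (M : Matrix (Fin 2) (Fin 2) ℂ) : star (adMatrix M) = adMatrix (star M) := by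
  ext i j
  simp only [adMatrix, Matrix.star_apply, Matrix.of_apply, star_trivial, star_star]
  congr 2
  rw [← mul_assoc, ← mul_assoc, Matrix.trace_mul_comm (pauli j * M * pauli i)]
  rw [Matrix.trace_mul_comm (pauli i)]
  simp only [mul_assoc]

theorem pauli_triple (A : Matrix (Fin 3) (Fin 3) ℝ) :
    ((∑ k, ((A k 0 : ℝ) : ℂ) • pauli k) * (∑ k, ((A k 1 : ℝ) : ℂ) • pauli k) *
      (∑ k, ((A k 2 : ℝ) : ℂ) • pauli k)).trace = 2 * Complex.I * (A.det : ℂ) := by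
  simp [pauli, Fin.sum_univ_succ, Matrix.trace_fin_two, Matrix.det_fin_three,
    Complex.ext_iff]
  constructor <;> ring

theorem adMatrix_mem {M : Matrix (Fin 2) (Fin 2) ℂ} (hM : M ∈ Matrix.unitaryGroup (Fin 2) ℂ) :
    adMatrix M ∈ Matrix.specialOrthogonalGroup (Fin 3) ℝ := by
  refine Matrix.mem_specialOrthogonalGroup_iff.2 ⟨?_, ?_⟩
  · have : adMatrix M * star (adMatrix M) = 1 := by
      rw [adMatrix_star, ← adMatrix_mul M (Unitary.star_mem hM), Matrix.mem_unitaryGroup_iff.1 hM,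
        adMatrix_one]
    exact (Matrix.mem_orthogonalGroup_iff (Fin 3) ℝ).2 this
  · have h := pauli_triple (adMatrix M)
    have h1 := pauli_triple 1
    rw [← adMatrix_expand hM, ← adMatrix_expand hM, ← adMatrix_expand hM] at h
    rw [← adMatrix_one, ← adMatrix_expand (one_mem _), ← adMatrix_expand (one_mem _),
      ← adMatrix_expand (one_mem _), adMatrix_one] at h1
    have hs : star M * M = 1 := Matrix.mem_unitaryGroup_iff'.1 hM
    have e : M * pauli 0 * star M * (M * pauli 1 * star M) * (M * pauli 2 * star M) =
        M * (pauli 0 * pauli 1 * pauli 2 * star M) := by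
      simp only [mul_assoc]
      simp only [← mul_assoc (star M) M, hs, one_mul]
    rw [e, Matrix.trace_mul_comm, mul_assoc, hs, mul_one] at h
    simp only [one_mul, star_one, mul_one, Matrix.det_one, Complex.ofReal_one] at h1
    rw [h1] at h
    have hne : (2 * Complex.I) ≠ 0 := by simp
    have h2 := mul_left_cancel₀ hne ((mul_one _).trans h)
    exact_mod_cast h2.symm

theorem contDiff_adMatrix : ContDiff ℝ ∞ adMatrix := by
  refine contDiff_matrix fun i j => ?_
  have h1 : ContDiff ℝ ∞ (fun M : Matrix (Fin 2) (Fin 2) ℂ => pauli i * (M * pauli j * star M)) :=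
    contDiff_const.mul ((contDiff_id.mul contDiff_const).mul
      (contDiff_matrix fun a b => by
        simp only [Matrix.star_apply]
        exact Complex.conjCLE.contDiff.comp (contDiff_entry b a)))
  have h2 : ContDiff ℝ ∞ (fun M : Matrix (Fin 2) (Fin 2) ℂ => M.trace.re) :=
    (Complex.reLm ∘ₗ Matrix.traceLinearMap (Fin 2) ℝ ℂ).toContinuousLinearMap.contDiff
  exact contDiff_const.mul (h2.comp h1)

/-- The adjoint representation `U₂ → SO₃`, written in the basis of Pauli matrices. Its kernel is the
group of scalars, so that it is an isomorphism `PU₂ ≅ SO₃` preceded by the projection. -/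
noncomputable def adHom : LinHom U2 SO3 where
  hom := (MonoidHom.toHomUnits
    { toFun := fun u : U2 => adMatrix ((u : (Matrix (Fin 2) (Fin 2) ℂ)ˣ) : Matrix _ _ ℂ)
      map_one' := by simpa using adMatrix_one
      map_mul' := fun u v => by
        simpa using adMatrix_mul _ ((Submonoid.mem_units_iff _ _).1 v.2).1 }).codRestrict SO3
    fun u => (Submonoid.mem_units_iff _ _).2
      ⟨adMatrix_mem ((Submonoid.mem_units_iff _ _).1 u.2).1, by
        rw [← map_inv]
        exact adMatrix_mem ((Submonoid.mem_units_iff _ _).1 (u⁻¹).2).1⟩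
  ext := adMatrix
  smooth_ext := contDiff_adMatrix
  ext_eq _ := rfl

/-- Conjugation by `k` in `SO₃`. -/
noncomputable def conjSO (k : SO3) : LinHom SO3 SO3 where
  hom := (MulAut.conj k).toMonoidHom
  ext M := ((k : (Matrix (Fin 3) (Fin 3) ℝ)ˣ) : Matrix _ _ ℝ) * M *
    (((k⁻¹ : SO3) : (Matrix (Fin 3) (Fin 3) ℝ)ˣ) : Matrix _ _ ℝ)
  smooth_ext := (contDiff_const.mul contDiff_id).mul contDiff_const
  ext_eq g := by simp [MulAut.conj_apply]

end Groups

instance : HasNegOne SU2 where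
  neg_one_mem := by
    have h : (-1 : Matrix (Fin 2) (Fin 2) ℂ) ∈ Matrix.specialUnitaryGroup (Fin 2) ℂ := by
      rw [Matrix.mem_specialUnitaryGroup_iff, Matrix.mem_unitaryGroup_iff]
      simp [Matrix.det_neg]
    exact (Submonoid.mem_units_iff _ _).2 ⟨h, by simpa using h⟩

instance : HasNegOne U2 where
  neg_one_mem := by
    have h : (-1 : Matrix (Fin 2) (Fin 2) ℂ) ∈ Matrix.unitaryGroup (Fin 2) ℂ := by
      rw [Matrix.mem_unitaryGroup_iff]
      simp
    exact (Submonoid.mem_units_iff _ _).2 ⟨h, by simpa using h⟩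

section Moduli

open PrincipalBundle

variable (Y : Type u) [TopologicalSpace Y] [ChartedSpace (EuclideanSpace ℝ (Fin 2)) Y]

instance PrincipalBundle.z2Setoid : Setoid (PrincipalBundle Y Z2) where
  r Z Z' := Nonempty (Iso Z Z')
  iseqv := {
    refl := fun Z => ⟨Iso.refl Z⟩
    symm := fun ⟨f⟩ => ⟨f.symm⟩
    trans := fun ⟨f⟩ ⟨g⟩ => ⟨f.trans g⟩ }

/-- Isomorphism classes of `ℤ/2`-bundles (each carries a unique connection). -/
def ModuliZ2 : Type (u + 1) := Quotient (PrincipalBundle.z2Setoid Y)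

theorem FixedDet.toFun_push {Y : Type u} [TopologicalSpace Y]
    [ChartedSpace (EuclideanSpace ℝ (Fin 2)) Y] {P P' : PrincipalBundle Y U2} (φ : Iso P P') {x : Y}
    (p : P.Fib x) (h : U1) :
    (φ.push detU).toFun (P.pushMk detU p h) = P'.pushMk detU (φ.toFun p) h := by
  change (P'.push detU).act (P'.pushMk detU (φ.toFun p) 1) h = _
  rw [push_act, one_mul]

variable [IsManifold (𝓡 2) ∞ Y]

/-- Gauge equivalence classes of `SU₂`-connections over `Y`. -/
def ModuliSU2 : Type (u + 1) := Quotient (GConn.setoid : Setoid (GConn Y SU2))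

variable {Y}

/-- The class `[Z]`. -/
def ModuliZ2.mk (Z : PrincipalBundle Y Z2) : ModuliZ2 Y := Quotient.mk _ Z

/-- The class `[P, A]` of an `SU₂`-connection. -/
noncomputable def ModuliSU2.mk (P : GConn Y SU2) : ModuliSU2 Y := Quotient.mk _ P

/-- The action `[Z] · [P, A] = [Z ⊗ P, Z ⊗ A]`. -/
noncomputable def ModuliSU2.tensor : ModuliZ2 Y → ModuliSU2 Y → ModuliSU2 Y :=
  Quotient.map₂ (fun Z P => GConn.tensor Z P)
    fun _ _ ⟨f⟩ _ _ ⟨φ, h⟩ => ⟨f.tensor φ, f.tensor_preserves h⟩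

/-- A `U₂`-connection with determinant `(T, a)`: the identification of `(Det P, Det A)` with
`(T, a)` is the isomorphism `det`. -/
structure FixedDet (T : GConn Y U1) extends GConn Y U2 where
  det : Iso (bundle.push detU) T.bundle
  det_preserves : det.Preserves (conn.push detU) T.conn

/-- Equivalence of `U₂`-connections with determinant `(T, a)`: gauge transformations `φ` that
preserve the connections and for which `Det φ` is the identity of `T`. -/
def FixedDet.Equiv {T : GConn Y U1} (P P' : FixedDet T) : Prop :=
  ∃ φ : Iso P.bundle P'.bundle, φ.Preserves P.conn P'.conn ∧
    ∀ (x : Y) (c : (P.bundle.push detU).Fib x), P'.det.toFun ((φ.push detU).toFun c) =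
      P.det.toFun c

instance FixedDet.setoid (T : GConn Y U1) : Setoid (FixedDet T) where
  r := FixedDet.Equiv
  iseqv := {
    refl := fun P => ⟨Iso.refl _, Iso.refl_preserves _, fun x c => by
      induction c using Quotient.inductionOn with
      | h a => exact congrArg P.det.toFun (toFun_push (Iso.refl P.bundle) a.1 a.2)⟩
    symm := fun {P P'} ⟨φ, h, hd⟩ => ⟨φ.symm, Iso.symm_preserves h, fun x c => by
      induction c using Quotient.inductionOn with
      | h a =>
        have h1 := hd x (P.bundle.pushMk detU (φ.invFun a.1) a.2)
        rw [toFun_push, Iso.toFun_invFun] at h1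
        exact (congrArg P.det.toFun (toFun_push φ.symm a.1 a.2)).trans h1.symm⟩
    trans := fun {P P' P''} ⟨φ, h, hd⟩ ⟨ψ, h', hd'⟩ =>
      ⟨φ.trans ψ, Iso.trans_preserves h h', fun x c => by
        induction c using Quotient.inductionOn with
        | h a =>
          have h1 := hd x (P.bundle.pushMk detU a.1 a.2)
          have h2 := hd' x (P'.bundle.pushMk detU (φ.toFun a.1) a.2)
          rw [toFun_push] at h1 h2
          exact (congrArg P''.det.toFun (toFun_push (φ.trans ψ) a.1 a.2)).trans (h2.trans h1)⟩ }

/-- The moduli space of `U₂`-connections with determinant `(T, a)`. -/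
def ModuliU2 (T : GConn Y U1) : Type (u + 1) := Quotient (FixedDet.setoid T)

/-- The class `[P, A]` of a `U₂`-connection with determinant `(T, a)`. -/
noncomputable def ModuliU2.mk {T : GConn Y U1} (P : FixedDet T) : ModuliU2 T := Quotient.mk _ P

theorem detU_sgn (e : Z2) : detU.hom ((sgn U2).hom e) = 1 := by
  ext
  rw [← detU.ext_eq, sgn_val]
  change (algebraMap ℝ (Matrix (Fin 2) (Fin 2) ℂ) ((e : ℝˣ) : ℝ)).det = 1
  rcases Z2.eq_or e with h | h <;> simp [h, Matrix.det_neg]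

/-- `Z ⊗ (P, A)`, where `Det (Z ⊗ P)` is identified with `Det P` through `z ⊗ p ↦ p`. -/
noncomputable def FixedDet.tensor {T : GConn Y U1} (Z : PrincipalBundle Y Z2) (P : FixedDet T) :
    FixedDet T where
  toGConn := P.toGConn.tensor Z
  det := (tensorPushIso Z P.bundle detU detU_sgn).trans P.det
  det_preserves :=
    Iso.trans_preserves (tensorPushIso_preserves Z P.conn detU detU_sgn) P.det_preserves

/-- The action `[Z] · [P, A] = [Z ⊗ P, Z ⊗ A]`. -/
noncomputable def ModuliU2.tensor {T : GConn Y U1} : ModuliZ2 Y → ModuliU2 T → ModuliU2 T :=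
  Quotient.map₂ (fun Z P => FixedDet.tensor Z P)
    fun Z Z' ⟨f⟩ P P' ⟨φ, h, hd⟩ => ⟨f.tensor φ, f.tensor_preserves h, fun x c => by
      induction c using Quotient.inductionOn with
      | h a =>
      obtain ⟨b, k⟩ := a
      induction b using Quotient.inductionOn with
      | h b =>
      have h1 := hd x (P.bundle.pushMk detU b.2 k)
      rw [FixedDet.toFun_push] at h1
      have h2 : (FixedDet.tensor Z P).det.toFun ((Z.tensor P.bundle).pushMk detU
          (tensorMk Z P.bundle b.1 b.2) k) = P.det.toFun (P.bundle.pushMk detU b.2 k) :=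
        congrArg P.det.toFun (tensorPushIso_mk detU detU_sgn b.1 b.2 k)
      have h3 : (FixedDet.tensor Z' P').det.toFun ((Z'.tensor P'.bundle).pushMk detU
          (tensorMk Z' P'.bundle (f.toFun b.1) (φ.toFun b.2)) k) =
          P'.det.toFun (P'.bundle.pushMk detU (φ.toFun b.2) k) :=
        congrArg P'.det.toFun (tensorPushIso_mk detU detU_sgn _ _ k)
      have h4 := FixedDet.toFun_push (f.tensor φ) (tensorMk Z P.bundle b.1 b.2) k
      exact (congrArg (FixedDet.tensor Z' P').det.toFun h4).trans (h3.trans (h1.trans h2.symm))⟩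

/-- The homomorphism `β : U₂ → SO₃`: the projection to `PU₂` followed by an isomorphism
`PU₂ ≅ SO₃`. Two such isomorphisms differ by an automorphism of `SO₃`, which is the conjugation by
some `k`. -/
noncomputable def beta (k : SO3) : LinHom U2 SO3 := (conjSO k).comp adHom

/-- The `SO₃`-connection `R` reduces to an `O₂`-connection `(Q, B)` with `Det Q ≅ Z`. -/
def ReducesWithDet (R : GConn Y SO3) (Z : PrincipalBundle Y Z2) : Prop :=
  ∃ Q : GConn Y O2, (Q.push inclO).Equiv R ∧ Nonempty (Iso (Q.bundle.push detO) Z)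

end Moduli

end GaugeTheory

namespace GaugeTheory

universe u

/-! ### Calculus on the surface: locally constant functions and gauge transforms of one-forms -/

section Calculus

variable {Y : Type u} [TopologicalSpace Y] [ChartedSpace (EuclideanSpace ℝ (Fin 2)) Y]

/-! A fixed point of `[Z]` amounts to a connection preserving isomorphism `φ : Z ⊗ P ≅ P` of
determinant one (`TensorFixed`); the determinant condition is automatic for `SU₂` and says `Det φ =
id` for `U₂`. Comparing `φ (z ⊗ p)` with `p` gives a function `u (z, p)` with values in `SU₂` such
that `u (z e, p g) = e g⁻¹ u (z, p) g`. That `φ` preserves the connections means that `u` is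
covariantly constant: `du = u A - A u` in local sections.

The trace of `u` is real, independent of `p`, locally constant (the trace of a commutator vanishes),
and changes sign with `z`. Over a connected surface its square is constant. Were it non-zero, the
`z` of positive trace would form a global section of `Z`. Hence `u` is trace-free when `Z` is
non-trivial (`isoTrace_eq_zero_of_not_isTrivial`); this is the only use of non-triviality and of
connectedness.

The trace-free elements of `SU₂` form the unit sphere of its Lie algebra `ℝ³`, on which `U₂` acts by
conjugation, that is, through `β`. So a trace-free `u` is a `ParallelAxis`: a parallel unit section
of the vector bundle of `βP` twisted by `Z` (`nonempty_parallelAxis_of_tensorFixed`). Conversely an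
axis gives back `u`, for every `Z` (`tensorFixed_of_parallelAxis`).

A parallel axis is in turn the same as a reduction to `O₂`, the group of rotations that preserve the
third axis and act on its sign by the determinant (`exists_inclO_eq`). The pairs `(z, r)` in which
the axis is `north` form an `O₂`-bundle that projects to `Z` and to `βP`, and the connection
restricts to it because the axis is parallel (`ParallelAxis.reducesWithDet`). In the other
direction, the third vector of the frames in `Q`, with its sign recorded by `Det Q ≅ Z`, is a
parallel axis (`nonempty_parallelAxis_of_reduces`). The structure `IsAdjoint` treats `SU₂` and `U₂`
together. -/

theorem mvfderiv_clm_comp {E F : Type*} [NormedAddCommGroup E] [NormedSpace ℝ E]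
    [NormedAddCommGroup F] [NormedSpace ℝ F] {f : Y → E} {x : Y} (L : E →L[ℝ] F)
    (hf : MDifferentiableAt (𝓡 2) 𝓘(ℝ, E) f x) (v : TangentSpace (𝓡 2) x) :
    mvfderiv (𝓡 2) (fun y => L (f y)) x v = L (mvfderiv (𝓡 2) f x v) := by
  have := (L.hasFDerivAt.hasMFDerivAt.comp x hf.hasMFDerivAt).mfderiv
  exact congrArg (fun T => T v) this

/-- A function with vanishing differential is locally constant. -/
theorem eventually_eq_of_mvfderiv_eq_zero [IsManifold (𝓡 2) ∞ Y] {E : Type*}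
    [NormedAddCommGroup E] [NormedSpace ℝ E] {f : Y → E} {U : Set Y} (hU : IsOpen U)
    (hf : ∀ y ∈ U, MDifferentiableAt (𝓡 2) 𝓘(ℝ, E) f y)
    (h0 : ∀ y ∈ U, ∀ v, mvfderiv (𝓡 2) f y v = 0) {x : Y} (hx : x ∈ U) :
    ∀ᶠ y in nhds x, f y = f x := by
  have : IsManifold (𝓡 2) 1 Y := IsManifold.of_le (n := ∞) (by simp)
  set e := extChartAt (𝓡 2) x with he
  have hV : e.target ∩ e.symm ⁻¹' U ∈ nhds (e x) := by
    refine Filter.inter_mem (extChartAt_target_mem_nhds x) ?_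
    exact (continuousAt_extChartAt_symm x).preimage_mem_nhds
      (hU.mem_nhds (by simpa [he] using hx))
  obtain ⟨r, hr, hball⟩ := Metric.mem_nhds_iff.1 hV
  -- Read in a chart, the function has zero derivative on a ball, which is convex and hence
  -- connected.
  have hg : ∀ z ∈ Metric.ball (e x) r, HasFDerivAt (f ∘ e.symm) (0 : _ →L[ℝ] E) z := by
    intro z hz
    have h1 := (hf _ (hball hz).2).hasMFDerivAt
    have h2 : MDifferentiableAt 𝓘(ℝ, EuclideanSpace ℝ (Fin 2)) (𝓡 2) e.symm z := by
      have := mdifferentiableWithinAt_extChartAt_symm (I := 𝓡 2) (hball hz).1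
      rwa [ModelWithCorners.range_eq_univ, mdifferentiableWithinAt_univ] at this
    have h3 := (h1.comp z h2.hasMFDerivAt)
    have h4 : mfderiv (𝓡 2) 𝓘(ℝ, E) f (e.symm z) = 0 := by
      ext v
      exact h0 _ (hball hz).2 v
    rw [h4] at h3
    have h5 := h3.hasFDerivAt
    rwa [ContinuousLinearMap.zero_comp] at h5
  have hconst : ∀ z ∈ Metric.ball (e x) r, (f ∘ e.symm) z = (f ∘ e.symm) (e x) := fun z hz =>
    Metric.isOpen_ball.is_const_of_fderiv_eq_zero (𝕜 := ℝ) (convex_ball (e x) r).isPreconnected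
      (fun z hz => (hg z hz).differentiableAt.differentiableWithinAt)
      (fun z hz => (hg z hz).fderiv) hz (Metric.mem_ball_self hr)
  filter_upwards [(continuousAt_extChartAt (I := 𝓡 2) x).preimage_mem_nhds
    (Metric.ball_mem_nhds (e x) hr), extChartAt_source_mem_nhds (I := 𝓡 2) x] with y hy hys
  have := hconst _ hy
  rw [Function.comp_apply, Function.comp_apply, he, extChartAt_to_inv,
    (extChartAt (𝓡 2) x).left_inv hys] at this
  exact this

/-- The differential is the fibre component of the tangent map, and on an open set the tangent map
within the set is the full one. -/
theorem contMDiffOn_mvfderiv [IsManifold (𝓡 2) ∞ Y] {E : Type*} [NormedAddCommGroup E]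
    [NormedSpace ℝ E] {f : Y → E} {U : Set Y} (hU : IsOpen U)
    (hf : ContMDiffOn (𝓡 2) 𝓘(ℝ, E) ∞ f U) :
    ContMDiffOn (𝓡 2).tangent 𝓘(ℝ, E) ∞
      (fun w : TangentBundle (𝓡 2) Y => mvfderiv (𝓡 2) f w.proj w.snd) {w | w.proj ∈ U} := by
  have : IsManifold (𝓡 2) 1 Y := IsManifold.of_le (n := ∞) (by simp)
  have h1 := hf.contMDiffOn_tangentMapWithin (m := ∞) (by simp) hU.uniqueMDiffOn
  have h2 := (contMDiff_snd_tangentBundle_modelSpace E 𝓘(ℝ, E)).comp_contMDiffOn h1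
  refine h2.congr fun w hw => ?_
  have : mfderivWithin (𝓡 2) 𝓘(ℝ, E) f U w.proj = mfderiv (𝓡 2) 𝓘(ℝ, E) f w.proj :=
    mfderivWithin_of_isOpen hU hw
  change mvfderiv (𝓡 2) f w.proj w.snd = mfderivWithin (𝓡 2) 𝓘(ℝ, E) f U w.proj w.snd
  rw [this]
  rfl

theorem ContMDiffOn.comp_tangentBundle_proj {E : Type*} [NormedAddCommGroup E] [NormedSpace ℝ E]
    [IsManifold (𝓡 2) ∞ Y] {f : Y → E} {U : Set Y} (hf : ContMDiffOn (𝓡 2) 𝓘(ℝ, E) ∞ f U) :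
    ContMDiffOn (𝓡 2).tangent 𝓘(ℝ, E) ∞ (fun w : TangentBundle (𝓡 2) Y => f w.proj)
      {w | w.proj ∈ U} := by
  have : IsManifold (𝓡 2) (∞ + 1) Y := by simpa
  exact hf.comp (Bundle.contMDiff_proj (TangentSpace (𝓡 2))).contMDiffOn fun w hw => hw

variable {𝔸 : Type} [NormedRing 𝔸] [NormedAlgebra ℝ 𝔸] {G : Subgroup 𝔸ˣ}

theorem contMDiffOn_gaugeAt [CompleteSpace 𝔸] [IsManifold (𝓡 2) ∞ Y] {h : Y → G} {U : Set Y}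
    (hU : IsOpen U) (hh : SmoothOn h U) {α : ∀ x : Y, TangentSpace (𝓡 2) x →L[ℝ] 𝔸}
    (hα : ContMDiffOn (𝓡 2).tangent 𝓘(ℝ, 𝔸) ∞
      (fun w : TangentBundle (𝓡 2) Y => α w.proj w.snd) {w | w.proj ∈ U}) :
    ContMDiffOn (𝓡 2).tangent 𝓘(ℝ, 𝔸) ∞
      (fun w : TangentBundle (𝓡 2) Y => gaugeAt h (α w.proj) w.snd) {w | w.proj ∈ U} := by
  have hm : ContDiff ℝ ∞ (fun p : 𝔸 × 𝔸 => p.1 * p.2) := contDiff_fst.mul contDiff_snd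
  have ha : ContDiff ℝ ∞ (fun p : 𝔸 × 𝔸 => p.1 + p.2) := contDiff_fst.add contDiff_snd
  have mul : ∀ {f g : TangentBundle (𝓡 2) Y → 𝔸},
      ContMDiffOn (𝓡 2).tangent 𝓘(ℝ, 𝔸) ∞ f {w | w.proj ∈ U} →
      ContMDiffOn (𝓡 2).tangent 𝓘(ℝ, 𝔸) ∞ g {w | w.proj ∈ U} →
      ContMDiffOn (𝓡 2).tangent 𝓘(ℝ, 𝔸) ∞ (fun w => f w * g w) {w | w.proj ∈ U} :=
    fun hf hg => hm.contMDiff.comp_contMDiffOn (hf.prodMk_space hg)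
  have hi := ContMDiffOn.comp_tangentBundle_proj hh.inv
  have hp := ContMDiffOn.comp_tangentBundle_proj hh
  exact ha.contMDiff.comp_contMDiffOn
    ((mul (mul hi hα) hp).prodMk_space (mul hi (contMDiffOn_mvfderiv hU hh)))

/-- `gaugeAt h α` as a linear map of the tangent vector. -/
noncomputable def gaugeCLM (h : Y → G) {x : Y} (α : TangentSpace (𝓡 2) x →L[ℝ] 𝔸) :
    TangentSpace (𝓡 2) x →L[ℝ] 𝔸 :=
  (ContinuousLinearMap.mul ℝ 𝔸 (((h x)⁻¹ : G) : 𝔸ˣ)).comp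
    (((ContinuousLinearMap.mul ℝ 𝔸).flip ((h x : 𝔸ˣ) : 𝔸)).comp α +
      mvfderiv (𝓡 2) (fun y => ((h y : 𝔸ˣ) : 𝔸)) x)

theorem gaugeCLM_apply (h : Y → G) {x : Y} (α : TangentSpace (𝓡 2) x →L[ℝ] 𝔸)
    (v : TangentSpace (𝓡 2) x) : gaugeCLM h α v = gaugeAt h α v := by
  change _ * (α v * _ + _) = _
  rw [gaugeAt, mul_add, mul_assoc]
  rfl

/-- Multiplication by `h` removes the inverse and leaves the linear equation `dh = h X - α h`, the
form in which parallelism is exploited below. -/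
theorem gaugeAt_eq_iff (h : Y → G) {x : Y} (α : TangentSpace (𝓡 2) x →L[ℝ] 𝔸)
    (v : TangentSpace (𝓡 2) x) (X : 𝔸) :
    gaugeAt h α v = X ↔ mvfderiv (𝓡 2) (fun y => ((h y : 𝔸ˣ) : 𝔸)) x v =
      ((h x : 𝔸ˣ) : 𝔸) * X - α v * ((h x : 𝔸ˣ) : 𝔸) := by
  have e : ((((h x)⁻¹ : G) : 𝔸ˣ) : 𝔸) * ((h x : 𝔸ˣ) : 𝔸) = 1 := by simp
  have e' : ((h x : 𝔸ˣ) : 𝔸) * ((((h x)⁻¹ : G) : 𝔸ˣ) : 𝔸) = 1 := by simp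
  rw [gaugeAt, mul_assoc, ← mul_add]
  constructor
  · intro hX
    rw [← hX, ← mul_assoc, e', one_mul, add_sub_cancel_left]
  · intro hX
    rw [hX, add_sub_cancel, ← mul_assoc, e, one_mul]

/-- A smooth map to `ℤ/2` has vanishing differential. -/
theorem mvfderiv_Z2 {e : Y → Z2} {U : Set Y} (hU : IsOpen U) (he : SmoothOn e U) {x : Y}
    (hx : x ∈ U) (v : TangentSpace (𝓡 2) x) :
    mvfderiv (𝓡 2) (fun y => ((e y : ℝˣ) : ℝ)) x v = 0 := by
  have hd := he.mdiff hU hx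
  -- Differentiating `e² = 1` gives `2 e de = 0`, with `e = ±1`.
  have h1 := mvfderiv_ring_mul hd hd v
  have h2 : (fun y => ((e y : ℝˣ) : ℝ) * ((e y : ℝˣ) : ℝ)) = fun _ => (1 : ℝ) := by
    funext y
    rcases Z2.eq_or (e y) with h | h <;> simp [h]
  rw [h2, mvfderiv_const] at h1
  rcases Z2.eq_or (e x) with h | h <;> simp [h] at h1 <;> linarith

theorem Z2.mul_self (e : Z2) : e * e = 1 := by
  ext
  rcases Z2.eq_or e with h | h <;> simp [h]

theorem Z2.coe_mul_self (e : Z2) : ((e : ℝˣ) : ℝ) * ((e : ℝˣ) : ℝ) = 1 := by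
  rcases Z2.eq_or e with h | h <;> simp [h]

theorem Z2.ext_real {e f : Z2} (h : ((e : ℝˣ) : ℝ) = ((f : ℝˣ) : ℝ)) : e = f :=
  Subtype.ext (Units.ext h)

/-- The element `-1` of `ℤ/2`. -/
def Z2.neg : Z2 := ⟨-1, by simp [mem_rootsOfUnity]⟩

end Calculus

/-! ### The rotation group, and `O₂` as the subgroup preserving the third axis -/

section RotationGroup

open Matrix

/-- The action of `SO₃` on `ℝ³`. -/
def SO3.vec (g : SO3) (v : Fin 3 → ℝ) : Fin 3 → ℝ :=
  ((g : (Matrix (Fin 3) (Fin 3) ℝ)ˣ) : Matrix (Fin 3) (Fin 3) ℝ) *ᵥ v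

theorem SO3.vec_one (v : Fin 3 → ℝ) : SO3.vec 1 v = v := by simp [SO3.vec]

theorem SO3.vec_mul (g h : SO3) (v : Fin 3 → ℝ) : SO3.vec (g * h) v = SO3.vec g (SO3.vec h v) := by
  simp [SO3.vec]

theorem SO3.vec_inv_vec (g : SO3) (v : Fin 3 → ℝ) : SO3.vec g⁻¹ (SO3.vec g v) = v := by
  rw [← SO3.vec_mul, inv_mul_cancel, SO3.vec_one]

theorem SO3.vec_vec_inv (g : SO3) (v : Fin 3 → ℝ) : SO3.vec g (SO3.vec g⁻¹ v) = v := by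
  rw [← SO3.vec_mul, mul_inv_cancel, SO3.vec_one]

theorem SO3.vec_smul (g : SO3) (c : ℝ) (v : Fin 3 → ℝ) :
    SO3.vec g (c • v) = c • SO3.vec g v := Matrix.mulVec_smul _ _ _

theorem SO3.mem_orthogonal (g : SO3) :
    ((g : (Matrix (Fin 3) (Fin 3) ℝ)ˣ) : Matrix (Fin 3) (Fin 3) ℝ) ∈
      Matrix.orthogonalGroup (Fin 3) ℝ :=
  (Matrix.mem_specialOrthogonalGroup_iff.1 ((Submonoid.mem_units_iff _ _).1 g.2).1).1

theorem SO3.det_eq_one (g : SO3) :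
    ((g : (Matrix (Fin 3) (Fin 3) ℝ)ˣ) : Matrix (Fin 3) (Fin 3) ℝ).det = 1 :=
  (Matrix.mem_specialOrthogonalGroup_iff.1 ((Submonoid.mem_units_iff _ _).1 g.2).1).2

theorem SO3.transpose_mul_self (g : SO3) :
    ((g : (Matrix (Fin 3) (Fin 3) ℝ)ˣ) : Matrix (Fin 3) (Fin 3) ℝ)ᵀ *
      ((g : (Matrix (Fin 3) (Fin 3) ℝ)ˣ) : Matrix (Fin 3) (Fin 3) ℝ) = 1 :=
  (Matrix.mem_orthogonalGroup_iff' (Fin 3) ℝ).1 (SO3.mem_orthogonal g)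

theorem SO3.dotProduct_vec (g : SO3) (v w : Fin 3 → ℝ) :
    SO3.vec g v ⬝ᵥ SO3.vec g w = v ⬝ᵥ w := by
  rw [SO3.vec, SO3.vec, Matrix.dotProduct_mulVec, Matrix.vecMul_mulVec, SO3.transpose_mul_self,
    ← Matrix.dotProduct_mulVec, Matrix.one_mulVec]

/-- A matrix of determinant one with orthonormal rows, as an element of `SO₃`. -/
def SO3.mk (M : Matrix (Fin 3) (Fin 3) ℝ) (h : M * Mᵀ = 1) (hd : M.det = 1) : SO3 :=
  ⟨⟨M, Mᵀ, h, mul_eq_one_comm.1 h⟩, (Submonoid.mem_units_iff _ _).2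
    ⟨Matrix.mem_specialOrthogonalGroup_iff.2 ⟨(Matrix.mem_orthogonalGroup_iff (Fin 3) ℝ).2 h, hd⟩,
      Matrix.mem_specialOrthogonalGroup_iff.2
        ⟨(Matrix.mem_orthogonalGroup_iff (Fin 3) ℝ).2 (by
          simpa [Matrix.star_eq_conjTranspose] using mul_eq_one_comm.1 h), by
          change Mᵀ.det = 1
          rw [Matrix.det_transpose, hd]⟩⟩⟩

/-- A two by two matrix with orthonormal rows, as an element of `O₂`. -/
def O2.mk (M : Matrix (Fin 2) (Fin 2) ℝ) (h : M * Mᵀ = 1) : O2 :=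
  ⟨⟨M, Mᵀ, h, mul_eq_one_comm.1 h⟩, (Submonoid.mem_units_iff _ _).2
    ⟨(Matrix.mem_orthogonalGroup_iff (Fin 2) ℝ).2 h,
      (Matrix.mem_orthogonalGroup_iff (Fin 2) ℝ).2 (by
          simpa [Matrix.star_eq_conjTranspose] using mul_eq_one_comm.1 h)⟩⟩

/-- The third basis vector, which is fixed up to sign by `O₂`. -/
def north : Fin 3 → ℝ := ![0, 0, 1]

theorem north_dotProduct_north : north ⬝ᵥ north = 1 := by
  simp [north, dotProduct, Fin.sum_univ_succ]

theorem inclO_val (a : O2) : ((inclO.hom a : (Matrix (Fin 3) (Fin 3) ℝ)ˣ) :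
    Matrix (Fin 3) (Fin 3) ℝ) = blockDet (a : (Matrix (Fin 2) (Fin 2) ℝ)ˣ) := rfl

theorem detO_val (a : O2) : ((detO.hom a : ℝˣ) : ℝ) =
    ((a : (Matrix (Fin 2) (Fin 2) ℝ)ˣ) : Matrix (Fin 2) (Fin 2) ℝ).det := rfl

theorem blockDet_apply (M : Matrix (Fin 2) (Fin 2) ℝ) :
    blockDet M = !![M 0 0, M 0 1, 0; M 1 0, M 1 1, 0; 0, 0, M.det] := rfl

/-- The third column of `diag(a, det a)`. It ties the sign of the axis to the orientation bundle
`Det Q`. -/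
theorem inclO_vec_north (a : O2) :
    SO3.vec (inclO.hom a) north = ((detO.hom a : ℝˣ) : ℝ) • north := by
  rw [SO3.vec, inclO_val, detO_val, blockDet_apply]
  ext i
  fin_cases i <;> simp [north, Matrix.mulVec, dotProduct, Fin.sum_univ_succ]

theorem inclO_injective : Function.Injective inclO.hom := by
  intro a b h
  have h1 : blockDet (a : (Matrix (Fin 2) (Fin 2) ℝ)ˣ) = blockDet (b : (Matrix (Fin 2) (Fin 2) ℝ)ˣ) := by
    rw [← inclO_val, ← inclO_val, h]
  have e := fun i j => congrFun (congrFun h1 i) j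
  refine Subtype.ext (Units.ext ?_)
  ext i j
  have e00 := e 0 0
  have e01 := e 0 1
  have e10 := e 1 0
  have e11 := e 1 1
  simp [blockDet_apply] at e00 e01 e10 e11
  fin_cases i <;> fin_cases j <;> assumption

/-- The upper left two by two block. -/
noncomputable def upperBlock : Matrix (Fin 3) (Fin 3) ℝ →L[ℝ] Matrix (Fin 2) (Fin 2) ℝ :=
  LinearMap.toContinuousLinearMap
    { toFun := fun M => !![M 0 0, M 0 1; M 1 0, M 1 1]
      map_add' := fun M N => by ext i j; fin_cases i <;> fin_cases j <;> rfl
      map_smul' := fun c M => by ext i j; fin_cases i <;> fin_cases j <;> rfl }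

theorem upperBlock_apply (M : Matrix (Fin 3) (Fin 3) ℝ) :
    upperBlock M = !![M 0 0, M 0 1; M 1 0, M 1 1] := rfl

/-- A linear left inverse of the inclusion `O₂ → SO₃`; through it smoothness and connection forms
pass from `SO₃` back to `O₂`. -/
theorem upperBlock_blockDet (M : Matrix (Fin 2) (Fin 2) ℝ) : upperBlock (blockDet M) = M := by
  rw [upperBlock_apply, blockDet_apply]
  ext i j
  fin_cases i <;> fin_cases j <;> simp

/-- The subgroup `O₂` of `SO₃` consists of the rotations that preserve the third axis. -/
theorem exists_inclO_eq {g : SO3} {e : Z2} (h : SO3.vec g north = ((e : ℝˣ) : ℝ) • north) :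
    ∃ a : O2, inclO.hom a = g ∧ detO.hom a = e := by
  set M := ((g : (Matrix (Fin 3) (Fin 3) ℝ)ˣ) : Matrix (Fin 3) (Fin 3) ℝ) with hM
  set c := ((e : ℝˣ) : ℝ) with hc
  have hcc : c * c = 1 := Z2.coe_mul_self e
  have h0 := congrFun h 0
  have h1 := congrFun h 1
  have h2 := congrFun h 2
  simp [SO3.vec, ← hM, north, Matrix.mulVec, dotProduct, Fin.sum_univ_succ] at h0 h1 h2
  have ht := SO3.transpose_mul_self g
  have ht' := mul_eq_one_comm.1 ht
  rw [← hM] at ht ht'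
  have k := fun i j => congrFun (congrFun ht' i) j
  have k00 := k 0 0
  have k01 := k 0 1
  have k10 := k 1 0
  have k11 := k 1 1
  have k02 := k 0 2
  have k12 := k 1 2
  have k22 := k 2 2
  simp [Matrix.mul_apply, Fin.sum_univ_succ, h0, h1, h2, hcc] at k00 k01 k10 k11 k02 k12 k22
  -- The third row has length one (`k22`) and last entry `c = ±1`, so its other entries vanish.
  have h20 : M 2 0 = 0 := by nlinarith [mul_self_nonneg (M 2 0), mul_self_nonneg (M 2 1)]
  have h21 : M 2 1 = 0 := by nlinarith [mul_self_nonneg (M 2 0), mul_self_nonneg (M 2 1)]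
  have hd : (M 0 0 * M 1 1 - M 0 1 * M 1 0) * c = 1 := by
    have := SO3.det_eq_one g
    rw [← hM, Matrix.det_fin_three] at this
    simp [h0, h1, h2, h20, h21] at this
    linarith
  -- The sign `c` is its own inverse, so the determinant of the block is `c` itself.
  have hd' : M 0 0 * M 1 1 - M 0 1 * M 1 0 = c := by
    have := congrArg (· * c) hd
    simp only [mul_assoc, hcc] at this
    linarith
  have ho : upperBlock M * (upperBlock M)ᵀ = 1 := by
    rw [upperBlock_apply]
    ext i j
    fin_cases i <;> fin_cases j <;> simp [Matrix.mul_apply, Fin.sum_univ_succ] <;> assumption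
  have hdet : (upperBlock M).det = c := by
    rw [upperBlock_apply, Matrix.det_fin_two]
    simpa using hd'
  refine ⟨O2.mk _ ho, ?_, ?_⟩
  · refine Subtype.ext (Units.ext ?_)
    rw [inclO_val]
    change blockDet (upperBlock M) = M
    rw [blockDet_apply, hdet, upperBlock_apply]
    ext i j
    fin_cases i <;> fin_cases j <;> simp [h0, h1, h2, h20, h21]
  · refine Z2.ext_real ?_
    rw [detO_val]
    exact hdet

/-! ### Rotations that carry `north` to a given unit vector -/

/-- The matrix of the rotation by `π` which exchanges `north` and the unit vector `m`. -/
noncomputable def swapMatrix (m : Fin 3 → ℝ) : Matrix (Fin 3) (Fin 3) ℝ :=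
  (1 + m 2)⁻¹ • Matrix.vecMulVec (m + north) (m + north) - 1

theorem swapMatrix_eq (m : Fin 3 → ℝ) : swapMatrix m =
    !![(1 + m 2)⁻¹ * (m 0 * m 0) - 1, (1 + m 2)⁻¹ * (m 0 * m 1), (1 + m 2)⁻¹ * (m 0 * (m 2 + 1));
      (1 + m 2)⁻¹ * (m 1 * m 0), (1 + m 2)⁻¹ * (m 1 * m 1) - 1, (1 + m 2)⁻¹ * (m 1 * (m 2 + 1));
      (1 + m 2)⁻¹ * ((m 2 + 1) * m 0), (1 + m 2)⁻¹ * ((m 2 + 1) * m 1),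
        (1 + m 2)⁻¹ * ((m 2 + 1) * (m 2 + 1)) - 1] := by
  have h0 : (m + north) 0 = m 0 := add_zero _
  have h1 : (m + north) 1 = m 1 := add_zero _
  have h2 : (m + north) 2 = m 2 + 1 := rfl
  ext i j
  rw [swapMatrix, Matrix.sub_apply, Matrix.smul_apply, Matrix.vecMulVec_apply]
  fin_cases i <;> fin_cases j <;> simp [-Pi.add_apply, h0, h1, h2]

/-- For `w = m + north` with `m` a unit vector, `|w|² = 2 (1 + m 2)`, so the matrix is `2 w wᵀ /
|w|² - 1`: a symmetric involution. -/
theorem swapMatrix_mul_transpose {m : Fin 3 → ℝ} (hm : m ⬝ᵥ m = 1) (h : 1 + m 2 ≠ 0) :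
    swapMatrix m * (swapMatrix m)ᵀ = 1 := by
  have hm' : m 0 * m 0 + m 1 * m 1 + m 2 * m 2 = 1 := by
    simpa [dotProduct, Fin.sum_univ_succ, add_assoc] using hm
  have ht : (swapMatrix m)ᵀ = swapMatrix m := by
    ext i j
    simp [swapMatrix, Matrix.vecMulVec_apply, Matrix.one_apply, mul_comm, eq_comm]
  have hv : Matrix.vecMulVec (m + north) (m + north) * Matrix.vecMulVec (m + north) (m + north) =
      (2 * (1 + m 2)) • Matrix.vecMulVec (m + north) (m + north) := by
    rw [Matrix.vecMulVec_mul_vecMulVec]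
    have : (m + north) ⬝ᵥ (m + north) = 2 * (1 + m 2) := by
      simp [dotProduct, Fin.sum_univ_succ, north]
      linarith
    rw [this]
    ext i j
    simp [Matrix.vecMulVec_apply]
    ring
  rw [ht, swapMatrix, sub_mul, mul_sub, mul_sub, Matrix.smul_mul, Matrix.mul_smul, hv, smul_smul,
    smul_smul]
  have : (1 + m 2)⁻¹ * (1 + m 2)⁻¹ * (2 * (1 + m 2)) = 2 * (1 + m 2)⁻¹ := by field_simp
  rw [this, two_mul, add_smul]
  simp

theorem det_swapMatrix {m : Fin 3 → ℝ} (hm : m ⬝ᵥ m = 1) (h : 1 + m 2 ≠ 0) :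
    (swapMatrix m).det = 1 := by
  have hm' : m 0 * m 0 + m 1 * m 1 + m 2 * m 2 = 1 := by
    simpa [dotProduct, Fin.sum_univ_succ, add_assoc] using hm
  have h0 : m 0 ^ 2 = 1 - m 1 ^ 2 - m 2 ^ 2 := by linarith
  rw [swapMatrix_eq, Matrix.det_fin_three]
  simp
  field_simp
  ring_nf
  simp only [h0]
  ring

theorem swapMatrix_mulVec {m : Fin 3 → ℝ} (h : 1 + m 2 ≠ 0) : swapMatrix m *ᵥ north = m := by
  rw [swapMatrix_eq]
  ext i
  have h' : m 2 + 1 ≠ 0 := by rwa [add_comm]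
  fin_cases i <;> simp [Matrix.mulVec, dotProduct, Fin.sum_univ_succ, north] <;> field_simp <;> ring

open Classical in
/-- A rotation that carries `north` to the unit vector `m ≠ -north`. -/
noncomputable def swapRot (m : Fin 3 → ℝ) : SO3 :=
  if h : m ⬝ᵥ m = 1 ∧ 1 + m 2 ≠ 0 then
    SO3.mk (swapMatrix m) (swapMatrix_mul_transpose h.1 h.2) (det_swapMatrix h.1 h.2)
  -- A default value; `swapRot` is evaluated meaningfully only at unit vectors away from `-north`.
  else 1

theorem swapRot_val {m : Fin 3 → ℝ} (hm : m ⬝ᵥ m = 1) (h : 1 + m 2 ≠ 0) :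
    ((swapRot m : (Matrix (Fin 3) (Fin 3) ℝ)ˣ) : Matrix (Fin 3) (Fin 3) ℝ) = swapMatrix m := by
  rw [swapRot, dif_pos ⟨hm, h⟩]
  rfl

theorem swapRot_vec {m : Fin 3 → ℝ} (hm : m ⬝ᵥ m = 1) (h : 1 + m 2 ≠ 0) :
    SO3.vec (swapRot m) north = m := by
  rw [SO3.vec, swapRot_val hm h, swapMatrix_mulVec h]

theorem contDiffOn_swapMatrix : ContDiffOn ℝ ∞ swapMatrix {m | 1 + m 2 ≠ 0} := by
  have hc : ∀ i, ContDiff ℝ ∞ fun m : Fin 3 → ℝ => m i := fun i => contDiff_apply ℝ ℝ i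
  have hi : ContDiffOn ℝ ∞ (fun m : Fin 3 → ℝ => (1 + m 2)⁻¹) {m | 1 + m 2 ≠ 0} :=
    ((contDiff_const.add (hc 2)).contDiffOn).inv fun m hm => hm
  have hv : ContDiff ℝ ∞ fun m : Fin 3 → ℝ => Matrix.vecMulVec (m + north) (m + north) :=
    contDiff_matrix fun i j => by
      simp only [Matrix.vecMulVec_apply, Pi.add_apply]
      exact ((hc i).add contDiff_const).mul ((hc j).add contDiff_const)
  exact (hi.smul hv.contDiffOn).sub contDiffOn_const

/-! ### The Lie algebras of `SO₃` and `O₂` -/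

/-- Differentiate `γᵀ γ = 1` at the identity. -/
theorem transpose_of_mem_lieSet_SO3 {X : Matrix (Fin 3) (Fin 3) ℝ} (hX : X ∈ lieSet SO3) :
    Xᵀ = -X := by
  obtain ⟨γ, -, h0, h1⟩ := hX
  let T : Matrix (Fin 3) (Fin 3) ℝ →L[ℝ] Matrix (Fin 3) (Fin 3) ℝ :=
    (Matrix.transposeLinearEquiv (Fin 3) (Fin 3) ℝ ℝ).toLinearMap.toContinuousLinearMap
  have h2 : HasDerivAt (fun t => (((γ t : (Matrix (Fin 3) (Fin 3) ℝ)ˣ) :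
      Matrix (Fin 3) (Fin 3) ℝ))ᵀ) Xᵀ 0 := T.hasFDerivAt.comp_hasDerivAt (x := (0 : ℝ)) h1
  have h3 := h2.mul h1
  have h4 : (fun t => (((γ t : (Matrix (Fin 3) (Fin 3) ℝ)ˣ) : Matrix (Fin 3) (Fin 3) ℝ))ᵀ *
      ((γ t : (Matrix (Fin 3) (Fin 3) ℝ)ˣ) : Matrix (Fin 3) (Fin 3) ℝ)) = fun _ => 1 :=
    funext fun t => SO3.transpose_mul_self (γ t)
  have h5 := h3.unique ((hasDerivAt_const (0 : ℝ) (1 : Matrix (Fin 3) (Fin 3) ℝ)).congr_of_eventuallyEq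
    (Filter.Eventually.of_forall fun t => congrFun h4 t))
  simp only [h0, Subgroup.coe_one, Units.val_one, mul_one, Matrix.transpose_one, one_mul] at h5
  exact eq_neg_of_add_eq_zero_left h5

/-- The generator of the rotations of the plane. -/
def planeGen (c : ℝ) : Matrix (Fin 2) (Fin 2) ℝ := !![0, -c; c, 0]

/-- The generator of the rotations of `ℝ³` about the third axis. -/
def axisGen (c : ℝ) : Matrix (Fin 3) (Fin 3) ℝ := !![0, -c, 0; c, 0, 0; 0, 0, 0]

/-- Rotation of the plane. -/
noncomputable def planeRot (θ : ℝ) : O2 :=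
  O2.mk !![Real.cos θ, -Real.sin θ; Real.sin θ, Real.cos θ] (by
    have h := Real.cos_sq_add_sin_sq θ
    ext i j
    fin_cases i <;> fin_cases j <;> simp [Matrix.mul_apply, Fin.sum_univ_succ] <;> linarith)

theorem planeRot_val (θ : ℝ) : ((planeRot θ : (Matrix (Fin 2) (Fin 2) ℝ)ˣ) :
    Matrix (Fin 2) (Fin 2) ℝ) = !![Real.cos θ, -Real.sin θ; Real.sin θ, Real.cos θ] := rfl

theorem hasDerivAt_matrix {n : ℕ} {f : ℝ → Matrix (Fin n) (Fin n) ℝ} {X : Matrix (Fin n) (Fin n) ℝ}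
    {t : ℝ} (h : ∀ i j, HasDerivAt (fun s => f s i j) (X i j) t) : HasDerivAt f X t := by
  have h1 : HasDerivAt (fun s => (fun i j => f s i j : Fin n → Fin n → ℝ)) (fun i j => X i j) t :=
    hasDerivAt_pi.2 fun i => hasDerivAt_pi.2 fun j => h i j
  exact ((Matrix.ofLinearEquiv ℝ : (Fin n → Fin n → ℝ) ≃ₗ[ℝ]
    Matrix (Fin n) (Fin n) ℝ).toLinearMap.toContinuousLinearMap.hasFDerivAt).comp_hasDerivAt t h1

theorem contDiff_planeRot (c : ℝ) : ContDiff ℝ ∞ fun t =>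
    ((planeRot (c * t) : (Matrix (Fin 2) (Fin 2) ℝ)ˣ) : Matrix (Fin 2) (Fin 2) ℝ) := by
  have hl : ContDiff ℝ ∞ fun t : ℝ => c * t := contDiff_const.mul contDiff_id
  have hc := Real.contDiff_cos.comp hl
  have hs := Real.contDiff_sin.comp hl
  refine contDiff_matrix fun i j => ?_
  simp only [planeRot_val]
  fin_cases i <;> fin_cases j
  exacts [hc, hs.neg, hs, hc]

theorem hasDerivAt_planeRot (c : ℝ) : HasDerivAt (fun t =>
    ((planeRot (c * t) : (Matrix (Fin 2) (Fin 2) ℝ)ˣ) : Matrix (Fin 2) (Fin 2) ℝ)) (planeGen c) 0 := by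
  have hl : HasDerivAt (fun t : ℝ => c * t) c 0 := by simpa using (hasDerivAt_id (0 : ℝ)).const_mul c
  have hc : HasDerivAt (fun t => Real.cos (c * t)) 0 0 := by simpa using hl.cos
  have hs : HasDerivAt (fun t => Real.sin (c * t)) c 0 := by simpa using hl.sin
  refine hasDerivAt_matrix fun i j => ?_
  simp only [planeRot_val]
  fin_cases i <;> fin_cases j
  exacts [hc, hs.neg, hs, hc]

theorem planeGen_mem (c : ℝ) : planeGen c ∈ lieSet O2 := by
  refine ⟨fun t => planeRot (c * t), contDiff_planeRot c, ?_, hasDerivAt_planeRot c⟩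
  refine Subtype.ext (Units.ext ?_)
  rw [planeRot_val]
  ext i j
  fin_cases i <;> fin_cases j <;> simp

/-- The chain rule along the curve `t ↦ planeRot (c * t)`, entry by entry; the determinant entry is
constantly one. -/
theorem inclO_diff_planeGen (c : ℝ) : inclO.diff (planeGen c) = axisGen c := by
  have h0 : ((planeRot (c * 0) : (Matrix (Fin 2) (Fin 2) ℝ)ˣ) : Matrix (Fin 2) (Fin 2) ℝ) = 1 := by
    rw [planeRot_val]
    ext i j
    fin_cases i <;> fin_cases j <;> simp
  have h1 : HasFDerivAt inclO.ext inclO.diff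
      ((planeRot (c * 0) : (Matrix (Fin 2) (Fin 2) ℝ)ˣ) : Matrix (Fin 2) (Fin 2) ℝ) := by
    rw [h0]
    exact inclO.hasFDerivAt_one
  refine (h1.comp_hasDerivAt (x := (0 : ℝ)) (hasDerivAt_planeRot c)).unique ?_
  have hl : HasDerivAt (fun t : ℝ => c * t) c 0 := by simpa using (hasDerivAt_id (0 : ℝ)).const_mul c
  have hc : HasDerivAt (fun t => Real.cos (c * t)) 0 0 := by simpa using hl.cos
  have hs : HasDerivAt (fun t => Real.sin (c * t)) c 0 := by simpa using hl.sin
  have h0 : HasDerivAt (fun _ : ℝ => (0 : ℝ)) 0 0 := hasDerivAt_const _ _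
  have hd : HasDerivAt (fun t : ℝ =>
      (!![Real.cos (c * t), -Real.sin (c * t); Real.sin (c * t), Real.cos (c * t)]).det) 0 0 := by
    refine (hasDerivAt_const (0 : ℝ) (1 : ℝ)).congr_of_eventuallyEq
      (Filter.Eventually.of_forall fun t => ?_)
    simp only [Matrix.det_fin_two]
    simp
    linarith [Real.cos_sq_add_sin_sq (c * t)]
  refine hasDerivAt_matrix fun i j => ?_
  fin_cases i <;> fin_cases j
  exacts [hc, hs.neg, h0, hs, hc, h0, h0, h0, hd]

/-- An infinitesimal rotation that kills `north`. -/
theorem eq_axisGen {X : Matrix (Fin 3) (Fin 3) ℝ} (hX : Xᵀ = -X) (h : X *ᵥ north = 0) :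
    X = axisGen (X 1 0) := by
  have e := fun i j => congrFun (congrFun hX i) j
  simp only [Matrix.transpose_apply, Matrix.neg_apply] at e
  have h0 := congrFun h 0
  have h1 := congrFun h 1
  have h2 := congrFun h 2
  simp [Matrix.mulVec, dotProduct, Fin.sum_univ_succ, north] at h0 h1 h2
  have e00 := e 0 0
  have e11 := e 1 1
  have e10 := e 1 0
  have e20 := e 2 0
  have e21 := e 2 1
  ext i j
  fin_cases i <;> fin_cases j <;> simp [axisGen] <;> linarith

/-- Skew-symmetry and a vanishing third column leave only the generator of rotations about the third
axis. This is the criterion by which a connection form is recognised as coming from `O₂`. -/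
theorem inclO_diff_upperBlock {X : Matrix (Fin 3) (Fin 3) ℝ} (hX : Xᵀ = -X)
    (h : X *ᵥ north = 0) : upperBlock X ∈ lieSet O2 ∧ inclO.diff (upperBlock X) = X := by
  have e : upperBlock X = planeGen (X 1 0) := by
    rw [eq_axisGen hX h, upperBlock_apply]
    ext i j
    fin_cases i <;> fin_cases j <;> simp [axisGen, planeGen]
  rw [e]
  exact ⟨planeGen_mem _, (inclO_diff_planeGen _).trans (eq_axisGen hX h).symm⟩

/-- The first two entries of the third column vanish identically on block matrices, hence so do
their derivatives; the last entry vanishes by skew-symmetry. -/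
theorem inclO_diff_mulVec_north {B : Matrix (Fin 2) (Fin 2) ℝ} (hB : B ∈ lieSet O2) :
    inclO.diff B *ᵥ north = 0 := by
  have hs := transpose_of_mem_lieSet_SO3 (inclO.diff_mem hB)
  have e22 := congrFun (congrFun hs 2) 2
  simp only [Matrix.transpose_apply, Matrix.neg_apply] at e22
  obtain ⟨γ, -, h0, h1⟩ := hB
  have hF : HasFDerivAt inclO.ext inclO.diff
      ((γ 0 : (Matrix (Fin 2) (Fin 2) ℝ)ˣ) : Matrix (Fin 2) (Fin 2) ℝ) := by
    rw [h0]
    exact inclO.hasFDerivAt_one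
  have h2 := hF.comp_hasDerivAt (x := (0 : ℝ)) h1
  have h3 : ∀ i j, (∀ t, inclO.ext ((γ t : (Matrix (Fin 2) (Fin 2) ℝ)ˣ) :
      Matrix (Fin 2) (Fin 2) ℝ) i j = 0) → inclO.diff B i j = 0 := by
    intro i j hij
    have h4 := ((Matrix.entryLinearMap ℝ ℝ i j).toContinuousLinearMap.hasFDerivAt).comp_hasDerivAt
      (x := (0 : ℝ)) h2
    refine h4.unique ((hasDerivAt_const (0 : ℝ) (0 : ℝ)).congr_of_eventuallyEq
      (Filter.Eventually.of_forall fun t => hij t))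
  have h02 := h3 0 2 fun t => rfl
  have h12 := h3 1 2 fun t => rfl
  ext i
  fin_cases i <;> simp [Matrix.mulVec, dotProduct, Fin.sum_univ_succ, north, h02, h12]
  linarith

end RotationGroup

/-! ### From a reduction to `O₂` to a parallel axis -/

section Axis

open PrincipalBundle Matrix

section

variable {𝔸 : Type} [NormedRing 𝔸] [NormedAlgebra ℝ 𝔸] {G : Subgroup 𝔸ˣ}
  {Y : Type u} [TopologicalSpace Y] [ChartedSpace (EuclideanSpace ℝ (Fin 2)) Y]

theorem PrincipalBundle.div_act_act (P : PrincipalBundle Y G) {x : Y} (p q : P.Fib x) (g h : G) :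
    P.div (P.act p g) (P.act q h) = g⁻¹ * P.div p q * h := by
  apply P.div_eq
  rw [← P.act_mul, mul_assoc, mul_inv_cancel_left, P.act_mul, P.act_div]

theorem PrincipalBundle.div_act_right (P : PrincipalBundle Y G) {x : Y} (p q : P.Fib x) (h : G) :
    P.div p (P.act q h) = P.div p q * h := by
  apply P.div_eq
  rw [P.act_mul, P.act_div]

theorem PrincipalBundle.div_act_left (P : PrincipalBundle Y G) {x : Y} (p q : P.Fib x) (g : G) :
    P.div (P.act p g) q = g⁻¹ * P.div p q := by
  apply P.div_eq
  rw [← P.act_mul, mul_inv_cancel_left, P.act_div]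

theorem PrincipalBundle.div_mul_div (P : PrincipalBundle Y G) {x : Y} (p q r : P.Fib x) :
    P.div p q * P.div q r = P.div p r := by
  symm
  apply P.div_eq
  rw [P.act_mul, P.act_div, P.act_div]

theorem PrincipalBundle.div_inv (P : PrincipalBundle Y G) {x : Y} (p q : P.Fib x) :
    (P.div p q)⁻¹ = P.div q p := by
  rw [inv_eq_iff_mul_eq_one, P.div_mul_div, P.div_self]

theorem Iso.toFun_pushMk_act {𝔹 : Type} [NormedRing 𝔹] [NormedAlgebra ℝ 𝔹] {H : Subgroup 𝔹ˣ}
    (F : LinHom G H) {Q : PrincipalBundle Y G} {R : PrincipalBundle Y H} (φ : Iso (Q.push F) R)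
    {x : Y} (q : Q.Fib x) (g : G) : φ.toFun (Q.pushMk F (Q.act q g) 1) =
      R.act (φ.toFun (Q.pushMk F q 1)) (F.hom g) := by
  rw [pushMk_act, mul_one]
  have := φ.equivariant (Q.pushMk F q 1) (F.hom g)
  rwa [push_act, one_mul] at this

theorem SmoothOn.congr {h k : Y → G} {U : Set Y} (hh : SmoothOn h U) (e : ∀ x ∈ U, k x = h x) :
    SmoothOn k U :=
  ContMDiffOn.congr hh fun x hx => by rw [e x hx]

theorem smoothOn_const (g : G) (U : Set Y) : SmoothOn (fun _ => g) U :=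
  contMDiffOn_const

end

section

variable {Y : Type u} [TopologicalSpace Y] [ChartedSpace (EuclideanSpace ℝ (Fin 2)) Y]

/-- Evaluation of three by three matrices at a vector. -/
noncomputable def mulVecCLM (m : Fin 3 → ℝ) : Matrix (Fin 3) (Fin 3) ℝ →L[ℝ] (Fin 3 → ℝ) :=
  LinearMap.toContinuousLinearMap
    { toFun := fun M => M *ᵥ m
      map_add' := fun M N => Matrix.add_mulVec M N m
      map_smul' := fun c M => Matrix.smul_mulVec c M m }

theorem SmoothOn.vec {h : Y → SO3} {U : Set Y} (hh : SmoothOn h U) (m : Fin 3 → ℝ) :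
    ContMDiffOn (𝓡 2) 𝓘(ℝ, Fin 3 → ℝ) ∞ (fun y => SO3.vec (h y) m) U :=
  (mulVecCLM m).contDiff.contMDiff.comp_contMDiffOn hh

theorem SmoothOn.smul {E : Type*} [NormedAddCommGroup E] [NormedSpace ℝ E] {e : Y → Z2}
    {f : Y → E} {U : Set Y} (he : SmoothOn e U) (hf : ContMDiffOn (𝓡 2) 𝓘(ℝ, E) ∞ f U) :
    ContMDiffOn (𝓡 2) 𝓘(ℝ, E) ∞ (fun y => ((e y : ℝˣ) : ℝ) • f y) U :=
  ContMDiffOn.smul he hf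

theorem mvfderiv_Z2_smul {E : Type*} [NormedAddCommGroup E] [NormedSpace ℝ E] {e : Y → Z2}
    {f : Y → E} {U : Set Y} (hU : IsOpen U) (he : SmoothOn e U)
    {x : Y} (hx : x ∈ U) (hf : MDifferentiableAt (𝓡 2) 𝓘(ℝ, E) f x) (v : TangentSpace (𝓡 2) x) :
    mvfderiv (𝓡 2) (fun y => ((e y : ℝˣ) : ℝ) • f y) x v =
      ((e x : ℝˣ) : ℝ) • mvfderiv (𝓡 2) f x v := by
  have h := congrArg (fun T => T v) (mvfderiv_smul (he.mdiff hU hx) hf)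
  have h2 := mvfderiv_Z2 hU he hx v
  refine h.trans ?_
  change ((e x : ℝˣ) : ℝ) • mvfderiv (𝓡 2) f x v + mvfderiv (𝓡 2) (fun y => ((e y : ℝˣ) : ℝ)) x v • f x = _
  rw [h2, zero_smul, add_zero]

theorem mvfderiv_vec {h : Y → SO3} {U : Set Y} (hU : IsOpen U) (hh : SmoothOn h U) {x : Y} (hx : x ∈ U)
    (m : Fin 3 → ℝ) (v : TangentSpace (𝓡 2) x) :
    mvfderiv (𝓡 2) (fun y => SO3.vec (h y) m) x v = mvfderiv (𝓡 2)
      (fun y => ((h y : (Matrix (Fin 3) (Fin 3) ℝ)ˣ) : Matrix (Fin 3) (Fin 3) ℝ)) x v *ᵥ m :=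
  mvfderiv_clm_comp (mulVecCLM m) (hh.mdiff hU hx) v

/-- The gauge transform of a skew-symmetric form is skew-symmetric. -/
theorem gaugeAt_transpose {h : Y → SO3} {U : Set Y} (hU : IsOpen U) (hh : SmoothOn h U) {x : Y} (hx : x ∈ U)
    (α : TangentSpace (𝓡 2) x →L[ℝ] Matrix (Fin 3) (Fin 3) ℝ) {v : TangentSpace (𝓡 2) x}
    (hα : (α v)ᵀ = -α v) : (gaugeAt h α v)ᵀ = -gaugeAt h α v := by
  set X := gaugeAt h α v with hX
  have hd := (gaugeAt_eq_iff h α v X).1 hX.symm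
  set M := ((h x : (Matrix (Fin 3) (Fin 3) ℝ)ˣ) : Matrix (Fin 3) (Fin 3) ℝ) with hM
  let T : Matrix (Fin 3) (Fin 3) ℝ →L[ℝ] Matrix (Fin 3) (Fin 3) ℝ :=
    (Matrix.transposeLinearEquiv (Fin 3) (Fin 3) ℝ ℝ).toLinearMap.toContinuousLinearMap
  have hT := mvfderiv_clm_comp T (hh.mdiff hU hx) v
  have hTd := (T.differentiable.mdifferentiable.mdifferentiableAt).comp x (hh.mdiff hU hx)
  have h1 := mvfderiv_ring_mul hTd (hh.mdiff hU hx) v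
  simp only [Function.comp_def] at h1
  -- Differentiate `hᵀ h = 1` and substitute `dh = h X - α h`: the `α` terms cancel by
  -- skew-symmetry, and `X + Xᵀ = 0` remains.
  have h2 : (fun y => T ((h y : (Matrix (Fin 3) (Fin 3) ℝ)ˣ) : Matrix (Fin 3) (Fin 3) ℝ) *
      ((h y : (Matrix (Fin 3) (Fin 3) ℝ)ˣ) : Matrix (Fin 3) (Fin 3) ℝ)) = fun _ => 1 :=
    funext fun y => SO3.transpose_mul_self (h y)
  have hMM : Mᵀ * M = 1 := SO3.transpose_mul_self (h x)
  rw [h2, mvfderiv_const, hd] at h1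
  replace h1 : 0 = Mᵀ * (M * X - α v * M) + (M * X - α v * M)ᵀ * M := h1.trans
    (congrArg (fun D => Mᵀ * (M * X - α v * M) + D * M) (hT.trans (congrArg T hd)))
  rw [mul_sub, ← mul_assoc, hMM, one_mul, Matrix.transpose_sub, Matrix.transpose_mul,
    Matrix.transpose_mul, hα, sub_mul, mul_assoc, hMM, mul_one] at h1
  rw [eq_neg_iff_add_eq_zero]
  rw [mul_neg, neg_mul, mul_assoc] at h1
  rw [eq_comm] at h1
  rw [← h1]
  abel

end

variable {Y : Type u} [TopologicalSpace Y] [ChartedSpace (EuclideanSpace ℝ (Fin 2)) Y]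
  [IsManifold (𝓡 2) ∞ Y]

/-- A parallel unit section of the tensor product of the real line bundle of `Z` with the vector
bundle associated to the `SO₃`-connection `R`, written as an equivariant map. -/
structure ParallelAxis (R : GConn Y SO3) (Z : PrincipalBundle Y Z2) where
  toFun : ∀ {x : Y}, Z.Fib x → R.bundle.Fib x → (Fin 3 → ℝ)
  equivariant : ∀ {x : Y} (z : Z.Fib x) (r : R.bundle.Fib x) (e : Z2) (g : SO3),
    toFun (Z.act z e) (R.bundle.act r g) = ((e : ℝˣ) : ℝ) • SO3.vec g⁻¹ (toFun z r)
  unit : ∀ {x : Y} (z : Z.Fib x) (r : R.bundle.Fib x), toFun z r ⬝ᵥ toFun z r = 1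
  smooth : ∀ a i, ContMDiffOn (𝓡 2) 𝓘(ℝ, Fin 3 → ℝ) ∞
    (fun x => toFun (Z.sec a x) (R.bundle.sec i x)) (Z.dom a ∩ R.bundle.dom i)
  parallel : ∀ a i, ∀ x ∈ Z.dom a ∩ R.bundle.dom i, ∀ v,
    mvfderiv (𝓡 2) (fun y => toFun (Z.sec a y) (R.bundle.sec i y)) x v =
      -(R.conn.form i x v *ᵥ toFun (Z.sec a x) (R.bundle.sec i x))

/-- The third axis of a reduction to `O₂`. -/
noncomputable def axisOfFrame {Q : PrincipalBundle Y O2} {R : PrincipalBundle Y SO3}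
    {Z : PrincipalBundle Y Z2} (φ : Iso (Q.push inclO) R) (χ : Iso (Q.push detO) Z) {x : Y}
    (q : Q.Fib x) (z : Z.Fib x) (r : R.Fib x) : Fin 3 → ℝ :=
  ((Z.div (χ.toFun (Q.pushMk detO q 1)) z : ℝˣ) : ℝ) •
    SO3.vec (R.div r (φ.toFun (Q.pushMk inclO q 1))) north

-- Moving `q` by `a` multiplies the third vector by `det a` and the sign by its inverse. So the axis
-- depends on `z` and `r` alone.
omit [IsManifold (𝓡 2) ∞ Y] in
theorem axisOfFrame_congr {Q : PrincipalBundle Y O2} {R : PrincipalBundle Y SO3}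
    {Z : PrincipalBundle Y Z2} (φ : Iso (Q.push inclO) R) (χ : Iso (Q.push detO) Z) {x : Y}
    (q q' : Q.Fib x) (z : Z.Fib x) (r : R.Fib x) :
    axisOfFrame φ χ q z r = axisOfFrame φ χ q' z r := by
  rw [← Q.act_div q q']
  generalize Q.div q q' = a
  rw [axisOfFrame, axisOfFrame, Iso.toFun_pushMk_act, Iso.toFun_pushMk_act, R.div_act_right,
    SO3.vec_mul, inclO_vec_north, SO3.vec_smul, smul_smul]
  congr 1
  rw [Z.div_act_left, ← Units.val_mul, ← Subgroup.coe_mul, mul_right_comm, inv_mul_cancel, one_mul]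

/-- The axis is the third vector of the frames in `Q`. It is parallel because the connection form in
such a frame lies in the Lie algebra of `O₂`, which kills `north`. -/
theorem nonempty_parallelAxis_of_reduces {R : GConn Y SO3} {Z : PrincipalBundle Y Z2}
    (h : ReducesWithDet R Z) : Nonempty (ParallelAxis R Z) := by
  obtain ⟨Q, ⟨φ, hφ⟩, ⟨χ⟩⟩ := h
  change Iso (Q.bundle.push inclO) R.bundle at φ
  -- The choice of sections varies with the point without any regularity; `key` replaces them by one
  -- fixed section near a given point.
  choose j hj using Q.bundle.cover
  have key : ∀ (k : Q.bundle.ι) (a : Z.ι) (i : R.bundle.ι) (y : Y),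
      axisOfFrame φ χ (Q.bundle.sec (j y) y) (Z.sec a y) (R.bundle.sec i y) =
        ((((χ.rep k a y)⁻¹ : Z2) : ℝˣ) : ℝ) • SO3.vec (φ.rep k i y) north := by
    intro k a i y
    rw [axisOfFrame_congr φ χ _ (Q.bundle.sec k y), axisOfFrame, ← PrincipalBundle.div_inv]
    rfl
  have smoothχ : ∀ (k : Q.bundle.ι) (a : Z.ι), SmoothOn (fun y => (χ.rep k a y)⁻¹)
      (Q.bundle.dom k ∩ Z.dom a) := fun k a => (χ.smooth k a).inv
  have smoothφ : ∀ (k : Q.bundle.ι) (i : R.bundle.ι), SmoothOn (φ.rep k i)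
      (Q.bundle.dom k ∩ R.bundle.dom i) := fun k i => φ.smooth k i
  refine ⟨⟨fun {x} z r => axisOfFrame φ χ (Q.bundle.sec (j x) x) z r, ?_, ?_, ?_, ?_⟩⟩
  · intro x z r e g
    rw [axisOfFrame, axisOfFrame, Z.div_act_right]
    rw [R.bundle.div_act_left, SO3.vec_mul, SO3.vec_smul, smul_smul, mul_comm, Subgroup.coe_mul, Units.val_mul]
  · intro x z r
    rw [axisOfFrame, smul_dotProduct, dotProduct_smul, SO3.dotProduct_vec, north_dotProduct_north,
      smul_eq_mul, smul_eq_mul, mul_one, Z2.coe_mul_self]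
  · intro a i x hx
    simp only [key (j x) a i]
    have hx' : x ∈ Q.bundle.dom (j x) ∩ (Z.dom a ∩ R.bundle.dom i) := ⟨hj x, hx⟩
    refine ContMDiffAt.contMDiffWithinAt (ContMDiffOn.contMDiffAt (SmoothOn.smul
      ((smoothχ (j x) a).mono fun y hy => ⟨hy.1, hy.2.1⟩)
      (SmoothOn.vec ((smoothφ (j x) i).mono fun y hy => ⟨hy.1, hy.2.2⟩) north)) (IsOpen.mem_nhds
        ((Q.bundle.isOpen_dom _).inter ((Z.isOpen_dom a).inter (R.bundle.isOpen_dom i))) hx'))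
  · intro a i x hx v
    simp only [key (j x) a i]
    rw [mvfderiv_Z2_smul ((Q.bundle.isOpen_dom _).inter (Z.isOpen_dom a)) (smoothχ (j x) a)
      ⟨hj x, hx.1⟩ ?_ v, mvfderiv_vec
        ((Q.bundle.isOpen_dom _).inter (R.bundle.isOpen_dom i)) (smoothφ (j x) i) ⟨hj x, hx.2⟩]
    · have h1 := hφ (j x) i x ⟨hj x, hx.2⟩ v
      -- With `h` the frame, `B` the form of `Q` and `A` that of `R`: `dh north = h B north - A h
      -- north`, and `B north = 0` by `h2`.
      rw [(gaugeAt_eq_iff (φ.rep (j x) i) _ v _).1 h1.symm]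
      have h2 : ((Q.push inclO).conn.form (j x) x v) *ᵥ north = 0 :=
        inclO_diff_mulVec_north (Q.conn.form_mem (j x) x (hj x) v)
      rw [Matrix.sub_mulVec, ← Matrix.mulVec_mulVec, h2, Matrix.mulVec_zero, zero_sub,
        ← Matrix.mulVec_mulVec, smul_neg, Matrix.mulVec_smul]
      rfl
    · exact ((SmoothOn.vec (smoothφ (j x) i) north).contMDiffAt (IsOpen.mem_nhds
        ((Q.bundle.isOpen_dom _).inter (R.bundle.isOpen_dom i)) ⟨hj x, hx.2⟩)).mdifferentiableAt
        (by simp)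

end Axis

/-! ### From a parallel axis to a reduction to `O₂` -/

section Reduction

open PrincipalBundle Matrix

theorem upperBlock_inclO_diff (M : Matrix (Fin 2) (Fin 2) ℝ) : upperBlock (inclO.diff M) = M := by
  have h := upperBlock.hasFDerivAt.comp (1 : Matrix (Fin 2) (Fin 2) ℝ) inclO.hasFDerivAt_one
  have e : upperBlock ∘ inclO.ext = fun M => M := funext upperBlock_blockDet
  rw [e] at h
  exact congrArg (fun T => T M) (h.unique (hasFDerivAt_id _))

/-- The rotation `swapRot` is unavailable only at `-north`; a change of sign of `z` moves the axis
out of that direction. -/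
theorem exists_sign_one_add_ne_zero (m : Fin 3 → ℝ) :
    ∃ e : Z2, 1 + (((e : ℝˣ) : ℝ) • m) 2 ≠ 0 := by
  by_cases h : 1 + m 2 = 0
  · refine ⟨Z2.neg, ?_⟩
    change 1 + ((-1 : ℝˣ) : ℝ) * m 2 ≠ 0
    rw [Units.val_neg, Units.val_one]
    intro h'
    linarith
  · refine ⟨1, ?_⟩
    simpa using h

variable {Y : Type u} [TopologicalSpace Y] [ChartedSpace (EuclideanSpace ℝ (Fin 2)) Y]
  [IsManifold (𝓡 2) ∞ Y] {R : GConn Y SO3} {Z : PrincipalBundle Y Z2}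

namespace ParallelAxis

variable (W : ParallelAxis R Z)

/-- The frames whose third vector is the axis. -/
def Fib (x : Y) : Type u := {p : Z.Fib x × R.bundle.Fib x // W.toFun p.1 p.2 = north}

theorem toFun_act_of_eq_north {x : Y} {z : Z.Fib x} {r : R.bundle.Fib x}
    (h : W.toFun z r = north) (a : O2) :
    W.toFun (Z.act z (detO.hom a)) (R.bundle.act r (inclO.hom a)) = north := by
  rw [W.equivariant, h, ← map_inv, inclO_vec_north, smul_smul, map_inv]
  have : ((detO.hom a : ℝˣ) : ℝ) * ((((detO.hom a)⁻¹ : Z2) : ℝˣ) : ℝ) = 1 := by simp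
  rw [this, one_smul]

variable {W}

noncomputable def act {x : Y} (p : W.Fib x) (a : O2) : W.Fib x :=
  ⟨(Z.act p.1.1 (detO.hom a), R.bundle.act p.1.2 (inclO.hom a)), W.toFun_act_of_eq_north p.2 a⟩

/-- The rotation from `r` to `r'` carries `north` to `±north`, the sign being the one from `z` to
`z'`. So it lies in `O₂` with this determinant, and the `Z` component agrees automatically. -/
theorem existsUnique_act {x : Y} (p q : W.Fib x) : ∃! a : O2, act p a = q := by
  obtain ⟨⟨z, r⟩, hp⟩ := p
  obtain ⟨⟨z', r'⟩, hq⟩ := q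
  simp only at hp hq
  have h := W.equivariant z r (Z.div z z') (R.bundle.div r r')
  rw [Z.act_div, R.bundle.act_div, hp, hq] at h
  have h' : SO3.vec (R.bundle.div r r') north = ((Z.div z z' : ℝˣ) : ℝ) • north := by
    conv_lhs => rw [h]
    rw [SO3.vec_smul, SO3.vec_vec_inv]
  obtain ⟨a, ha, hd⟩ := exists_inclO_eq h'
  refine ⟨a, Subtype.ext (Prod.ext ?_ ?_), fun b hb => inclO_injective ?_⟩
  · change Z.act z (detO.hom a) = z'
    rw [hd, Z.act_div]
  · change R.bundle.act r (inclO.hom a) = r'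
    rw [ha, R.bundle.act_div]
  · have h2 : R.bundle.act r (inclO.hom b) = r' := congrArg (fun p => p.1.2) hb
    rw [ha]
    exact (R.bundle.div_eq h2).symm

variable (W) in
/-- Smooth local frames whose third vector is the axis. -/
structure LocalFrame where
  dom : Set Y
  isOpen_dom : IsOpen dom
  frame : ∀ x, W.Fib x
  smooth_fst : ∀ a, SmoothOn (fun x => Z.div (Z.sec a x) (frame x).1.1) (dom ∩ Z.dom a)
  smooth_snd : ∀ i, SmoothOn (fun x => R.bundle.div (R.bundle.sec i x) (frame x).1.2)
    (dom ∩ R.bundle.dom i)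

-- With `n` the axis multiplied by the sign `e`, equivariance gives `swapRot(n)⁻¹ n` for the axis in
-- the new frame, which is `north`.
variable (W) in
theorem toFun_swapRot {x : Y} (z : Z.Fib x) (r : R.bundle.Fib x) {e : Z2}
    (h : 1 + (((e : ℝˣ) : ℝ) • W.toFun z r) 2 ≠ 0) :
    W.toFun (Z.act z e) (R.bundle.act r (swapRot (((e : ℝˣ) : ℝ) • W.toFun z r))) = north := by
  have hu : (((e : ℝˣ) : ℝ) • W.toFun z r) ⬝ᵥ (((e : ℝˣ) : ℝ) • W.toFun z r) = 1 := by
    rw [smul_dotProduct, dotProduct_smul, W.unit, smul_eq_mul, smul_eq_mul, mul_one,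
      Z2.coe_mul_self]
  rw [W.equivariant, ← SO3.vec_smul]
  have h1 := SO3.vec_inv_vec (swapRot (((e : ℝˣ) : ℝ) • W.toFun z r)) north
  rwa [swapRot_vec hu h] at h1

variable (W) in
theorem nonempty_fib (x : Y) : Nonempty (W.Fib x) := by
  obtain ⟨a, -⟩ := Z.cover x
  obtain ⟨i, -⟩ := R.bundle.cover x
  obtain ⟨e, he⟩ := exists_sign_one_add_ne_zero (W.toFun (Z.sec a x) (R.bundle.sec i x))
  exact ⟨⟨(_, _), W.toFun_swapRot _ _ he⟩⟩

variable (W) in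
theorem exists_localFrame (x : Y) : ∃ s : W.LocalFrame, x ∈ s.dom := by
  classical
  obtain ⟨a, ha⟩ := Z.cover x
  obtain ⟨i, hi⟩ := R.bundle.cover x
  obtain ⟨e, he⟩ := exists_sign_one_add_ne_zero (W.toFun (Z.sec a x) (R.bundle.sec i x))
  set n : Y → Fin 3 → ℝ :=
    fun y => ((e : ℝˣ) : ℝ) • W.toFun (Z.sec a y) (R.bundle.sec i y) with hn
  have hD : IsOpen (Z.dom a ∩ R.bundle.dom i) := (Z.isOpen_dom a).inter (R.bundle.isOpen_dom i)
  have hns : ContMDiffOn (𝓡 2) 𝓘(ℝ, Fin 3 → ℝ) ∞ n (Z.dom a ∩ R.bundle.dom i) :=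
    SmoothOn.smul (smoothOn_const e _) (W.smooth a i)
  have hu : ∀ y, n y ⬝ᵥ n y = 1 := fun y => by
    rw [hn, smul_dotProduct, dotProduct_smul, W.unit, smul_eq_mul, smul_eq_mul, mul_one,
      Z2.coe_mul_self]
  -- The sign `e` was chosen for the point `x`; it still avoids `-north` on this open neighbourhood.
  set U : Set Y := (Z.dom a ∩ R.bundle.dom i) ∩ n ⁻¹' {m | 1 + m 2 ≠ 0} with hUdef
  have hU : IsOpen U := hns.continuousOn.isOpen_inter_preimage hD
    (isOpen_ne_fun (continuous_const.add (continuous_apply 2)) continuous_const)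
  -- Frames are total functions of which only the values on `U` matter, so any point of the fibre
  -- serves where `1 + n y 2 = 0`.
  let s : ∀ y, W.Fib y := fun y =>
    if h : 1 + n y 2 ≠ 0 then
      ⟨(Z.act (Z.sec a y) e, R.bundle.act (R.bundle.sec i y) (swapRot (n y))),
        W.toFun_swapRot _ _ h⟩
    else (W.nonempty_fib y).some
  have hs : ∀ y ∈ U, (s y).1 =
      (Z.act (Z.sec a y) e, R.bundle.act (R.bundle.sec i y) (swapRot (n y))) := fun y hy => by
    have : 1 + n y 2 ≠ 0 := hy.2
    exact congrArg Subtype.val (dif_pos this)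
  have hrot : SmoothOn (fun y => swapRot (n y)) U := by
    have h1 := contDiffOn_swapMatrix.contMDiffOn.comp (hns.mono fun y hy => hy.1)
      (fun y (hy : y ∈ U) => hy.2)
    exact h1.congr fun y hy => swapRot_val (hu y) hy.2
  refine ⟨⟨U, hU, s, fun b => ?_, fun j => ?_⟩, ⟨ha, hi⟩, he⟩
  · refine SmoothOn.congr (SmoothOn.mul ((Z.smooth_trans b a).mono fun y hy => ⟨hy.2, hy.1.1.1⟩)
      (smoothOn_const e _)) fun y hy => ?_
    rw [hs y hy.1, Z.div_act_right]
    rfl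
  · refine SmoothOn.congr (SmoothOn.mul ((R.bundle.smooth_trans j i).mono
      fun y hy => ⟨hy.2, hy.1.1.2⟩) (hrot.mono fun y hy => hy.1)) fun y hy => ?_
    rw [hs y hy.1, R.bundle.div_act_right]
    rfl

/-- In `SO₃` the transition is a quotient of two smooth coordinate functions, and the linear map
`upperBlock` recovers the `O₂`-valued function from it. -/
theorem LocalFrame.smooth_transition (s t : W.LocalFrame) : ∃ g : Y → O2,
    SmoothOn g (s.dom ∩ t.dom) ∧ ∀ x, act (s.frame x) (g x) = t.frame x := by
  choose g hg _ using fun x => existsUnique_act (s.frame x) (t.frame x)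
  refine ⟨g, ?_, hg⟩
  have h1 : ∀ i x, inclO.hom (g x) =
      (R.bundle.div (R.bundle.sec i x) (s.frame x).1.2)⁻¹ *
        R.bundle.div (R.bundle.sec i x) (t.frame x).1.2 := by
    intro i x
    rw [R.bundle.div_inv, R.bundle.div_mul_div, ← hg x]
    exact (R.bundle.div_eq rfl).symm
  have h2 : SmoothOn (fun x => inclO.hom (g x)) (s.dom ∩ t.dom) := by
    refine SmoothOn.of_cover R.bundle.dom R.bundle.isOpen_dom R.bundle.cover fun i => ?_
    exact SmoothOn.congr (SmoothOn.mul
      ((s.smooth_snd i).inv.mono fun x hx => ⟨hx.1.1, hx.2⟩)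
      ((t.smooth_snd i).mono fun x hx => ⟨hx.1.2, hx.2⟩)) fun x _ => h1 i x
  have h3 := upperBlock.contDiff.contMDiff.comp_contMDiffOn h2
  refine h3.congr fun x _ => ?_
  exact (upperBlock_blockDet _).symm

variable (W) in
/-- The reduction to `O₂` given by a parallel axis. -/
noncomputable def bundle : PrincipalBundle Y O2 where
  Fib := W.Fib
  act := act
  act_one p := Subtype.ext (Prod.ext (by
    change Z.act _ _ = _
    rw [map_one, Z.act_one]) (by
    change R.bundle.act _ _ = _
    rw [map_one, R.bundle.act_one]))
  act_mul p a b := Subtype.ext (Prod.ext (by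
    change Z.act _ _ = Z.act (Z.act _ _) _
    rw [map_mul, Z.act_mul]) (by
    change R.bundle.act _ _ = R.bundle.act (R.bundle.act _ _) _
    rw [map_mul, R.bundle.act_mul]))
  torsor := existsUnique_act
  ι := W.LocalFrame
  dom s := s.dom
  isOpen_dom s := s.isOpen_dom
  cover := W.exists_localFrame
  sec s := s.frame
  smooth_sec := LocalFrame.smooth_transition

namespace LocalFrame

/-- The local frame `s`, relative to the local section `i` of `R`. -/
noncomputable def coord (s : W.LocalFrame) (i : R.bundle.ι) (x : Y) : SO3 :=
  R.bundle.div (R.bundle.sec i x) (s.frame x).1.2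

theorem smooth_coord (s : W.LocalFrame) (i : R.bundle.ι) :
    SmoothOn (s.coord i) (s.dom ∩ R.bundle.dom i) := s.smooth_snd i

theorem isOpen_inter (s : W.LocalFrame) (i : R.bundle.ι) : IsOpen (s.dom ∩ R.bundle.dom i) :=
  s.isOpen_dom.inter (R.bundle.isOpen_dom i)

/-- The equivariance of the axis, solved for the third vector of the frame. -/
theorem coord_vec_north (s : W.LocalFrame) (a : Z.ι) (i : R.bundle.ι) (x : Y) :
    SO3.vec (s.coord i x) north = ((Z.div (Z.sec a x) (s.frame x).1.1 : ℝˣ) : ℝ) •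
      W.toFun (Z.sec a x) (R.bundle.sec i x) := by
  have h := W.equivariant (Z.sec a x) (R.bundle.sec i x) (Z.div (Z.sec a x) (s.frame x).1.1)
    (R.bundle.div (R.bundle.sec i x) (s.frame x).1.2)
  rw [Z.act_div, R.bundle.act_div, (s.frame x).2] at h
  refine (congrArg (SO3.vec (s.coord i x)) h).trans ?_
  rw [SO3.vec_smul]
  exact congrArg _ (SO3.vec_vec_inv _ _)

/-- A change of the local section of `R` inserts a transition function, which the compatibility of
the connection forms absorbs. Thus the pull-back along the frame depends only on the frame. -/
theorem gaugeAt_coord_congr (s : W.LocalFrame) {i j : R.bundle.ι} {x : Y} (hx : x ∈ s.dom)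
    (hi : x ∈ R.bundle.dom i) (hj : x ∈ R.bundle.dom j) (v : TangentSpace (𝓡 2) x) :
    gaugeAt (s.coord i) (R.conn.form i x) v = gaugeAt (s.coord j) (R.conn.form j x) v := by
  have e : s.coord i = fun y => R.bundle.trans i j y * s.coord j y := funext fun y =>
    (R.bundle.div_mul_div _ _ _).symm
  rw [e]
  exact gaugeAt_mul ((R.bundle.smooth_trans i j).mdiff
    ((R.bundle.isOpen_dom i).inter (R.bundle.isOpen_dom j)) ⟨hi, hj⟩)
    ((s.smooth_coord j).mdiff (s.isOpen_inter j) ⟨hx, hj⟩) _ _ _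
    (R.conn.compat i j x ⟨hi, hj⟩ v)

/-- The third vector `h north` has derivative `h X north - A h north` because `dh = h X - A h`, and
derivative `-A h north` because it is the axis up to a sign. Hence `h X north = 0`. -/
theorem gaugeAt_coord_north (s : W.LocalFrame) {i : R.bundle.ι} {x : Y} (hx : x ∈ s.dom)
    (hi : x ∈ R.bundle.dom i) (v : TangentSpace (𝓡 2) x) :
    gaugeAt (s.coord i) (R.conn.form i x) v *ᵥ north = 0 := by
  obtain ⟨a, ha⟩ := Z.cover x
  have h1 := (gaugeAt_eq_iff (s.coord i) (R.conn.form i x) v _).1 rfl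
  have h2 := mvfderiv_vec (s.isOpen_inter i) (s.smooth_coord i) ⟨hx, hi⟩ north v
  have h3 : (fun y => SO3.vec (s.coord i y) north) = fun y =>
      ((Z.div (Z.sec a y) (s.frame y).1.1 : ℝˣ) : ℝ) •
        W.toFun (Z.sec a y) (R.bundle.sec i y) := funext fun y => s.coord_vec_north a i y
  have hm : IsOpen (Z.dom a ∩ R.bundle.dom i) := (Z.isOpen_dom a).inter (R.bundle.isOpen_dom i)
  rw [h3, mvfderiv_Z2_smul (s.isOpen_dom.inter (Z.isOpen_dom a)) (s.smooth_fst a) ⟨hx, ha⟩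
    (((W.smooth a i).contMDiffAt (hm.mem_nhds ⟨ha, hi⟩)).mdifferentiableAt (by simp)),
    W.parallel a i x ⟨ha, hi⟩, h1, Matrix.sub_mulVec, smul_neg, ← Matrix.mulVec_smul,
    ← s.coord_vec_north, ← Matrix.mulVec_mulVec, ← Matrix.mulVec_mulVec] at h2
  have h4 : SO3.vec (s.coord i x) (gaugeAt (s.coord i) (R.conn.form i x) v *ᵥ north) = 0 := by
    have h5 : R.conn.form i x v *ᵥ SO3.vec (s.coord i x) north = R.conn.form i x v *ᵥ
      ((s.coord i x : (Matrix (Fin 3) (Fin 3) ℝ)ˣ) : Matrix (Fin 3) (Fin 3) ℝ) *ᵥ north := rfl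
    rw [h5, neg_eq_iff_add_eq_zero, add_sub_cancel] at h2
    exact h2
  rw [← SO3.vec_inv_vec (s.coord i x) (gaugeAt _ _ v *ᵥ north), h4, SO3.vec, Matrix.mulVec_zero]

theorem gaugeAt_coord_transpose (s : W.LocalFrame) {i : R.bundle.ι} {x : Y} (hx : x ∈ s.dom)
    (hi : x ∈ R.bundle.dom i) (v : TangentSpace (𝓡 2) x) :
    (gaugeAt (s.coord i) (R.conn.form i x) v)ᵀ = -gaugeAt (s.coord i) (R.conn.form i x) v :=
  gaugeAt_transpose (s.isOpen_inter i) (s.smooth_coord i) ⟨hx, hi⟩ _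
    (transpose_of_mem_lieSet_SO3 (R.conn.form_mem i x hi v))

/-- The connection form in the local frame `s`. -/
noncomputable def form (s : W.LocalFrame) (x : Y) :
    TangentSpace (𝓡 2) x →L[ℝ] Matrix (Fin 2) (Fin 2) ℝ :=
  -- An arbitrary section around each point; `form_apply` shows that the choice does not matter.
  upperBlock.comp (gaugeCLM (s.coord (R.bundle.cover x).choose)
    (R.conn.form (R.bundle.cover x).choose x))

theorem form_apply (s : W.LocalFrame) {i : R.bundle.ι} {x : Y} (hx : x ∈ s.dom)
    (hi : x ∈ R.bundle.dom i) (v : TangentSpace (𝓡 2) x) :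
    s.form x v = upperBlock (gaugeAt (s.coord i) (R.conn.form i x) v) := by
  rw [← s.gaugeAt_coord_congr hx (R.bundle.cover x).choose_spec hi v, ← gaugeCLM_apply]
  rfl

theorem form_mem (s : W.LocalFrame) {x : Y} (hx : x ∈ s.dom) (v : TangentSpace (𝓡 2) x) :
    s.form x v ∈ lieSet O2 := by
  obtain ⟨i, hi⟩ := R.bundle.cover x
  rw [s.form_apply hx hi]
  exact (inclO_diff_upperBlock (s.gaugeAt_coord_transpose hx hi v)
    (s.gaugeAt_coord_north hx hi v)).1

theorem inclO_diff_form (s : W.LocalFrame) {i : R.bundle.ι} {x : Y} (hx : x ∈ s.dom)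
    (hi : x ∈ R.bundle.dom i) (v : TangentSpace (𝓡 2) x) :
    inclO.diff (s.form x v) = gaugeAt (s.coord i) (R.conn.form i x) v := by
  rw [s.form_apply hx hi]
  exact (inclO_diff_upperBlock (s.gaugeAt_coord_transpose hx hi v)
    (s.gaugeAt_coord_north hx hi v)).2

/-- The transformation law holds in `SO₃`, where the frames differ by the image of the transition
function, and `upperBlock` undoes the differential of the inclusion. -/
theorem form_compat (s t : W.LocalFrame) {x : Y} (hx : x ∈ s.dom ∩ t.dom)
    (v : TangentSpace (𝓡 2) x) : t.form x v = gaugeAt (W.bundle.trans s t) (s.form x) v := by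
  obtain ⟨i, hi⟩ := R.bundle.cover x
  have hg := (W.bundle.smooth_trans s t).mdiff (s.isOpen_dom.inter t.isOpen_dom) hx
  have hg' := ((W.bundle.smooth_trans s t).map inclO).mdiff (s.isOpen_dom.inter t.isOpen_dom) hx
  have e : t.coord i = fun y => s.coord i y * inclO.hom (W.bundle.trans s t y) := by
    funext y
    have h := W.bundle.act_trans s t y
    have h2 : R.bundle.act (s.frame y).1.2 (inclO.hom (W.bundle.trans s t y)) =
        (t.frame y).1.2 := congrArg (fun p => p.1.2) h
    rw [coord, ← h2, R.bundle.div_act_right]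
    rfl
  rw [t.form_apply hx.2 hi, e, gaugeAt_mul ((s.smooth_coord i).mdiff (s.isOpen_inter i) ⟨hx.1, hi⟩)
    hg' _ (inclO.diff.comp (s.form x)) v (s.inclO_diff_form hx.1 hi v),
    gaugeAt_map inclO hg _ v (s.form_mem hx.1 v), upperBlock_inclO_diff]

end LocalFrame

variable (W) in
/-- The reduced connection. -/
noncomputable def conn : Connection W.bundle where
  form s := s.form
  form_mem s _ hx v := s.form_mem hx v
  smooth_form (s : W.LocalFrame) := by
    intro w hw
    obtain ⟨i, hi⟩ := R.bundle.cover w.proj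
    have hp : Continuous (fun w : TangentBundle (𝓡 2) Y => w.proj) :=
      FiberBundle.continuous_proj _ _
    have hO : IsOpen {w : TangentBundle (𝓡 2) Y | w.proj ∈ s.dom ∩ R.bundle.dom i} :=
      (s.isOpen_inter i).preimage hp
    have h1 := contMDiffOn_gaugeAt (s.isOpen_inter i) (s.smooth_coord i)
      ((R.conn.smooth_form i).mono fun w hw => hw.2)
    have h2 := (upperBlock.contDiff.contMDiff.comp_contMDiffOn h1).congr
      fun w' hw' => s.form_apply hw'.1 hw'.2 w'.snd
    exact (h2.contMDiffAt (hO.mem_nhds ⟨hw, hi⟩)).contMDiffWithinAt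
  compat s t _ hx v := s.form_compat t hx v

/-- The reduced bundle sits inside the fibre product of `Z` and `R`, and its two projections are
equivariant along `detO` and `inclO`. -/
theorem reducesWithDet (W : ParallelAxis R Z) : ReducesWithDet R Z := by
  let φ : Iso (W.bundle.push inclO) R.bundle :=
    Iso.ofEquivariant inclO W.bundle (R := R.bundle) (fun p => p.1.2) (fun _ _ => rfl)
      fun s i => LocalFrame.smooth_coord s i
  let χ : Iso (W.bundle.push detO) Z :=
    Iso.ofEquivariant detO W.bundle (R := Z) (fun p => p.1.1) (fun _ _ => rfl)
      fun s a => LocalFrame.smooth_fst s a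
  refine ⟨⟨W.bundle, W.conn⟩, ⟨φ, fun (s : W.LocalFrame) i x hx v => ?_⟩, ⟨χ⟩⟩
  have e : φ.rep s i = s.coord i := funext fun y =>
    congrArg (R.bundle.div (R.bundle.sec i y)) (R.bundle.act_one _)
  exact (s.inclO_diff_form hx.1 hx.2 v).trans
    (congrArg (fun h => gaugeAt h (R.conn.form i x) v) e.symm)

end ParallelAxis

end Reduction

/-! ### The Lie algebra of `SU₂` as `ℝ³`, and the adjoint representation -/

section Spin

open Matrix

/-- The isomorphism of `ℝ³` with the trace-free skew-Hermitian matrices. -/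
noncomputable def spin : (Fin 3 → ℝ) →ₗ[ℝ] Matrix (Fin 2) (Fin 2) ℂ where
  toFun v := Complex.I • ∑ j, ((v j : ℝ) : ℂ) • pauli j
  map_add' v w := by
    simp only [Pi.add_apply, Complex.ofReal_add, add_smul, Finset.sum_add_distrib, smul_add]
  map_smul' c v := by
    simp only [Pi.smul_apply, smul_eq_mul, Complex.ofReal_mul, mul_smul, RingHom.id_apply,
      ← Finset.smul_sum]
    rw [smul_comm]
    rfl

/-- The coordinates of a trace-free skew-Hermitian matrix. -/
noncomputable def unspin : Matrix (Fin 2) (Fin 2) ℂ →ₗ[ℝ] (Fin 3 → ℝ) where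
  toFun M j := 1 / 2 * (pauli j * (-Complex.I • M)).trace.re
  map_add' M N := by
    ext j
    simp [smul_add, mul_add]
  map_smul' c M := by
    ext j
    rw [smul_comm, Matrix.mul_smul, Matrix.trace_smul]
    simp
    ring

theorem spin_apply (v : Fin 3 → ℝ) : spin v =
    !![Complex.I * v 2, Complex.I * v 0 + v 1; Complex.I * v 0 - v 1, -(Complex.I * v 2)] := by
  ext i j
  fin_cases i <;> fin_cases j <;>
    simp [spin, pauli, Fin.sum_univ_succ, Complex.ext_iff]

theorem unspin_spin (v : Fin 3 → ℝ) : unspin (spin v) = v := by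
  ext j
  change 1 / 2 * (pauli j * (-Complex.I • spin v)).trace.re = v j
  rw [spin_apply]
  fin_cases j <;>
    simp [pauli, Matrix.trace_fin_two] <;> ring

/-- The matrix `-i M` is Hermitian and trace-free, so `pauli_expand` applies to it. -/
theorem spin_unspin {M : Matrix (Fin 2) (Fin 2) ℂ} (hM : star M = -M) (ht : M.trace = 0) :
    spin (unspin M) = M := by
  have h := pauli_expand (-Complex.I • M) (by
    rw [star_smul, hM]
    simp) (by rw [Matrix.trace_smul, ht, smul_zero])
  change Complex.I • ∑ j, ((1 / 2 * (pauli j * (-Complex.I • M)).trace.re : ℝ) : ℂ) • pauli j = M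
  rw [← h, smul_smul]
  simp

/-- This turns the determinant condition on the gauge transformation into unit length of the axis.
-/
theorem det_spin (v : Fin 3 → ℝ) : (spin v).det = ((v ⬝ᵥ v : ℝ) : ℂ) := by
  rw [spin_apply, Matrix.det_fin_two]
  simp [dotProduct, Fin.sum_univ_succ, Complex.ext_iff]
  constructor <;> ring

theorem spin_mem {v : Fin 3 → ℝ} (h : v ⬝ᵥ v = 1) :
    spin v ∈ Matrix.specialUnitaryGroup (Fin 2) ℂ := by
  rw [Matrix.mem_specialUnitaryGroup_iff, Matrix.mem_unitaryGroup_iff, det_spin, h]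
  refine ⟨?_, by simp⟩
  have h' : v 0 * v 0 + v 1 * v 1 + v 2 * v 2 = 1 := by
    simpa [dotProduct, Fin.sum_univ_succ, add_assoc] using h
  rw [spin_apply]
  ext i j
  fin_cases i <;> fin_cases j <;>
    simp [Matrix.mul_apply, Fin.sum_univ_succ, Complex.ext_iff] <;>
    constructor <;> linarith

theorem conj_spin {M : Matrix (Fin 2) (Fin 2) ℂ} (hM : M ∈ Matrix.unitaryGroup (Fin 2) ℂ)
    (v : Fin 3 → ℝ) : M * spin v * star M = spin (adMatrix M *ᵥ v) := by
  change M * (Complex.I • ∑ j, ((v j : ℝ) : ℂ) • pauli j) * star M =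
    Complex.I • ∑ j, (((adMatrix M *ᵥ v) j : ℝ) : ℂ) • pauli j
  rw [Matrix.mul_smul, Matrix.smul_mul, Finset.mul_sum, Finset.sum_mul]
  congr 1
  have h : ∀ j, M * ((v j : ℂ) • pauli j) * star M =
      ∑ l, ((adMatrix M l j * v j : ℝ) : ℂ) • pauli l := by
    intro j
    rw [Matrix.mul_smul, Matrix.smul_mul, adMatrix_expand hM, Finset.smul_sum]
    refine Finset.sum_congr rfl fun l _ => ?_
    rw [smul_smul, Complex.ofReal_mul, mul_comm]
  simp only [h]
  rw [Finset.sum_comm]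
  refine Finset.sum_congr rfl fun l _ => ?_
  rw [← Finset.sum_smul, Matrix.mulVec, dotProduct, Complex.ofReal_sum]

/-- In `SU₂` the inverse is both the adjoint and the adjugate, and the adjugate of a two by two
matrix is `tr M - M`. In particular a vanishing trace means that `M` is skew-Hermitian. -/
theorem star_add_self {M : Matrix (Fin 2) (Fin 2) ℂ}
    (hM : M ∈ Matrix.unitaryGroup (Fin 2) ℂ) (hd : M.det = 1) : star M + M = M.trace • 1 := by
  have h1 : M.adjugate * M = 1 := by rw [Matrix.adjugate_mul, hd, one_smul]
  have h2 : M.adjugate = star M := by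
    calc M.adjugate = M.adjugate * (M * star M) := by
          rw [Matrix.mem_unitaryGroup_iff.1 hM, mul_one]
      _ = star M := by rw [← mul_assoc, h1, one_mul]
  rw [← h2, Matrix.adjugate_fin_two]
  ext i j
  fin_cases i <;> fin_cases j <;> simp [Matrix.trace_fin_two, add_comm]

theorem trace_im_eq_zero {M : Matrix (Fin 2) (Fin 2) ℂ}
    (hM : M ∈ Matrix.unitaryGroup (Fin 2) ℂ) (hd : M.det = 1) : M.trace.im = 0 := by
  have h := congrFun (congrFun (star_add_self hM hd) 0) 0
  have h1 := congrArg Complex.im h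
  simpa [Matrix.star_apply] using h1.symm

/-- The homomorphism `F : G → SO₃` is the adjoint representation of a group between `SU₂` and
`U₂`, up to conjugation by `k`. -/
structure IsAdjoint {G : Subgroup (Matrix (Fin 2) (Fin 2) ℂ)ˣ} (F : LinHom G SO3) (k : SO3) :
    Prop where
  le_U2 : G ≤ U2
  SU2_le : SU2 ≤ G
  vec_hom : ∀ (g : G) (v : Fin 3 → ℝ), SO3.vec (F.hom g) v = SO3.vec k
    (adMatrix ((g : (Matrix (Fin 2) (Fin 2) ℂ)ˣ) : Matrix (Fin 2) (Fin 2) ℂ) *ᵥ SO3.vec k⁻¹ v)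

theorem isAdjoint_beta (k : SO3) : IsAdjoint (beta k) k where
  le_U2 := le_rfl
  SU2_le g hg := (inclSU.hom ⟨g, hg⟩).2
  vec_hom g v := by
    have h : (beta k).hom g = k * adHom.hom g * k⁻¹ := rfl
    rw [h, SO3.vec_mul, SO3.vec_mul]
    rfl

theorem isAdjoint_beta_comp_inclSU (k : SO3) : IsAdjoint ((beta k).comp inclSU) k where
  le_U2 g hg := (inclSU.hom ⟨g, hg⟩).2
  SU2_le := le_rfl
  vec_hom g v := (isAdjoint_beta k).vec_hom (inclSU.hom g) v

/-- `spin` in the frame `k`. -/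
noncomputable def spinAt (k : SO3) : (Fin 3 → ℝ) →L[ℝ] Matrix (Fin 2) (Fin 2) ℂ :=
  LinearMap.toContinuousLinearMap (spin.comp (Matrix.mulVecLin
    (((k⁻¹ : SO3) : (Matrix (Fin 3) (Fin 3) ℝ)ˣ) : Matrix (Fin 3) (Fin 3) ℝ)))

/-- `unspin` in the frame `k`. -/
noncomputable def unspinAt (k : SO3) : Matrix (Fin 2) (Fin 2) ℂ →L[ℝ] (Fin 3 → ℝ) :=
  LinearMap.toContinuousLinearMap ((Matrix.mulVecLin
    ((k : (Matrix (Fin 3) (Fin 3) ℝ)ˣ) : Matrix (Fin 3) (Fin 3) ℝ)).comp unspin)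

theorem spinAt_apply (k : SO3) (v : Fin 3 → ℝ) : spinAt k v = spin (SO3.vec k⁻¹ v) := rfl

theorem unspinAt_apply (k : SO3) (M : Matrix (Fin 2) (Fin 2) ℂ) :
    unspinAt k M = SO3.vec k (unspin M) := rfl

theorem unspinAt_spinAt (k : SO3) (v : Fin 3 → ℝ) : unspinAt k (spinAt k v) = v := by
  rw [spinAt_apply, unspinAt_apply, unspin_spin, SO3.vec_vec_inv]

theorem spinAt_unspinAt (k : SO3) {M : Matrix (Fin 2) (Fin 2) ℂ}
    (hM : M ∈ Matrix.unitaryGroup (Fin 2) ℂ) (hd : M.det = 1) (ht : M.trace = 0) :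
    spinAt k (unspinAt k M) = M := by
  have h := star_add_self hM hd
  rw [ht, zero_smul] at h
  rw [unspinAt_apply, spinAt_apply, SO3.vec_inv_vec, spin_unspin (eq_neg_of_add_eq_zero_left h) ht]

theorem det_spinAt (k : SO3) (v : Fin 3 → ℝ) : (spinAt k v).det = ((v ⬝ᵥ v : ℝ) : ℂ) := by
  rw [spinAt_apply, det_spin, SO3.dotProduct_vec]

namespace IsAdjoint

variable {G : Subgroup (Matrix (Fin 2) (Fin 2) ℂ)ˣ} {F : LinHom G SO3} {k : SO3}
  (hF : IsAdjoint F k)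
include hF

theorem mem_unitaryGroup (g : G) : ((g : (Matrix (Fin 2) (Fin 2) ℂ)ˣ) :
    Matrix (Fin 2) (Fin 2) ℂ) ∈ Matrix.unitaryGroup (Fin 2) ℂ :=
  ((Submonoid.mem_units_iff _ _).1 (hF.le_U2 g.2)).1

/-- The equivariance of `spinAt`, written without inverses so that it can be differentiated in
`spinAt_diff`. -/
theorem mul_spinAt (g : G) (v : Fin 3 → ℝ) :
    ((g : (Matrix (Fin 2) (Fin 2) ℂ)ˣ) : Matrix (Fin 2) (Fin 2) ℂ) * spinAt k v =
      spinAt k (SO3.vec (F.hom g) v) *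
        ((g : (Matrix (Fin 2) (Fin 2) ℂ)ˣ) : Matrix (Fin 2) (Fin 2) ℂ) := by
  have hg := hF.mem_unitaryGroup g
  rw [spinAt_apply, spinAt_apply, hF.vec_hom, SO3.vec_inv_vec, ← conj_spin hg, mul_assoc,
    Matrix.mem_unitaryGroup_iff'.1 hg, mul_one]

theorem spinAt_vec_inv (g : G) (v : Fin 3 → ℝ) : spinAt k (SO3.vec (F.hom g)⁻¹ v) =
    (((g⁻¹ : G) : (Matrix (Fin 2) (Fin 2) ℂ)ˣ) : Matrix (Fin 2) (Fin 2) ℂ) * spinAt k v *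
      ((g : (Matrix (Fin 2) (Fin 2) ℂ)ˣ) : Matrix (Fin 2) (Fin 2) ℂ) := by
  rw [hF.mul_spinAt, map_inv, mul_assoc, ← Units.val_mul, ← Subgroup.coe_mul, inv_mul_cancel]
  simp

/-- Differentiating `mul_spinAt` along a curve with velocity `X` turns the differential of `F` into
the commutator with `X`. -/
theorem spinAt_diff {X : Matrix (Fin 2) (Fin 2) ℂ} (hX : X ∈ lieSet G) (v : Fin 3 → ℝ) :
    spinAt k (F.diff X *ᵥ v) = X * spinAt k v - spinAt k v * X := by
  obtain ⟨γ, -, h0, h1⟩ := hX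
  have hE : HasFDerivAt F.ext F.diff
      ((γ 0 : (Matrix (Fin 2) (Fin 2) ℂ)ˣ) : Matrix (Fin 2) (Fin 2) ℂ) := by
    rw [h0]
    exact F.hasFDerivAt_one
  have h2 := hE.comp_hasDerivAt (x := (0 : ℝ)) h1
  have h3 := ((spinAt k).comp (mulVecCLM v)).hasFDerivAt.comp_hasDerivAt (x := (0 : ℝ)) h2
  have h4 := (h3.mul h1).unique ((h1.mul_const (spinAt k v)).congr_of_eventuallyEq
    (Filter.Eventually.of_forall fun t => ?_))
  · simp only [Function.comp_apply, h0, Subgroup.coe_one, Units.val_one, mul_one] at h4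
    have h5 : spinAt k (F.ext 1 *ᵥ v) = spinAt k v := by
      have h6 : F.ext 1 = 1 := by simpa using F.ext_eq 1
      rw [h6, Matrix.one_mulVec]
    exact eq_sub_of_add_eq
      ((congrArg (fun S => spinAt k (F.diff X *ᵥ v) + S * X) h5.symm).trans h4)
  · change spinAt k (F.ext _ *ᵥ v) * _ = _
    rw [F.ext_eq]
    exact (hF.mul_spinAt (γ t) v).symm

/-- Unit vectors give elements of `SU₂`, which `G` contains. -/
theorem exists_eq_spinAt {v : Fin 3 → ℝ} (h : v ⬝ᵥ v = 1) :
    ∃ g : G, ((g : (Matrix (Fin 2) (Fin 2) ℂ)ˣ) : Matrix (Fin 2) (Fin 2) ℂ) = spinAt k v := by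
  have hm : spinAt k v ∈ Matrix.specialUnitaryGroup (Fin 2) ℂ := by
    rw [spinAt_apply]
    exact spin_mem (by rw [SO3.dotProduct_vec, h])
  have h1 := Matrix.mem_unitaryGroup_iff.1 (Matrix.mem_specialUnitaryGroup_iff.1 hm).1
  refine ⟨⟨⟨spinAt k v, star (spinAt k v), h1, mul_eq_one_comm.1 h1⟩, hF.SU2_le ?_⟩, rfl⟩
  exact (Submonoid.mem_units_iff _ _).2 ⟨hm, Matrix.mem_specialUnitaryGroup_iff.2
    ⟨Unitary.star_mem (Matrix.mem_specialUnitaryGroup_iff.1 hm).1, by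
      change (star (spinAt k v)).det = 1
      rw [Matrix.star_eq_conjTranspose, Matrix.det_conjTranspose,
        (Matrix.mem_specialUnitaryGroup_iff.1 hm).2, star_one]⟩⟩

end IsAdjoint

end Spin

/-! ### Fixed points and parallel axes -/

section FixedPoints

open PrincipalBundle Matrix

theorem coe_sgn_mul {G : Subgroup (Matrix (Fin 2) (Fin 2) ℂ)ˣ} [HasNegOne G] (e : Z2) (g : G) :
    ((((sgn G).hom e * g : G) : (Matrix (Fin 2) (Fin 2) ℂ)ˣ) : Matrix (Fin 2) (Fin 2) ℂ) =
      ((e : ℝˣ) : ℝ) • ((g : (Matrix (Fin 2) (Fin 2) ℂ)ˣ) : Matrix (Fin 2) (Fin 2) ℂ) := by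
  rw [Subgroup.coe_mul, Units.val_mul, sgn_val, Algebra.smul_def]

variable {Y : Type u} [TopologicalSpace Y] [ChartedSpace (EuclideanSpace ℝ (Fin 2)) Y]
  [IsManifold (𝓡 2) ∞ Y] {G : Subgroup (Matrix (Fin 2) (Fin 2) ℂ)ˣ}

/-- A connection preserving isomorphism `Z ⊗ P ≅ P` of determinant one. -/
def TensorFixed [HasNegOne G] (Z : PrincipalBundle Y Z2) (P : GConn Y G) : Prop :=
  ∃ φ : Iso (Z.tensor P.bundle) P.bundle, φ.Preserves (P.conn.tensor Z) P.conn ∧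
    ∀ (x : Y) (z : Z.Fib x) (p : P.bundle.Fib x),
      ((P.bundle.div p (φ.toFun (tensorMk Z P.bundle z p)) : (Matrix (Fin 2) (Fin 2) ℂ)ˣ) :
        Matrix (Fin 2) (Fin 2) ℂ).det = 1

variable {F : LinHom G SO3} {k : SO3} {Z : PrincipalBundle Y Z2} {P : GConn Y G}

/-! ### From a parallel axis to an isomorphism `Z ⊗ P ≅ P` -/

section OfAxis

variable (hF : IsAdjoint F k) (W : ParallelAxis (P.push F) Z)

/-- The axis, as a function on `P`. -/
noncomputable def ParallelAxis.onFrame (W : ParallelAxis (P.push F) Z) {x : Y} (z : Z.Fib x)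
    (p : P.bundle.Fib x) : Fin 3 → ℝ :=
  W.toFun z (P.bundle.pushMk F p 1)

theorem ParallelAxis.onFrame_act (W : ParallelAxis (P.push F) Z) {x : Y} (z : Z.Fib x)
    (p : P.bundle.Fib x) (e : Z2) (g : G) : W.onFrame (Z.act z e) (P.bundle.act p g) =
      ((e : ℝˣ) : ℝ) • SO3.vec (F.hom g)⁻¹ (W.onFrame z p) := by
  have h := W.equivariant z (P.bundle.pushMk F p 1) e (F.hom g)
  rw [onFrame, onFrame, ← h, pushMk_act, mul_one]
  congr 1
  change P.bundle.pushMk F p (F.hom g) = P.bundle.pushMk F p (1 * F.hom g)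
  rw [one_mul]

/-- The automorphism of the fibre given by the rotation by `π` about the axis. -/
noncomputable def axisGauge {x : Y} (z : Z.Fib x) (p : P.bundle.Fib x) : G :=
  (hF.exists_eq_spinAt (W.unit z (P.bundle.pushMk F p 1))).choose

theorem axisGauge_val {x : Y} (z : Z.Fib x) (p : P.bundle.Fib x) :
    ((axisGauge hF W z p : (Matrix (Fin 2) (Fin 2) ℂ)ˣ) : Matrix (Fin 2) (Fin 2) ℂ) =
      spinAt k (W.onFrame z p) :=
  (hF.exists_eq_spinAt (W.unit z (P.bundle.pushMk F p 1))).choose_spec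

variable [HasNegOne G]

theorem axisGauge_act {x : Y} (z : Z.Fib x) (p : P.bundle.Fib x) (e : Z2) (g : G) :
    axisGauge hF W (Z.act z e) (P.bundle.act p g) =
      (sgn G).hom e * (g⁻¹ * axisGauge hF W z p * g) := by
  refine Subtype.ext (Units.ext ?_)
  rw [coe_sgn_mul, axisGauge_val, W.onFrame_act, map_smul, hF.spinAt_vec_inv]
  simp only [Subgroup.coe_mul, Units.val_mul, axisGauge_val]

theorem axisGauge_act_right {x : Y} (z : Z.Fib x) (p : P.bundle.Fib x) (g : G) :
    axisGauge hF W z (P.bundle.act p g) = g⁻¹ * axisGauge hF W z p * g := by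
  have h := axisGauge_act hF W z p 1 g
  rwa [Z.act_one, map_one, one_mul] at h

/-- The isomorphism `z ⊗ p ↦ p · axisGauge z p`. -/
noncomputable def axisIso : Iso (Z.tensor P.bundle) P.bundle where
  toFun {x} c := Quotient.lift
    (fun a : Z.Fib x × P.bundle.Fib x => P.bundle.act a.2 (axisGauge hF W a.1 a.2)) (by
      rintro ⟨z, p⟩ ⟨w, q⟩ ⟨e, h1, h2⟩
      simp only at h1 h2 ⊢
      -- The sign by which the point moves cancels the sign from `axisGauge_act`, and conjugation by
      -- a central sign is trivial.
      have he : (sgn G).hom e * (sgn G).hom e = 1 := by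
        rw [← map_mul, Z2.mul_self, map_one]
      rw [← h1, ← h2, axisGauge_act, ← P.bundle.act_mul]
      congr 1
      rw [← mul_assoc, he, one_mul, mul_assoc, ← sgn_comm, inv_mul_cancel_left]) c
  equivariant {x} c g := by
    induction c using Quotient.inductionOn with
    | h a =>
      change P.bundle.act (P.bundle.act a.2 g) (axisGauge hF W a.1 (P.bundle.act a.2 g)) =
        P.bundle.act (P.bundle.act a.2 (axisGauge hF W a.1 a.2)) g
      rw [axisGauge_act_right, ← P.bundle.act_mul, ← P.bundle.act_mul, mul_assoc,
        mul_inv_cancel_left]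
  smooth i j := by
    have h1 : SmoothOn (fun x => axisGauge hF W (Z.sec i.1 x) (P.bundle.sec i.2 x))
        (Z.dom i.1 ∩ P.bundle.dom i.2) :=
      ((spinAt k).contDiff.contMDiff.comp_contMDiffOn (W.smooth i.1 i.2)).congr fun x _ =>
        axisGauge_val hF W _ _
    exact SmoothOn.congr (SmoothOn.mul
      ((P.bundle.smooth_trans j i.2).mono fun x hx => ⟨hx.2, hx.1.2⟩)
      (h1.mono fun x hx => hx.1)) fun x _ => P.bundle.div_act_right _ _ _

/-- Once the transition function is removed, the claim for `u = axisGauge` is `du = u A - A u`. By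
`spinAt_diff` this is the image under `spinAt` of the equation of parallelism of the axis. -/
theorem axisIso_preserves : (axisIso hF W).Preserves (P.conn.tensor Z) P.conn := by
  rintro ⟨a, i⟩ j x ⟨⟨hxa, hxi⟩, hxj⟩ v
  have hO : IsOpen (Z.dom a ∩ P.bundle.dom i) := (Z.isOpen_dom a).inter (P.bundle.isOpen_dom i)
  have h1 : SmoothOn (fun x => axisGauge hF W (Z.sec a x) (P.bundle.sec i x))
      (Z.dom a ∩ P.bundle.dom i) :=
    ((spinAt k).contDiff.contMDiff.comp_contMDiffOn (W.smooth a i)).congr fun x _ =>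
      axisGauge_val hF W _ _
  have e : (axisIso hF W).rep (a, i) j = fun y => P.bundle.trans j i y *
      axisGauge hF W (Z.sec a y) (P.bundle.sec i y) :=
    funext fun y => P.bundle.div_act_right _ _ _
  rw [e, gaugeAt_mul ((P.bundle.smooth_trans j i).mdiff
    ((P.bundle.isOpen_dom j).inter (P.bundle.isOpen_dom i)) ⟨hxj, hxi⟩)
    (h1.mdiff hO ⟨hxa, hxi⟩) _ _ v (P.conn.compat j i x ⟨hxj, hxi⟩ v)]
  symm
  rw [gaugeAt_eq_iff]
  simp only [axisGauge_val]
  have hd := ((W.smooth a i).contMDiffAt (hO.mem_nhds ⟨hxa, hxi⟩)).mdifferentiableAt (by simp)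
  have h2 := mvfderiv_clm_comp (spinAt k) hd v
  have h3 : spinAt k (F.diff (P.conn.form i x v) *ᵥ W.onFrame (Z.sec a x) (P.bundle.sec i x)) =
    _ := hF.spinAt_diff (P.conn.form_mem i x hxi v) _
  refine (h2.trans (congrArg (spinAt k) (W.parallel a i x ⟨hxa, hxi⟩ v))).trans ?_
  rw [map_neg]
  exact (congrArg Neg.neg h3).trans (neg_sub _ _)

include hF in
theorem tensorFixed_of_parallelAxis (W : ParallelAxis (P.push F) Z) : TensorFixed Z P := by
  refine ⟨axisIso hF W, axisIso_preserves hF W, fun x z p => ?_⟩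
  have h : P.bundle.div p ((axisIso hF W).toFun (tensorMk Z P.bundle z p)) =
      axisGauge hF W z p := P.bundle.div_eq rfl
  have h1 : W.onFrame z p ⬝ᵥ W.onFrame z p = 1 := W.unit z (P.bundle.pushMk F p 1)
  rw [h, axisGauge_val, det_spinAt, h1, Complex.ofReal_one]

end OfAxis

/-! ### From an isomorphism `Z ⊗ P ≅ P` to a parallel axis -/

section ToAxis

variable [HasNegOne G]

variable (φ : Iso (Z.tensor P.bundle) P.bundle)

/-- The automorphism `p ↦ φ (z ⊗ p)`, relative to `p`. -/
noncomputable def isoGauge {x : Y} (z : Z.Fib x) (p : P.bundle.Fib x) : G :=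
  P.bundle.div p (φ.toFun (tensorMk Z P.bundle z p))

theorem isoGauge_act_right {x : Y} (z : Z.Fib x) (p : P.bundle.Fib x) (g : G) :
    isoGauge φ z (P.bundle.act p g) = g⁻¹ * isoGauge φ z p * g := by
  have h := φ.equivariant (tensorMk Z P.bundle z p) g
  rw [tensor_act] at h
  rw [isoGauge, h, P.bundle.div_act_act]
  rfl

theorem isoGauge_act_left {x : Y} (z : Z.Fib x) (p : P.bundle.Fib x) (e : Z2) :
    isoGauge φ (Z.act z e) p = (sgn G).hom e * isoGauge φ z p := by
  have h := φ.equivariant (tensorMk Z P.bundle z p) ((sgn G).hom e)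
  rw [tensor_act] at h
  rw [isoGauge, tensorMk_act, h, P.bundle.div_act_right, ← sgn_comm]
  rfl

/-- The real part of the trace of `isoGauge`. -/
noncomputable def isoTrace {x : Y} (z : Z.Fib x) (p : P.bundle.Fib x) : ℝ :=
  ((isoGauge φ z p : (Matrix (Fin 2) (Fin 2) ℂ)ˣ) : Matrix (Fin 2) (Fin 2) ℂ).trace.re

theorem isoTrace_act_right {x : Y} (z : Z.Fib x) (p : P.bundle.Fib x) (g : G) :
    isoTrace φ z (P.bundle.act p g) = isoTrace φ z p := by
  rw [isoTrace, isoGauge_act_right, Subgroup.coe_mul, Units.val_mul, Matrix.trace_mul_comm,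
    ← Units.val_mul, ← Subgroup.coe_mul, mul_inv_cancel_left]
  rfl

theorem isoTrace_congr {x : Y} (z : Z.Fib x) (p q : P.bundle.Fib x) :
    isoTrace φ z p = isoTrace φ z q := by
  rw [← P.bundle.act_div p q, isoTrace_act_right]

theorem isoTrace_act_left {x : Y} (z : Z.Fib x) (p : P.bundle.Fib x) (e : Z2) :
    isoTrace φ (Z.act z e) p = ((e : ℝˣ) : ℝ) * isoTrace φ z p := by
  rw [isoTrace, isoGauge_act_left, coe_sgn_mul, Matrix.trace_smul, Complex.smul_re]
  rfl

theorem smooth_isoGauge (a : Z.ι) (i : P.bundle.ι) :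
    SmoothOn (fun x => isoGauge φ (Z.sec a x) (P.bundle.sec i x)) (Z.dom a ∩ P.bundle.dom i) :=
  SmoothOn.mono (φ.smooth (a, i) i) fun _ hx => ⟨hx, hx.2⟩

variable {φ} (hφ : φ.Preserves (P.conn.tensor Z) P.conn)
include hφ

theorem mvfderiv_isoGauge {a : Z.ι} {i : P.bundle.ι} {x : Y}
    (hx : x ∈ Z.dom a ∩ P.bundle.dom i) (v : TangentSpace (𝓡 2) x) :
    mvfderiv (𝓡 2) (fun y => ((isoGauge φ (Z.sec a y) (P.bundle.sec i y) :
      (Matrix (Fin 2) (Fin 2) ℂ)ˣ) : Matrix (Fin 2) (Fin 2) ℂ)) x v =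
    ((isoGauge φ (Z.sec a x) (P.bundle.sec i x) :
      (Matrix (Fin 2) (Fin 2) ℂ)ˣ) : Matrix (Fin 2) (Fin 2) ℂ) * P.conn.form i x v -
    P.conn.form i x v * ((isoGauge φ (Z.sec a x) (P.bundle.sec i x) :
      (Matrix (Fin 2) (Fin 2) ℂ)ˣ) : Matrix (Fin 2) (Fin 2) ℂ) :=
  (gaugeAt_eq_iff (φ.rep (a, i) i) _ v _).1 (hφ (a, i) i x ⟨hx, hx.2⟩ v).symm

/-- The derivative of `isoGauge` is a commutator with the connection form, and commutators have
trace zero. -/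
theorem eventually_isoTrace_eq {a : Z.ι} {i : P.bundle.ι} {x : Y}
    (hx : x ∈ Z.dom a ∩ P.bundle.dom i) : ∀ᶠ y in nhds x,
      isoTrace φ (Z.sec a y) (P.bundle.sec i y) = isoTrace φ (Z.sec a x) (P.bundle.sec i x) := by
  let T : Matrix (Fin 2) (Fin 2) ℂ →L[ℝ] ℝ :=
    (Complex.reLm ∘ₗ Matrix.traceLinearMap (Fin 2) ℝ ℂ).toContinuousLinearMap
  have hO : IsOpen (Z.dom a ∩ P.bundle.dom i) := (Z.isOpen_dom a).inter (P.bundle.isOpen_dom i)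
  refine eventually_eq_of_mvfderiv_eq_zero hO
    (f := fun y => isoTrace φ (Z.sec a y) (P.bundle.sec i y)) (fun y hy => ?_) (fun y hy v => ?_) hx
  · exact (T.differentiable.mdifferentiable.mdifferentiableAt).comp y
      ((smooth_isoGauge φ a i).mdiff hO hy)
  · have h1 := mvfderiv_clm_comp T ((smooth_isoGauge φ a i).mdiff hO hy) v
    refine h1.trans ((congrArg T (mvfderiv_isoGauge hφ hy v)).trans ?_)
    rw [map_sub, sub_eq_zero]
    exact congrArg Complex.re (Matrix.trace_mul_comm
      ((isoGauge φ (Z.sec a y) (P.bundle.sec i y) : (Matrix (Fin 2) (Fin 2) ℂ)ˣ) :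
        Matrix (Fin 2) (Fin 2) ℂ) (P.conn.form i y v))

-- The trace is odd in `z` and its square is constant on the connected surface. If it were not zero,
-- the points of `Z` with positive trace would form a smooth global section.
omit hφ in
theorem isoTrace_eq_zero_of_not_isTrivial [PreconnectedSpace Y]
    (hφ : φ.Preserves (P.conn.tensor Z) P.conn) (hZ : ¬ Z.IsTrivial) {x : Y} (z : Z.Fib x)
    (p : P.bundle.Fib x) : isoTrace φ z p = 0 := by
  by_contra h0
  choose a ha using Z.cover
  choose i hi using P.bundle.cover
  -- Squaring removes the dependence on `z`, so this is a function on `Y` whatever sections are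
  -- chosen at each point.
  set t : Y → ℝ := fun y => isoTrace φ (Z.sec (a y) y) (P.bundle.sec (i y) y) ^ 2 with ht
  have hsq : ∀ {y : Y} (z : Z.Fib y) (p : P.bundle.Fib y), isoTrace φ z p ^ 2 = t y := by
    intro y z p
    rw [ht, isoTrace_congr φ z p (P.bundle.sec (i y) y), ← Z.act_div (Z.sec (a y) y) z,
      isoTrace_act_left, mul_pow, sq ((_ : ℝˣ) : ℝ), Z2.coe_mul_self, one_mul]
  have hloc : IsLocallyConstant t := by
    refine (IsLocallyConstant.iff_eventually_eq t).2 fun y => ?_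
    filter_upwards [eventually_isoTrace_eq hφ (a := a y) (i := i y) ⟨ha y, hi y⟩] with y' hy'
    rw [← hsq (Z.sec (a y) y') (P.bundle.sec (i y) y'), hy']
  have hne : ∀ {y : Y} (z : Z.Fib y) (p : P.bundle.Fib y), isoTrace φ z p ≠ 0 := by
    intro y z' p' h
    have h1 := hsq z' p'
    rw [hloc.apply_eq_of_isPreconnected isPreconnected_univ (mem_univ y) (mem_univ x),
      ← hsq z p, h] at h1
    exact h0 (by simpa using h1.symm)
  have hex : ∀ y, ∃ z : Z.Fib y, 0 < isoTrace φ z (P.bundle.sec (i y) y) := by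
    intro y
    rcases lt_or_gt_of_ne (hne (Z.sec (a y) y) (P.bundle.sec (i y) y)) with h | h
    · refine ⟨Z.act (Z.sec (a y) y) Z2.neg, ?_⟩
      rw [isoTrace_act_left]
      change 0 < ((-1 : ℝˣ) : ℝ) * _
      rw [Units.val_neg, Units.val_one]
      linarith
    · exact ⟨_, h⟩
  choose s hs using hex
  have hs' : ∀ (y : Y) (p : P.bundle.Fib y), 0 < isoTrace φ (s y) p := fun y p => by
    rw [isoTrace_congr φ _ p (P.bundle.sec (i y) y)]
    exact hs y
  refine hZ ⟨s, fun b y hy => ?_⟩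
  -- Relative to the section `b`, the sign of `s` must be that of the trace along `b`, which is
  -- locally constant.
  have hev : ∀ᶠ y' in nhds y, Z.div (Z.sec b y') (s y') = Z.div (Z.sec b y) (s y) := by
    filter_upwards [eventually_isoTrace_eq hφ (a := b) (i := i y) ⟨hy, hi y⟩] with y' hy'
    have h1 := hs' y' (P.bundle.sec (i y) y')
    have h2 := hs' y (P.bundle.sec (i y) y)
    rw [← Z.act_div (Z.sec b y') (s y'), isoTrace_act_left, hy'] at h1
    rw [← Z.act_div (Z.sec b y) (s y), isoTrace_act_left] at h2
    refine Z2.ext_real ?_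
    generalize isoTrace φ (Z.sec b y) (P.bundle.sec (i y) y) = c at h1 h2
    rcases Z2.eq_or (Z.div (Z.sec b y') (s y')) with h | h <;>
      rcases Z2.eq_or (Z.div (Z.sec b y) (s y)) with h' | h' <;>
      rw [h] at h1 ⊢ <;> rw [h'] at h2 ⊢ <;>
      simp only [Units.val_one, Units.val_neg] at h1 h2 <;> exfalso <;> linarith
  have hc : ContMDiffAt (𝓡 2) 𝓘(ℝ, ℝ) ∞
      (fun y' => ((Z.div (Z.sec b y') (s y') : ℝˣ) : ℝ)) y :=
    (contMDiffAt_const (c := ((Z.div (Z.sec b y) (s y) : ℝˣ) : ℝ))).congr_of_eventuallyEq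
      (hev.mono fun y' hy' => by simp only [hy'])
  exact hc.contMDiffWithinAt

-- At each point the gauge transformation is unitary of determinant one and of trace zero, hence
-- `spinAt` of a unit vector `n`. The equation `du = u A - A u` then becomes the parallelism of `n`
-- through `spinAt_diff`.
omit hφ in
theorem nonempty_parallelAxis_of_tensorFixed [PreconnectedSpace Y] (hF : IsAdjoint F k)
    (hZ : ¬ Z.IsTrivial) (h : TensorFixed Z P) : Nonempty (ParallelAxis (P.push F) Z) := by
  obtain ⟨φ, hφ, hdet⟩ := h
  have hψ : ∀ {x : Y} (z : Z.Fib x) (p : P.bundle.Fib x), spinAt k (unspinAt k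
      ((isoGauge φ z p : (Matrix (Fin 2) (Fin 2) ℂ)ˣ) : Matrix (Fin 2) (Fin 2) ℂ)) =
      ((isoGauge φ z p : (Matrix (Fin 2) (Fin 2) ℂ)ˣ) : Matrix (Fin 2) (Fin 2) ℂ) := by
    intro x z p
    have hu := hF.mem_unitaryGroup (isoGauge φ z p)
    exact spinAt_unspinAt k hu (hdet x z p) (Complex.ext
      (isoTrace_eq_zero_of_not_isTrivial hφ hZ z p) (trace_im_eq_zero hu (hdet x z p)))
  obtain ⟨n, hn⟩ : ∃ n : ∀ ⦃x : Y⦄, Z.Fib x → P.bundle.Fib x → Fin 3 → ℝ,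
      ∀ ⦃x : Y⦄ (z : Z.Fib x) (p : P.bundle.Fib x), n z p = unspinAt k
        ((isoGauge φ z p : (Matrix (Fin 2) (Fin 2) ℂ)ˣ) : Matrix (Fin 2) (Fin 2) ℂ) :=
    ⟨fun _ _ _ => _, fun _ _ _ => rfl⟩
  simp only [← hn] at hψ
  have hunit : ∀ {x : Y} (z : Z.Fib x) (p : P.bundle.Fib x), n z p ⬝ᵥ n z p = 1 := by
    intro x z p
    have h1 := det_spinAt k (n z p)
    rw [hψ] at h1
    have h2 := h1.symm.trans (hdet x z p)
    exact_mod_cast h2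
  have hact : ∀ {x : Y} (z : Z.Fib x) (p : P.bundle.Fib x) (e : Z2), n (Z.act z e) p =
      ((e : ℝˣ) : ℝ) • n z p := by
    intro x z p e
    simp only [hn]
    rw [isoGauge_act_left, coe_sgn_mul, map_smul]
  have hact' : ∀ {x : Y} (z : Z.Fib x) (p : P.bundle.Fib x) (g : G),
      n z (P.bundle.act p g) = SO3.vec (F.hom g)⁻¹ (n z p) := by
    intro x z p g
    rw [← unspinAt_spinAt k (SO3.vec (F.hom g)⁻¹ (n z p)), hF.spinAt_vec_inv, hψ]
    simp only [hn, isoGauge_act_right, Subgroup.coe_mul, Units.val_mul]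
  choose i hi using P.bundle.cover
  -- The function `n` on `P` is extended to the associated bundle by equivariance from one chosen
  -- point in each fibre; `hwp` shows that the choice is immaterial.
  obtain ⟨w, hw⟩ : ∃ w : ∀ ⦃x : Y⦄, Z.Fib x → (P.bundle.push F).Fib x → Fin 3 → ℝ,
      ∀ ⦃x : Y⦄ (z : Z.Fib x) (r : (P.bundle.push F).Fib x), w z r =
        SO3.vec ((P.bundle.push F).div r (P.bundle.pushMk F (P.bundle.sec (i x) x) 1))
          (n z (P.bundle.sec (i x) x)) :=
    ⟨fun _ _ _ => _, fun _ _ _ => rfl⟩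
  have hwp : ∀ {x : Y} (z : Z.Fib x) (p : P.bundle.Fib x),
      w z (P.bundle.pushMk F p 1) = n z p := by
    intro x z p
    have h1 := P.bundle.push_div F p (P.bundle.div p (P.bundle.sec (i x) x)) 1 1
    rw [P.bundle.act_div, inv_one, one_mul, mul_one] at h1
    refine (hw z (P.bundle.pushMk F p 1)).trans ?_
    rw [h1]
    conv_lhs => rw [← P.bundle.act_div p (P.bundle.sec (i x) x), hact', P.bundle.act_div]
    rw [SO3.vec_vec_inv]
  refine ⟨⟨fun {x} z r => w z r, ?_, ?_, ?_, ?_⟩⟩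
  · intro x z r e g
    have h1 : (P.bundle.push F).div ((P.bundle.push F).act r g)
        (P.bundle.pushMk F (P.bundle.sec (i x) x) 1) =
        g⁻¹ * (P.bundle.push F).div r (P.bundle.pushMk F (P.bundle.sec (i x) x) 1) :=
      (P.bundle.push F).div_act_left _ _ _
    refine (hw (Z.act z e) ((P.bundle.push F).act r g)).trans
      (Eq.trans ?_ (congrArg (fun u => ((e : ℝˣ) : ℝ) • SO3.vec g⁻¹ u) (hw z r).symm))
    rw [h1, hact, SO3.vec_smul, SO3.vec_mul]
  · intro x z r
    exact (congrArg (fun u => u ⬝ᵥ u) (hw z r)).trans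
      ((SO3.dotProduct_vec _ _ _).trans (hunit _ _))
  · intro a j
    exact ((unspinAt k).contDiff.contMDiff.comp_contMDiffOn (smooth_isoGauge φ a j)).congr
      fun x _ => (hwp _ _).trans (hn _ _)
  · intro a j x hx v
    have hO : IsOpen (Z.dom a ∩ P.bundle.dom j) := (Z.isOpen_dom a).inter (P.bundle.isOpen_dom j)
    have h1 : (fun y => w (Z.sec a y) ((P.push F).bundle.sec j y)) = fun y => unspinAt k
        ((isoGauge φ (Z.sec a y) (P.bundle.sec j y) : (Matrix (Fin 2) (Fin 2) ℂ)ˣ) :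
          Matrix (Fin 2) (Fin 2) ℂ) := funext fun y => (hwp _ _).trans (hn _ _)
    have h2 : w (Z.sec a x) ((P.push F).bundle.sec j x) =
      n (Z.sec a x) (P.bundle.sec j x) := hwp _ _
    rw [h1, h2]
    have h3 := hF.spinAt_diff (P.conn.form_mem j x hx.2 v) (n (Z.sec a x) (P.bundle.sec j x))
    have h4 := mvfderiv_isoGauge hφ hx v
    rw [← hψ (Z.sec a x) (P.bundle.sec j x), ← neg_sub, ← h3] at h4
    exact (mvfderiv_clm_comp (unspinAt k) ((smooth_isoGauge φ a j).mdiff hO hx) v).trans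
      ((congrArg (unspinAt k) h4).trans ((map_neg (unspinAt k) _).trans
        (congrArg Neg.neg (unspinAt_spinAt k _))))

end ToAxis

/-! ### The equivalence, and its translation to the moduli spaces -/

variable [HasNegOne G]

theorem tensorFixed_of_reduces (hF : IsAdjoint F k) (h : ReducesWithDet (P.push F) Z) :
    TensorFixed Z P := by
  obtain ⟨W⟩ := nonempty_parallelAxis_of_reduces h
  exact tensorFixed_of_parallelAxis hF W

theorem tensorFixed_iff_reduces [PreconnectedSpace Y] (hF : IsAdjoint F k) (hZ : ¬ Z.IsTrivial) :
    TensorFixed Z P ↔ ReducesWithDet (P.push F) Z := by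
  refine ⟨fun h => ?_, tensorFixed_of_reduces hF⟩
  obtain ⟨W⟩ := nonempty_parallelAxis_of_tensorFixed hF hZ h
  exact W.reducesWithDet

theorem ModuliSU2.tensor_mk_eq_iff (Z : PrincipalBundle Y Z2) (P : GConn Y SU2) :
    ModuliSU2.tensor (.mk Z) (.mk P) = .mk P ↔ TensorFixed Z P := by
  have h : ModuliSU2.tensor (.mk Z) (.mk P) = .mk P ↔ (P.tensor Z).Equiv P := Quotient.eq
  rw [h]
  refine ⟨fun ⟨φ, hφ⟩ => ⟨φ, hφ, fun x z p => ?_⟩, fun ⟨φ, hφ, _⟩ => ⟨φ, hφ⟩⟩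
  exact (Matrix.mem_specialUnitaryGroup_iff.1 ((Submonoid.mem_units_iff _ _).1
    (P.bundle.div p (φ.toFun (tensorMk Z P.bundle z p))).2).1).2

/-- Under `z ⊗ p ↦ p` the map `Det φ` becomes multiplication by the determinant of the gauge
transformation. As the identification with `T` is injective, `Det φ = id` says that this determinant
is one. -/
theorem ModuliU2.tensor_mk_eq_iff {T : GConn Y U1} (Z : PrincipalBundle Y Z2) (P : FixedDet T) :
    ModuliU2.tensor (.mk Z) (.mk P) = .mk P ↔ TensorFixed Z P.toGConn := by
  have h : ModuliU2.tensor (.mk Z) (.mk P) = .mk P ↔ (FixedDet.tensor Z P).Equiv P := Quotient.eq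
  rw [h]
  have key : ∀ (φ : Iso (Z.tensor P.bundle) P.bundle) {x : Y} (z : Z.Fib x) (p : P.bundle.Fib x)
      (h : U1),
      (P.det.toFun ((φ.push detU).toFun
        ((Z.tensor P.bundle).pushMk detU (tensorMk Z P.bundle z p) h)) =
      (FixedDet.tensor Z P).det.toFun
        ((Z.tensor P.bundle).pushMk detU (tensorMk Z P.bundle z p) h)) ↔
      ((P.bundle.div p (φ.toFun (tensorMk Z P.bundle z p)) : (Matrix (Fin 2) (Fin 2) ℂ)ˣ) :
        Matrix (Fin 2) (Fin 2) ℂ).det = 1 := by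
    intro φ x z p h
    have h1 : (FixedDet.tensor Z P).det.toFun
        ((Z.tensor P.bundle).pushMk detU (tensorMk Z P.bundle z p) h) =
        P.det.toFun (P.bundle.pushMk detU p h) :=
      congrArg P.det.toFun (tensorPushIso_mk detU detU_sgn z p h)
    have h3 : (φ.push detU).toFun
        ((Z.tensor P.bundle).pushMk detU (tensorMk Z P.bundle z p) h) =
        P.bundle.pushMk detU (φ.toFun (tensorMk Z P.bundle z p)) h :=
      FixedDet.toFun_push φ (tensorMk Z P.bundle z p) h
    rw [h1, h3]
    refine (P.det.bijective x).1.eq_iff.trans ?_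
    conv_lhs => rw [← P.bundle.act_div p (φ.toFun (tensorMk Z P.bundle z p)), pushMk_act]
    have h2 : ∀ u : U2, (((u : (Matrix (Fin 2) (Fin 2) ℂ)ˣ) :
        Matrix (Fin 2) (Fin 2) ℂ).det = 1 ↔ detU.hom u = 1) := fun u =>
      ⟨fun hu => Subtype.ext (Units.ext hu), fun hu => congrArg (fun c : U1 => ((c : ℂˣ) : ℂ)) hu⟩
    rw [h2]
    refine ⟨fun e => mul_eq_right.1 (P.bundle.pushMk_inj detU e), fun e => by rw [e, one_mul]⟩
  refine ⟨fun ⟨φ, hφ, hd⟩ => ⟨φ, hφ, fun x z p => (key φ z p 1).1 (hd x _)⟩,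
    fun ⟨φ, hφ, hd⟩ => ⟨φ, hφ, fun x c => ?_⟩⟩
  induction c using Quotient.inductionOn with
  | h a =>
  obtain ⟨b, h⟩ := a
  induction b using Quotient.inductionOn with
  | h b => exact (key φ b.1 b.2 h).2 (hd x b.1 b.2)

end FixedPoints

end GaugeTheory

theorem mainTheorem6 {Y : Type*} [TopologicalSpace Y] [T2Space Y] [CompactSpace Y]
    [ConnectedSpace Y] [ChartedSpace (EuclideanSpace ℝ (Fin 2)) Y] [IsManifold (𝓡 2) ∞ Y]
    (k : GaugeTheory.SO3) (Z : GaugeTheory.PrincipalBundle Y GaugeTheory.Z2) :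
    (∀ P : GaugeTheory.GConn Y GaugeTheory.SU2,
      (GaugeTheory.ReducesWithDet (P.push ((GaugeTheory.beta k).comp GaugeTheory.inclSU)) Z →
        GaugeTheory.ModuliSU2.tensor (.mk Z) (.mk P) = .mk P) ∧
      (¬ Z.IsTrivial →
        (GaugeTheory.ModuliSU2.tensor (.mk Z) (.mk P) = .mk P ↔
          GaugeTheory.ReducesWithDet (P.push ((GaugeTheory.beta k).comp GaugeTheory.inclSU)) Z))) ∧
    (∀ (T : GaugeTheory.GConn Y GaugeTheory.U1) (P : GaugeTheory.FixedDet T),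
      (GaugeTheory.ReducesWithDet (P.toGConn.push (GaugeTheory.beta k)) Z →
        GaugeTheory.ModuliU2.tensor (.mk Z) (.mk P) = .mk P) ∧
      (¬ Z.IsTrivial →
        (GaugeTheory.ModuliU2.tensor (.mk Z) (.mk P) = .mk P ↔
          GaugeTheory.ReducesWithDet (P.toGConn.push (GaugeTheory.beta k)) Z))) := by
  have h1 := GaugeTheory.isAdjoint_beta_comp_inclSU k
  have h2 := GaugeTheory.isAdjoint_beta k
  refine ⟨fun P => ?_, fun T P => ?_⟩
  · rw [GaugeTheory.ModuliSU2.tensor_mk_eq_iff]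
    exact ⟨GaugeTheory.tensorFixed_of_reduces h1, GaugeTheory.tensorFixed_iff_reduces h1⟩
  · rw [GaugeTheory.ModuliU2.tensor_mk_eq_iff]
    exact ⟨GaugeTheory.tensorFixed_of_reduces h2, GaugeTheory.tensorFixed_iff_reduces h2⟩
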